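/- Let $\mathbb F_q$ be a finite field with $q$ elements, identified with the set of digits $\{0,1,\dots,q-1\}$ by a bijection that sends $0$ to $0$ and $1$ to $1$, and let $\mathcal G_q(n,k)$ be the set of $k$-dimensional subspaces of $\mathbb F_q^n$, where $0<k<n$. For $X\in\mathcal G_q(n,k)$ let $RE(X)$ be its $k\times n$ generator matrix in reduced row echelon form, and call a column of $RE(X)$ a pivot column if it contains the leading one of a row. The Ferrers diagram $\mathcal F_X$ is given by the sequence $(\mathcal F_1,\dots,\mathcal F_{n-k})$, where $\mathcal F_i$ (the number of dots in column $i$) is the number of pivot columns to the left of the $i$-th non-pivot column, the non-pivot columns being numbered from right to left; its size is $|\mathcal F_X|=\sum_i\mathcal F_i$. The entries $x_1,x_2,\dots,x_{|\mathcal F_X|}$ of the Ferrers tableaux form of $X$ are the entries of $RE(X)$ in the first $\mathcal F_i$ rows of the $i$-th non-pivot column, for $i=1,\dots,n-k$ in this order, each column being read from top to bottom. For two Ferrers diagrams put $\mathcal F<\widetilde{\mathcal F}$ if $|\mathcal F|>|\widetilde{\mathcal F}|$, or if $|\mathcal F|=|\widetilde{\mathcal F}|$ and $\mathcal F_i>\widetilde{\mathcal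 F}_i$ for the least $i$ with $\mathcal F_i\ne\widetilde{\mathcal F}_i$. For $X,Y\in\mathcal G_q(n,k)$ put $X<Y$ if $\mathcal F_X<\mathcal F_Y$, or if $\mathcal F_X=\mathcal F_Y$ and $(x_1,x_2,\dots)$ is lexicographically smaller than $(y_1,y_2,\dots)$. Let $Ind_1(X)$ be the number of $Y\in\mathcal G_q(n,k)$ with $Y<X$. Then encoding ($X\mapsto Ind_1(X)$) and decoding ($i\mapsto X$ with $Ind_1(X)=i$, for $0\le i<|\mathcal G_q(n,k)|$, where such an $X$ exists for every such $i$) have complexity $$O\bigl(k^{5/2}(n-k)^{5/2}\bigr)$$ in digit operations. That is, there are two programs, one for encoding and one for decoding, for a random access machine, and a constant $C$, none of which depends on $q$, $n$, $k$, such that on every input each program halts with the correct output after at most $C\,k^{5/2}(n-k)^{5/2}$ elementary steps. Here subspaces are given by the entries of $RE(X)$ and indices by their base-$q$ digits; the numbers $q,n,k$ are given in registers; each memory cell holds a single base-$q$ digit; the finitely many registers used by a program, and the memory addresses, hold nonnegative integers of at most $O(\log(n+q))$ bits; and reading a literal, reading a register, reading a memory cell, writing to a register or memory cell, addition, truncated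 subtraction, multiplication, comparison and branching on these numbers each count as one step. -/

import Mathlib

namespace GrassmannEnc

section Subspaces

variable {F : Type*} [Field F] {n k : ℕ}

/-- The Grassmannian: all `k`-dimensional subspaces of `F ^ n`. -/
abbrev Grassmannian (F : Type*) [Field F] (n k : ℕ) : Type _ :=
  {X : Submodule F (Fin n → F) // Module.finrank F X = k}

/-- The leading (leftmost nonzero) coefficient of row `r` of `M` is in column `c`. -/
def IsLead (M : Matrix (Fin k) (Fin n) F) (r : Fin k) (c : Fin n) : Prop :=
  M r c ≠ 0 ∧ ∀ c' < c, M r c' = 0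

/-- A `k × n` matrix of rank `k` in reduced row echelon form. -/
structure IsRREF (M : Matrix (Fin k) (Fin n) F) : Prop where
  exists_lead : ∀ r, ∃ c, IsLead M r c
  lead_lt : ∀ ⦃r r' c c'⦄, r < r' → IsLead M r c → IsLead M r' c' → c < c'
  lead_eq_one : ∀ ⦃r c⦄, IsLead M r c → M r c = 1
  eq_zero_of_lead : ∀ ⦃r c⦄, IsLead M r c → ∀ r', r' ≠ r → M r' c = 0

/-- `M` is a generator matrix in reduced row echelon form of the subspace `X`. -/
def IsRREFOf (M : Matrix (Fin k) (Fin n) F) (X : Submodule F (Fin n → F)) : Prop :=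
  IsRREF M ∧ Submodule.span F (Set.range M.row) = X

theorem exists_isRREFOf (X : Grassmannian F n k) :
    ∃ M : Matrix (Fin k) (Fin n) F, IsRREFOf M X.1 := by
  classical
  obtain ⟨X, hX⟩ := X
  let P : Finset (Fin n) :=
    Finset.univ.filter fun c => ∃ x ∈ X, x c ≠ 0 ∧ ∀ c' < c, x c' = 0
  have hP : ∀ c, c ∈ P ↔ ∃ x ∈ X, x c ≠ 0 ∧ ∀ c' < c, x c' = 0 := by
    intro c; simp [P]
  -- a vector of `X` that vanishes on `P` is zero
  have hzero : ∀ x ∈ X, (∀ c ∈ P, x c = 0) → x = 0 := by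
    intro x hx h
    have : ∀ m : ℕ, ∀ c : Fin n, c.val = m → x c = 0 := by
      intro m
      induction m using Nat.strong_induction_on with
      | _ m ih =>
        intro c hc
        by_contra hne
        exact hne (h c ((hP c).2 ⟨x, hx, hne, fun c' hc' =>
          ih c'.val (by rw [← hc]; exact hc') c' rfl⟩))
    funext c
    exact this c.val c rfl
  -- the reduced vectors, by downward recursion on the leading position
  have hred : ∀ m : ℕ, ∀ c : Fin n, c ∈ P → n - c.val = m →
      ∃ y ∈ X, y c = 1 ∧ (∀ c' < c, y c' = 0) ∧ ∀ c' ∈ P, c' ≠ c → y c' = 0 := by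
    intro m
    induction m using Nat.strong_induction_on with
    | _ m ih =>
      intro c hc hm
      obtain ⟨x, hx, hxc, hlt⟩ := (hP c).1 hc
      have hex : ∀ c' : Fin n, ∃ y ∈ X, (c' ∈ P → c < c' → y c' = 1 ∧
          (∀ d < c', y d = 0) ∧ ∀ d ∈ P, d ≠ c' → y d = 0) := by
        intro c'
        by_cases h : c' ∈ P ∧ c < c'
        · have h2 : c.val < c'.val := h.2
          obtain ⟨y, hy, h3⟩ := ih (n - c'.val) (by omega) c' h.1 rfl
          exact ⟨y, hy, fun _ _ => h3⟩
        · exact ⟨0, X.zero_mem, fun h1 h2 => absurd ⟨h1, h2⟩ h⟩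
      choose y hy hy' using hex
      let z : Fin n → F := (x c)⁻¹ • x
      have hz : z ∈ X := X.smul_mem _ hx
      have hzc : z c = 1 := by simp [z, hxc]
      have hzlt : ∀ c' < c, z c' = 0 := fun c' h => by simp [z, hlt c' h]
      let Q := P.filter fun c' => c < c'
      have hQ : ∀ d, d ∈ Q ↔ d ∈ P ∧ c < d := fun d => by simp [Q]
      refine ⟨z - ∑ d ∈ Q, z d • y d,
        X.sub_mem hz (X.sum_mem fun d _ => X.smul_mem _ (hy d)), ?_, ?_, ?_⟩
      · have : ∀ d ∈ Q, (z d • y d) c = 0 := by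
          intro d hd
          have hd' := (hQ d).1 hd
          simp [(hy' d hd'.1 hd'.2).2.1 c hd'.2]
        rw [Pi.sub_apply, Finset.sum_apply, Finset.sum_eq_zero this, hzc, sub_zero]
      · intro c' hc'
        have : ∀ d ∈ Q, (z d • y d) c' = 0 := by
          intro d hd
          have hd' := (hQ d).1 hd
          simp [(hy' d hd'.1 hd'.2).2.1 c' (hc'.trans hd'.2)]
        rw [Pi.sub_apply, Finset.sum_apply, Finset.sum_eq_zero this, hzlt c' hc', sub_zero]
      · intro c' hc' hne
        rw [Pi.sub_apply, Finset.sum_apply]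
        by_cases h : c < c'
        · have hm' : c' ∈ Q := (hQ c').2 ⟨hc', h⟩
          rw [Finset.sum_eq_single_of_mem c' hm']
          · simp [(hy' c' hc' h).1]
          · intro d hd hdc
            have hd' := (hQ d).1 hd
            simp [(hy' d hd'.1 hd'.2).2.2 c' hc' (Ne.symm hdc)]
        · have hlt' : c' < c := lt_of_le_of_ne (not_lt.1 h) hne
          rw [hzlt c' hlt', Finset.sum_eq_zero, sub_zero]
          intro d hd
          have hd' := (hQ d).1 hd
          simp [(hy' d hd'.1 hd'.2).2.1 c' (hlt'.trans hd'.2)]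
  have hred' : ∀ c : P, ∃ y ∈ X, y c = 1 ∧ (∀ c' < c.1, y c' = 0) ∧
      ∀ c' ∈ P, c' ≠ c.1 → y c' = 0 := fun c => hred _ c.1 c.2 rfl
  choose y hyX hy1 hylt hy0 using hred'
  have hexp : ∀ x ∈ X, x = ∑ c : P, x c • y c := by
    intro x hx
    rw [← sub_eq_zero]
    refine hzero _ (X.sub_mem hx (X.sum_mem fun d _ => X.smul_mem _ (hyX d))) ?_
    intro c hc
    rw [Pi.sub_apply, Finset.sum_apply, Finset.sum_eq_single (⟨c, hc⟩ : P)]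
    · simp [hy1 ⟨c, hc⟩]
    · intro d _ hd
      simp [hy0 d c hc fun h => hd (Subtype.ext h.symm)]
    · simp
  have hspan : Submodule.span F (Set.range y) = X := by
    apply le_antisymm
    · rw [Submodule.span_le]
      rintro _ ⟨c, rfl⟩
      exact hyX c
    · intro x hx
      rw [hexp x hx]
      exact Submodule.sum_mem _ fun c _ =>
        Submodule.smul_mem _ _ (Submodule.subset_span ⟨c, rfl⟩)
  have hli : LinearIndependent F y := by
    rw [Fintype.linearIndependent_iff]
    intro g hg c
    have := congrFun hg c.1
    rw [Finset.sum_apply, Finset.sum_eq_single c] at this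
    · simpa [hy1 c] using this
    · intro d _ hd
      simp [hy0 d c c.2 fun h => hd (Subtype.ext h.symm)]
    · simp
  have hcard : P.card = k := by
    rw [← hX, ← hspan, finrank_span_eq_card hli, Fintype.card_coe]
  let p := P.orderIsoOfFin hcard
  have hlead : ∀ r c, IsLead (Matrix.of fun r => y (p r)) r c ↔ c = (p r).1 := by
    intro r c
    constructor
    · rintro ⟨h1, h2⟩
      rcases lt_trichotomy c (p r).1 with h | h | h
      · exact absurd (hylt (p r) c h) h1
      · exact h
      · have := h2 _ h
        simp [hy1 (p r)] at this
    · rintro rfl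
      exact ⟨by simp [hy1 (p r)], fun c' h => hylt (p r) c' h⟩
  refine ⟨Matrix.of fun r => y (p r), ⟨fun r => ⟨_, (hlead r _).2 rfl⟩, ?_, ?_, ?_⟩, ?_⟩
  · intro r r' c c' h hc hc'
    rw [(hlead _ _).1 hc, (hlead _ _).1 hc']
    exact p.strictMono h
  · intro r c hc
    rw [(hlead _ _).1 hc]
    exact hy1 (p r)
  · intro r c hc r' hr
    rw [(hlead _ _).1 hc]
    exact hy0 (p r') _ (p r).2 fun h => hr (p.injective (Subtype.ext h.symm))
  · refine Eq.trans (congrArg (Submodule.span F) ?_) hspan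
    exact p.toEquiv.surjective.range_comp y

/-- `RE(X)`, the generator matrix of `X` in reduced row echelon form. -/
noncomputable def rref (X : Grassmannian F n k) : Matrix (Fin k) (Fin n) F :=
  Classical.choose (exists_isRREFOf X)

open Classical in
/-- The identifying vector of `X`, as the set of the positions of its ones: the columns of
`RE(X)` with the leading coefficients of the rows. -/
noncomputable def idVec (X : Grassmannian F n k) : Finset (Fin n) :=
  Finset.univ.filter fun c => ∃ r, IsLead (rref X) r c

/-- The columns of the echelon Ferrers form of `v` that carry the Ferrers diagram (those at the
zeroes of `v`), from right to left. -/
def ferrersCols (v : Finset (Fin n)) : List (Fin n) :=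
  (List.finRange n).reverse.filter (· ∉ v)

/-- The number of dots in column `c ∉ v` of the echelon Ferrers form of `v`: there is a dot in
each row whose leading one is to the left of `c`, and these are the top rows. -/
def dots (v : Finset (Fin n)) (c : Fin n) : ℕ :=
  (v.filter (· < c)).card

/-- The Ferrers diagram of the echelon Ferrers form of `v`, as the sequence
`𝓕₁, 𝓕₂, …` of the numbers of dots in its columns, numbered from right to left. -/
def ferrers (v : Finset (Fin n)) : List ℕ :=
  (ferrersCols v).map (dots v)

/-- The entries `x₁, x₂, …` of the tableau with shape the Ferrers diagram of `v` and values taken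
from `M`: columns from right to left, each column from top to bottom. -/
def tableau (v : Finset (Fin n)) (M : Matrix (Fin k) (Fin n) F) : List F :=
  (ferrersCols v).flatMap fun c =>
    ((List.finRange k).filter fun r : Fin k => r.val < dots v c).map fun r => M r c

/-- The order of Ferrers diagrams: larger size first; for equal sizes, the diagram with more dots
in the first column where they differ first. -/
def FerrersLT (A B : List ℕ) : Prop :=
  B.sum < A.sum ∨ A.sum = B.sum ∧ List.Lex (· > ·) A B

/-- The order of the Grassmannian based on the Ferrers tableaux forms. The field elements are
ordered, and read as base-`q` digits, by means of `e`. -/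
def GrassLT {q : ℕ} (e : F ≃ Fin q) (X Y : Grassmannian F n k) : Prop :=
  FerrersLT (ferrers (idVec X)) (ferrers (idVec Y)) ∨
    ferrers (idVec X) = ferrers (idVec Y) ∧
      List.Lex (· < ·) ((tableau (idVec X) (rref X)).map e) ((tableau (idVec Y) (rref Y)).map e)

/-- `Ind₁(X)`: the index of `X` (counted from `0`) in the order based on the Ferrers tableaux
forms. -/
noncomputable def ind₁ {q : ℕ} (e : F ≃ Fin q) (X : Grassmannian F n k) : ℕ :=
  Nat.card {Y : Grassmannian F n k // GrassLT e Y X}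

end Subspaces

section Machine

/-- A state of the random access machine: the contents of the registers and of the arrays. -/
structure State where
  reg : ℕ → ℕ
  arr : ℕ → ℕ → ℕ

/-- Expressions: literals, registers, array cells, sum, truncated difference, product and
comparisons (with value `0` or `1`). -/
inductive Expr where
  | lit (m : ℕ)
  | reg (r : ℕ)
  | cell (a : ℕ) (i : Expr)
  | add (e f : Expr)
  | sub (e f : Expr)
  | mul (e f : Expr)
  | lt (e f : Expr)
  | eq (e f : Expr)

namespace Expr

def val (s : State) : Expr → ℕ
  | lit m => m
  | reg r => s.reg r
  | cell a i => s.arr a (i.val s)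
  | add e f => e.val s + f.val s
  | sub e f => e.val s - f.val s
  | mul e f => e.val s * f.val s
  | lt e f => if e.val s < f.val s then 1 else 0
  | eq e f => if e.val s = f.val s then 1 else 0

/-- The number of elementary operations used to evaluate an expression. -/
def cost : Expr → ℕ
  | lit _ => 1
  | reg _ => 1
  | cell _ i => i.cost + 1
  | add e f | sub e f | mul e f | lt e f | eq e f => e.cost + f.cost + 1

/-- No value that occurs in the evaluation exceeds `B`. -/
def Fits (B : ℕ) (s : State) : Expr → Prop
  | lit m => m ≤ B
  | reg r => s.reg r ≤ B
  | cell a i => i.Fits B s ∧ s.arr a (i.val s) ≤ B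
  | add e f => e.Fits B s ∧ f.Fits B s ∧ e.val s + f.val s ≤ B
  | mul e f => e.Fits B s ∧ f.Fits B s ∧ e.val s * f.val s ≤ B
  | sub e f | lt e f | eq e f => e.Fits B s ∧ f.Fits B s

end Expr

/-- Programs. `set r e` writes to register `r`, `store a i e` to cell `i` of array `a`;
a nonzero value of a condition means true. -/
inductive Prog where
  | skip
  | set (r : ℕ) (e : Expr)
  | store (a : ℕ) (i e : Expr)
  | seq (c d : Prog)
  | ite (b : Expr) (c d : Prog)
  | loop (b : Expr) (c : Prog)

/-- `Exec q B c s t s'`: started in `s`, the program `c` halts after exactly `t` elementary steps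
in `s'`, on the machine whose array cells hold one base-`q` digit each and whose registers and
addresses are bounded by `B`. An operation that violates these bounds has no successor state, so
a program that attempts it does not halt. -/
inductive Exec (q B : ℕ) : Prog → State → ℕ → State → Prop where
  | skip (s : State) : Exec q B .skip s 1 s
  | set (s : State) (r : ℕ) (e : Expr) (he : e.Fits B s) :
      Exec q B (.set r e) s (e.cost + 1)
        { s with reg := Function.update s.reg r (e.val s) }
  | store (s : State) (a : ℕ) (i e : Expr) (hi : i.Fits B s) (he : e.Fits B s)
      (hq : e.val s < q) :
      Exec q B (.store a i e) s (i.cost + e.cost + 1)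
        { s with arr := Function.update s.arr a
                  (Function.update (s.arr a) (i.val s) (e.val s)) }
  | seq {c d : Prog} {s s' s'' : State} {t t' : ℕ}
      (hc : Exec q B c s t s') (hd : Exec q B d s' t' s'') :
      Exec q B (.seq c d) s (t + t') s''
  | ite_true {b : Expr} {c d : Prog} {s s' : State} {t : ℕ} (hb : b.Fits B s)
      (h : b.val s ≠ 0) (hc : Exec q B c s t s') :
      Exec q B (.ite b c d) s (b.cost + 1 + t) s'
  | ite_false {b : Expr} {c d : Prog} {s s' : State} {t : ℕ} (hb : b.Fits B s)
      (h : b.val s = 0) (hd : Exec q B d s t s') :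
      Exec q B (.ite b c d) s (b.cost + 1 + t) s'
  | loop_true {b : Expr} {c : Prog} {s s' s'' : State} {t t' : ℕ} (hb : b.Fits B s)
      (h : b.val s ≠ 0) (hc : Exec q B c s t s') (hl : Exec q B (.loop b c) s' t' s'') :
      Exec q B (.loop b c) s (b.cost + 1 + t + t') s''
  | loop_false {b : Expr} {c : Prog} {s : State} (hb : b.Fits B s) (h : b.val s = 0) :
      Exec q B (.loop b c) s (b.cost + 1) s

/-- The initial state: the parameters `q, n, k` in registers `0, 1, 2`, the input in array `0`,
and zero everywhere else. -/
def initState (q n k : ℕ) (input : ℕ → ℕ) : State where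
  reg r := if r = 0 then q else if r = 1 then n else if r = 2 then k else 0
  arr a := if a = 0 then input else fun _ => 0

/-- With the parameters `q, n, k` and the given input, the program halts after at most `T` steps
with the given output in array `1`. -/
def ComputesWithin (c : Prog) (q n k B : ℕ) (input output : ℕ → ℕ) (T : ℝ) : Prop :=
  ∃ (t : ℕ) (s : State), Exec q B c (initState q n k input) t s ∧ s.arr 1 = output ∧ (t : ℝ) ≤ T

end Machine

/-- The array of the base-`q` digits of `m`, least significant digit in cell `0`. -/
def digitArray (q m : ℕ) : ℕ → ℕ :=
  fun j => m / q ^ j % q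

/-- The array with the entries of a `k × n` matrix, row by row, each entry as a base-`q` digit:
the entry in row `r` and column `c` is in cell `r * n + c`. -/
def matrixArray {F : Type*} {n k q : ℕ} (e : F ≃ Fin q) (M : Matrix (Fin k) (Fin n) F) : ℕ → ℕ :=
  fun j => if h : j < k * n then
    (e (M (Fin.divNat (⟨j, h⟩ : Fin (k * n))) (Fin.modNat (⟨j, h⟩ : Fin (k * n)))) : ℕ) else 0

end GrassmannEnc

/-! Put h = n - k and N = k * h. The Ferrers diagrams that occur are exactly the partitions with at
most h parts (the columns), each at most k. If P_i is the number of those with i dots, then each of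
them carries q^i tableaux. Since larger diagrams come first, the index of X with m dots is Σ_{i > m}
P_i q^i + q^m * (rank of the diagram among those of size m) + (the tableau read as a base-q number).
This is `grassIdx`. It is strictly increasing for the order of the Grassmannian
(`grassIdx_lt_of_grassLT`) and takes every value below Σ P_i q^i (`exists_grassIdx_eq`), so it
equals `ind₁` (`ind₁_eq_grassIdx`).

The rank of a diagram is computed column by column. Among diagrams of a given size in an a × b box,
those whose first column is full (`topPart`) precede the others. They are the ones whose rightmost
matrix column is not a pivot. So each pivot column adds one restricted partition number to the rank
(`pathIdx`), and comparing a rank with that number decides whether the last column is a pivot.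

The complexity rests on the fact that partition numbers are small: a partition number of i ≤ N is
below 2^(5(√N + 1)) (`boxPart_lt`), by bounding a coefficient of ∏ 1/(1 - x^j) through the value of
the product at x = s/(s + 1), with s about √N. Hence L = O(√N) digits suffice for each entry of the
table of all `boxPart a b i` with a ≤ k, b ≤ h, i ≤ N. The table has O(N²) entries, each obtained by
one addition of O(√N) digits, for a total of O(N^(5/2)). Everything else is O(N) additions,
subtractions or comparisons of numbers with L + N + 1 digits, where a multiplication by a power of q
is only a shift of position. That is O(N²).

The programs are verified by Hoare triples with a time bound (`Tri`). A bound D on the registers is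
maintained, and each expression used has at most 64 leaves, so no intermediate value exceeds D^64.
With D = (n + q)^8 this is polynomial in n + q. -/

namespace GrassmannEnc

/-! ### A Hoare logic with running times for the random access machine -/

section Logic

/-- The number of leaves of an expression, not counting the branching at array cells. -/
def Expr.leaves : Expr → ℕ
  | lit _ => 1
  | reg _ => 1
  | cell _ i => i.leaves
  | add e f | sub e f | mul e f | lt e f | eq e f => e.leaves + f.leaves

/-- The largest literal of an expression. -/
def Expr.maxLit : Expr → ℕ
  | lit m => m
  | reg _ => 0
  | cell _ i => i.maxLit
  | add e f | sub e f | mul e f | lt e f | eq e f => max e.maxLit f.maxLit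

/-- Expressions with at most `64` leaves and no literal above `5`. -/
def Expr.Small (e : Expr) : Prop := e.leaves ≤ 64 ∧ e.maxLit ≤ 5

instance (e : Expr) : Decidable e.Small := inferInstanceAs (Decidable (_ ∧ _))

/-- All registers are bounded by `D` and all cells hold base-`q` digits. -/
structure Good (q D : ℕ) (s : State) : Prop where
  five_le : 5 ≤ D
  two_mul_le : 2 * q ≤ D
  reg_le : ∀ r, s.reg r ≤ D
  arr_lt : ∀ a i, s.arr a i < q

theorem Expr.one_le_leaves (e : Expr) : 1 ≤ e.leaves := by
  induction e <;> simp only [Expr.leaves] <;> omega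

/-- Both powers are at least 2, and for such numbers a sum is at most the product. This lets
addition be treated like multiplication when leaves are counted. -/
theorem add_le_pow_add {D x y a b : ℕ} (hD : 2 ≤ D) (ha : 1 ≤ a) (hb : 1 ≤ b)
    (hx : x ≤ D ^ a) (hy : y ≤ D ^ b) : x + y ≤ D ^ (a + b) := by
  have h1 : 2 ≤ D ^ a := hD.trans (Nat.le_self_pow (by omega) D)
  have h2 : 2 ≤ D ^ b := hD.trans (Nat.le_self_pow (by omega) D)
  rw [pow_add]
  nlinarith

/-- Each leaf contributes one factor `D`: registers and literals are at most `D`, and a cell holds a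
digit below `q ≤ D` whatever its address is. Every operation at most multiplies the bounds. -/
theorem Expr.val_le {q D : ℕ} {s : State} (hs : Good q D s) :
    ∀ e : Expr, e.maxLit ≤ 5 → e.val s ≤ D ^ e.leaves
  | lit m, h => by
    simp only [Expr.maxLit] at h
    simpa [Expr.val, Expr.leaves] using h.trans hs.five_le
  | reg r, _ => by simpa [Expr.val, Expr.leaves] using hs.reg_le r
  | cell a i, _ => by
    have h1 := hs.arr_lt a (i.val s)
    have h2 := hs.two_mul_le
    have h3 : D ≤ D ^ i.leaves := Nat.le_self_pow (by have := i.one_le_leaves; omega) D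
    simp only [Expr.val, Expr.leaves]
    omega
  | add e f, h => by
    simp only [Expr.maxLit, max_le_iff] at h
    have := hs.five_le
    exact add_le_pow_add (by omega) e.one_le_leaves f.one_le_leaves
      (val_le hs e h.1) (val_le hs f h.2)
  | sub e f, h => by
    simp only [Expr.maxLit, max_le_iff] at h
    have := hs.five_le
    exact le_trans (by simp only [Expr.val]; omega) <|
      add_le_pow_add (by omega) e.one_le_leaves f.one_le_leaves
      (val_le hs e h.1) (val_le hs f h.2)
  | mul e f, h => by
    simp only [Expr.maxLit, max_le_iff] at h
    simp only [Expr.val, Expr.leaves, pow_add]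
    exact Nat.mul_le_mul (val_le hs e h.1) (val_le hs f h.2)
  | lt e f, h => by
    have : 1 ≤ D ^ (e.leaves + f.leaves) := Nat.one_le_pow _ _ (by have := hs.five_le; omega)
    simp only [Expr.val, Expr.leaves]
    split_ifs <;> omega
  | eq e f, h => by
    have : 1 ≤ D ^ (e.leaves + f.leaves) := Nat.one_le_pow _ _ (by have := hs.five_le; omega)
    simp only [Expr.val, Expr.leaves]
    split_ifs <;> omega

theorem Expr.fits_of_le {q D M : ℕ} {s : State} (hs : Good q D s) (e : Expr)
    (hl : e.maxLit ≤ 5) (hM : e.leaves ≤ M) : e.Fits (D ^ M) s := by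
  have hD : 0 < D := by have := hs.five_le; omega
  have hv : ∀ e : Expr, e.maxLit ≤ 5 → e.leaves ≤ M → e.val s ≤ D ^ M :=
    fun e h h' => (e.val_le hs h).trans (Nat.pow_le_pow_right hD h')
  have h0 := hv e hl hM
  induction e with
  | lit m => exact h0
  | reg r => exact h0
  | cell a i ih => exact ⟨ih hl hM (hv _ hl hM), h0⟩
  | add e f ihe ihf | mul e f ihe ihf =>
    simp only [Expr.maxLit, max_le_iff, Expr.leaves] at hl hM
    exact ⟨ihe hl.1 (by omega) (hv _ hl.1 (by omega)),
      ihf hl.2 (by omega) (hv _ hl.2 (by omega)), h0⟩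
  | sub e f ihe ihf | lt e f ihe ihf | eq e f ihe ihf =>
    simp only [Expr.maxLit, max_le_iff, Expr.leaves] at hl hM
    exact ⟨ihe hl.1 (by omega) (hv _ hl.1 (by omega)),
      ihf hl.2 (by omega) (hv _ hl.2 (by omega))⟩

/-- `Small` does not depend on the state and is decidable, so for the concrete expressions of the
programs all overflow conditions reduce to `decide`. -/
theorem Expr.Small.fits {q D : ℕ} {s : State} {e : Expr} (he : e.Small) (hs : Good q D s) :
    e.Fits (D ^ 64) s :=
  e.fits_of_le hs he.2 he.1

/-- Write `v` to register `r`. -/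
def State.setReg (s : State) (r v : ℕ) : State :=
  { s with reg := Function.update s.reg r v }

/-- Write `v` to cell `i` of array `a`. -/
def State.setCell (s : State) (a i v : ℕ) : State :=
  { s with arr := Function.update s.arr a (Function.update (s.arr a) i v) }

@[simp] theorem State.setReg_reg (s : State) (r v r' : ℕ) :
    (s.setReg r v).reg r' = if r' = r then v else s.reg r' := by
  simp [State.setReg, Function.update_apply]

@[simp] theorem State.setReg_arr (s : State) (r v : ℕ) : (s.setReg r v).arr = s.arr := rfl

@[simp] theorem State.setCell_reg (s : State) (a i v : ℕ) : (s.setCell a i v).reg = s.reg := rfl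

theorem State.setCell_arr (s : State) (a i v a' i' : ℕ) :
    (s.setCell a i v).arr a' i' = if a' = a ∧ i' = i then v else s.arr a' i' := by
  by_cases h : a' = a
  · subst h
    simp [State.setCell, Function.update_apply]
  · simp [State.setCell, h]

@[simp] theorem State.setCell_arr_self (s : State) (a i v i' : ℕ) :
    (s.setCell a i v).arr a i' = if i' = i then v else s.arr a i' := by
  simp [State.setCell_arr]

theorem State.setCell_arr_ne (s : State) {a a' : ℕ} (i v : ℕ) (h : a' ≠ a) :
    (s.setCell a i v).arr a' = s.arr a' := by
  simp [State.setCell, h]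

/-- Started in `s` with bounded registers, `c` halts within `T` steps in a state with bounded
registers that satisfies `Q`. -/
def Tri (q D : ℕ) (c : Prog) (T : ℕ) (Q : State → Prop) (s : State) : Prop :=
  Good q D s → ∃ t s', Exec q (D ^ 64) c s t s' ∧ t ≤ T ∧ Good q D s' ∧ Q s'

namespace Tri

variable {q D T T' T₁ T₂ : ℕ} {c d : Prog} {Q Q' : State → Prop} {s : State}

theorem mono (h : Tri q D c T Q s) (hT : T ≤ T') (hQ : ∀ s', Q s' → Q' s') :
    Tri q D c T' Q' s := fun hs => by
  obtain ⟨t, s', h1, h2, h3, h4⟩ := h hs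
  exact ⟨t, s', h1, h2.trans hT, h3, hQ _ h4⟩

theorem time (h : Tri q D c T Q s) (hT : T ≤ T') : Tri q D c T' Q s :=
  h.mono hT fun _ => id

theorem post (h : Tri q D c T Q s) (hQ : ∀ s', Good q D s' → Q s' → Q' s') :
    Tri q D c T Q' s := fun hs => by
  obtain ⟨t, s', h1, h2, h3, h4⟩ := h hs
  exact ⟨t, s', h1, h2, h3, hQ _ h3 h4⟩

theorem skip (h : Q s) : Tri q D .skip 1 Q s :=
  fun hs => ⟨1, s, .skip s, le_rfl, hs, h⟩

theorem set {r : ℕ} {e : Expr} (he : e.Small) (hD : Good q D s → e.val s ≤ D)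
    (h : Q (s.setReg r (e.val s))) : Tri q D (.set r e) (e.cost + 1) Q s := fun hs => by
  refine ⟨_, _, .set s r e (he.fits hs), le_rfl, ⟨hs.1, hs.2, fun r' => ?_, hs.4⟩, h⟩
  change (s.setReg r (e.val s)).reg r' ≤ D
  rw [State.setReg_reg]
  split_ifs
  · exact hD hs
  · exact hs.reg_le r'

theorem store {a : ℕ} {i e : Expr} (hi : i.Small) (he : e.Small)
    (hq : Good q D s → e.val s < q)
    (h : Q (s.setCell a (i.val s) (e.val s))) :
    Tri q D (.store a i e) (i.cost + e.cost + 1) Q s := fun hs => by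
  refine ⟨_, _, .store s a i e (hi.fits hs) (he.fits hs) (hq hs), le_rfl,
    ⟨hs.1, hs.2, hs.3, fun a' i' => ?_⟩, h⟩
  change (s.setCell a (i.val s) (e.val s)).arr a' i' < q
  rw [State.setCell_arr]
  split_ifs
  · exact hq hs
  · exact hs.arr_lt a' i'

theorem seq (hc : Tri q D c T₁ Q' s) (hd : ∀ s', Q' s' → Tri q D d T₂ Q s') :
    Tri q D (.seq c d) (T₁ + T₂) Q s := fun hs => by
  obtain ⟨t, s', h1, h2, h3, h4⟩ := hc hs
  obtain ⟨t', s'', h1', h2', h3', h4'⟩ := hd s' h4 h3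
  exact ⟨_, s'', .seq h1 h1', by omega, h3', h4'⟩

theorem set_seq {r : ℕ} {e : Expr} (he : e.Small) (hD : Good q D s → e.val s ≤ D)
    (h : Tri q D d T Q (s.setReg r (e.val s))) :
    Tri q D (.seq (.set r e) d) (e.cost + 1 + T) Q s :=
  seq (Q' := fun s' => s' = s.setReg r (e.val s)) (set he hD rfl) fun _ h' => h' ▸ h

theorem store_seq {a : ℕ} {i e : Expr} (hi : i.Small) (he : e.Small)
    (hq : Good q D s → e.val s < q)
    (h : Tri q D d T Q (s.setCell a (i.val s) (e.val s))) :
    Tri q D (.seq (.store a i e) d) (i.cost + e.cost + 1 + T) Q s :=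
  seq (Q' := fun s' => s' = s.setCell a (i.val s) (e.val s)) (store hi he hq rfl)
    fun _ h' => h' ▸ h

theorem ite {b : Expr} (hb : b.Small) (h1 : b.val s ≠ 0 → Tri q D c T₁ Q s)
    (h2 : b.val s = 0 → Tri q D d T₂ Q s) :
    Tri q D (.ite b c d) (b.cost + 1 + (T₁ + T₂)) Q s := fun hs => by
  by_cases h : b.val s = 0
  · obtain ⟨t, s', h1, h2, h3, h4⟩ := h2 h hs
    exact ⟨_, s', .ite_false (hb.fits hs) h h1, by omega, h3, h4⟩
  · obtain ⟨t, s', h1, h2, h3, h4⟩ := h1 h hs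
    exact ⟨_, s', .ite_true (hb.fits hs) h h1, by omega, h3, h4⟩

end Tri

/-- `for i = 0, …, e - 1 do c`, with the counter in register `i`. -/
def Prog.forLoop (i : ℕ) (e : Expr) (c : Prog) : Prog :=
  .seq (.set i (.lit 0))
    (.loop (.lt (.reg i) e) (.seq c (.set i (.add (.reg i) (.lit 1)))))

/-- Induction on the number of passes that remain. The invariant is required after the increment of
the counter, which is why `hstep` speaks of `s''.setReg i (j + 1)`. One pass costs the body, the
guard (`e.cost + 3`) and the increment (4); the initialisation (2) and the last guard give the
additive `e.cost + 5`. -/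
theorem Tri.forLoop {q D T m i : ℕ} {e : Expr} {c : Prog} {s : State} (Inv : ℕ → State → Prop)
    (he : (Expr.lt (.reg i) e).Small) (hm : m ≤ D)
    (hval : ∀ j s', Inv j s' → e.val s' = m)
    (h0 : Inv 0 (s.setReg i 0))
    (hstep : ∀ j s', j < m → s'.reg i = j → Good q D s' → Inv j s' →
      Tri q D c T (fun s'' => s''.reg i = j ∧ Inv (j + 1) (s''.setReg i (j + 1))) s') :
    Tri q D (.forLoop i e c) (m * (T + e.cost + 7) + e.cost + 5)
      (fun s' => s'.reg i = m ∧ Inv m s') s := by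
  refine Tri.time (Tri.set_seq (T := m * (T + e.cost + 7) + e.cost + 3) (by decide)
    (fun _ => Nat.zero_le _) ?_) ?_
  swap
  · simp [Expr.cost]; omega
  have key : ∀ d j s', j + d = m → s'.reg i = j → Inv j s' →
      Tri q D (.loop (.lt (.reg i) e) (.seq c (.set i (.add (.reg i) (.lit 1)))))
        (d * (T + e.cost + 7) + e.cost + 3) (fun s' => s'.reg i = m ∧ Inv m s') s' := by
    intro d
    induction d with
    | zero =>
      intro j s' hj hi hI hs
      obtain rfl : j = m := by omega
      refine ⟨_, s', .loop_false (he.fits hs) ?_, ?_, hs, hi, hI⟩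
      · simp [Expr.val, hval j s' hI, hi]
      · simp [Expr.cost]; omega
    | succ d ih =>
      intro j s' hj hi hI hs
      have hbody : Tri q D (.seq c (.set i (.add (.reg i) (.lit 1)))) (T + 4)
          (fun s'' => s''.reg i = j + 1 ∧ Inv (j + 1) s'') s' := by
        refine Tri.seq (hstep j s' (by omega) hi hs hI) fun s'' h => ?_
        refine Tri.set (e := .add (.reg i) (.lit 1)) (by simp [Expr.Small, Expr.leaves, Expr.maxLit]) (fun _ => ?_) ?_
        · simp only [Expr.val, h.1]; omega
        · simp only [Expr.val, h.1]
          exact ⟨by simp, h.2⟩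
      obtain ⟨t, s₁, e1, t1, g1, i1, I1⟩ := hbody hs
      obtain ⟨t', s₂, e2, t2, g2, i2⟩ := ih (j + 1) s₁ (by omega) i1 I1 g1
      refine ⟨_, s₂, .loop_true (he.fits hs) ?_ e1 e2, ?_, g2, i2⟩
      · simp [Expr.val, hval j s' hI, hi]; omega
      · rw [Nat.succ_mul]
        simp only [Expr.cost]
        omega
  exact key m 0 _ (by omega) (by simp [Expr.val]) h0

end Logic

/-! ### Base-q digits, carries and borrows -/

section Digits

variable {q : ℕ}

theorem mod_pow_succ_eq (q z p : ℕ) : z % q ^ (p + 1) = z % q ^ p + q ^ p * (z / q ^ p % q) :=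
  Nat.mod_pow_succ

/-- The carry into position `p` when `x`, `y` and `c₀` are added in base `q`. -/
def carry (q c₀ x y p : ℕ) : ℕ := (x % q ^ p + y % q ^ p + c₀) / q ^ p

theorem carry_zero (q c₀ x y : ℕ) : carry q c₀ x y 0 = c₀ := by
  simp [carry, Nat.mod_one]

/-- Dividing by `q ^ (p + 1)` is dividing by `q ^ p` and then by `q`; the first division turns the
lower parts into the old carry and leaves the two digits at position `p`. -/
theorem carry_succ (hq : 0 < q) (c₀ x y p : ℕ) :
    carry q c₀ x y (p + 1) = (x / q ^ p % q + y / q ^ p % q + carry q c₀ x y p) / q := by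
  have hp : 0 < q ^ p := by positivity
  unfold carry
  rw [mod_pow_succ_eq, mod_pow_succ_eq, pow_succ, ← Nat.div_div_eq_div_mul]
  congr 1
  rw [show x % q ^ p + q ^ p * (x / q ^ p % q) + (y % q ^ p + q ^ p * (y / q ^ p % q)) + c₀
    = (x % q ^ p + y % q ^ p + c₀) + q ^ p * (x / q ^ p % q + y / q ^ p % q) by ring,
    Nat.add_mul_div_left _ _ hp]
  ring

theorem carry_le_one (hq : 0 < q) {c₀ : ℕ} (hc : c₀ ≤ 1) (x y p : ℕ) :
    carry q c₀ x y p ≤ 1 := by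
  have hp : 0 < q ^ p := by positivity
  have h1 := Nat.mod_lt x hp
  have h2 := Nat.mod_lt y hp
  unfold carry
  exact Nat.lt_succ_iff.1 ((Nat.div_lt_iff_lt_mul hp).2 (by omega))

theorem digit_add (hq : 0 < q) (c₀ x y p : ℕ) :
    (x + y + c₀) / q ^ p % q =
      (x / q ^ p % q + y / q ^ p % q + carry q c₀ x y p) % q := by
  have hp : 0 < q ^ p := by positivity
  have h : (x + y + c₀) / q ^ p = x / q ^ p + y / q ^ p + carry q c₀ x y p := by
    unfold carry
    conv_lhs => rw [← Nat.mod_add_div x (q ^ p), ← Nat.mod_add_div y (q ^ p)]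
    rw [show x % q ^ p + q ^ p * (x / q ^ p) + (y % q ^ p + q ^ p * (y / q ^ p)) + c₀
      = (x % q ^ p + y % q ^ p + c₀) + q ^ p * (x / q ^ p + y / q ^ p) by ring,
      Nat.add_mul_div_left _ _ hp]
    ring
  rw [h]
  simp [Nat.add_mod]

/-- The borrow into position `p` when `y` is subtracted from `z` in base `q`. -/
def borrow (q z y p : ℕ) : ℕ := if z % q ^ p < y % q ^ p then 1 else 0

theorem borrow_zero (q z y : ℕ) : borrow q z y 0 = 0 := by simp [borrow, Nat.mod_one]

theorem borrow_le_one (q z y p : ℕ) : borrow q z y p ≤ 1 := by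
  unfold borrow; split_ifs <;> omega

/-- Truncations to `p + 1` digits are compared by their top digits first; the lower digits matter
only in case of equality, and then they enter as the old borrow. -/
theorem borrow_succ (hq : 0 < q) (z y p : ℕ) :
    borrow q z y (p + 1) = if z / q ^ p % q < y / q ^ p % q + borrow q z y p then 1 else 0 := by
  have hp : 0 < q ^ p := by positivity
  have h1 := Nat.mod_lt z hp
  have h2 := Nat.mod_lt y hp
  unfold borrow
  rw [mod_pow_succ_eq, mod_pow_succ_eq]
  generalize z % q ^ p = a at *
  generalize y % q ^ p = b at *
  generalize z / q ^ p % q = u at *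
  generalize y / q ^ p % q = v at *
  generalize q ^ p = Q at *
  congr 1
  rw [eq_iff_iff]
  rcases lt_trichotomy u v with h | h | h
  · have : Q * (u + 1) ≤ Q * v := Nat.mul_le_mul_left _ h
    rw [mul_add] at this
    constructor
    · intro _; omega
    · intro _; omega
  · subst h
    split_ifs <;> omega
  · have : Q * (v + 1) ≤ Q * u := Nat.mul_le_mul_left _ h
    rw [mul_add] at this
    split_ifs <;> omega

theorem borrow_eq_zero_iff {z y p : ℕ} (hz : z < q ^ p) (hy : y < q ^ p) :
    borrow q z y p = 0 ↔ y ≤ z := by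
  rw [borrow, Nat.mod_eq_of_lt hz, Nat.mod_eq_of_lt hy]
  split_ifs <;> simp <;> omega

/-- For z = x + y the borrows of z - y are the carries of x + y, so this is the addition rule read
backwards. It is stated without natural subtraction, so that it determines the digit of the
difference. -/
theorem digit_sub (hq : 0 < q) {z y : ℕ} (h : y ≤ z) (p : ℕ) :
    (z - y) / q ^ p % q + (y / q ^ p % q + borrow q z y p) =
      z / q ^ p % q + q * borrow q z y (p + 1) := by
  obtain ⟨x, rfl⟩ := Nat.exists_eq_add_of_le' h
  rw [Nat.add_sub_cancel]
  have hcb : ∀ p, borrow q (x + y) y p = carry q 0 x y p := by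
    intro p
    have hp : 0 < q ^ p := by positivity
    have h1 := Nat.mod_lt x hp
    have h2 := Nat.mod_lt y hp
    unfold borrow carry
    rw [Nat.add_mod, add_zero]
    by_cases hlt : x % q ^ p + y % q ^ p < q ^ p
    · rw [Nat.mod_eq_of_lt hlt, Nat.div_eq_of_lt hlt]
      simp
    · have h3 : x % q ^ p + y % q ^ p = q ^ p + (x % q ^ p + y % q ^ p - q ^ p) := by omega
      rw [h3, Nat.add_mod_left, Nat.mod_eq_of_lt (by omega), Nat.add_div_left _ hp,
        Nat.div_eq_of_lt (by omega), if_pos (by omega)]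
  have h1 := digit_add hq 0 x y p
  rw [add_zero] at h1
  rw [hcb, hcb, h1, carry_succ hq, Nat.mod_add_div, add_assoc]

theorem digit_mul_pow (hq : 0 < q) (y o p : ℕ) :
    y * q ^ o / q ^ p % q = if p < o then 0 else y / q ^ (p - o) % q := by
  split_ifs with h
  · obtain ⟨d, rfl⟩ := Nat.exists_eq_add_of_lt h
    rw [show y * q ^ (p + d + 1) = y * q ^ d * q * q ^ p by ring,
      Nat.mul_div_cancel _ (by positivity), Nat.mul_mod_left]
  · obtain ⟨d, rfl⟩ := Nat.exists_eq_add_of_le (not_lt.1 h)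
    rw [pow_add, Nat.add_sub_cancel_left, mul_comm (q ^ o), Nat.mul_div_mul_right _ _ (by positivity)]

theorem digit_eq_zero {z p : ℕ} (h : z < q ^ p) : z / q ^ p % q = 0 := by
  rw [Nat.div_eq_of_lt h, Nat.zero_mod]

theorem digitArray_eq_zero (hq : 0 < q) {z W p : ℕ} (h : z < q ^ W) (hp : W ≤ p) :
    digitArray q z p = 0 :=
  digit_eq_zero (h.trans_le (Nat.pow_le_pow_right hq hp))

theorem digitArray_lt (hq : 0 < q) (z p : ℕ) : digitArray q z p < q := Nat.mod_lt _ hq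

/-- The decoder works on q^m * rank + tableau. The digits of the tableau can be read there while the
rank above them changes. -/
theorem digitArray_add_mul_pow {t m : ℕ} (ht : t < q ^ m) (u : ℕ) {p : ℕ} (hp : p < m) :
    digitArray q (q ^ m * u + t) p = digitArray q t p := by
  have hq : 0 < q := by
    rcases Nat.eq_zero_or_pos q with rfl | h
    · rw [zero_pow (by omega)] at ht; omega
    · exact h
  obtain ⟨d, rfl⟩ := Nat.exists_eq_add_of_lt hp
  unfold digitArray
  rw [show q ^ (p + d + 1) * u + t = t + q ^ p * (q * (q ^ d * u)) by ring,
    Nat.add_mul_div_left _ _ (by positivity), Nat.add_mul_mod_self_left]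

/-- The number with the base-`q` digits `l`, most significant digit first. -/
def numOf (q : ℕ) : List ℕ → ℕ
  | [] => 0
  | d :: l => d * q ^ l.length + numOf q l

theorem numOf_append (q : ℕ) (l l' : List ℕ) :
    numOf q (l ++ l') = numOf q l * q ^ l'.length + numOf q l' := by
  induction l with
  | nil => simp [numOf]
  | cons d l ih => simp only [List.cons_append, numOf, ih, List.length_append]; ring

theorem numOf_lt {l : List ℕ} (h : ∀ d ∈ l, d < q) : numOf q l < q ^ l.length := by
  induction l with
  | nil => simp [numOf]
  | cons d l ih =>
    have h1 : numOf q l < q ^ l.length := ih fun d hd => h d (List.mem_cons_of_mem _ hd)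
    have h2 : (d + 1) * q ^ l.length ≤ q * q ^ l.length :=
      Nat.mul_le_mul_right _ (h d List.mem_cons_self)
    simp only [numOf, List.length_cons, pow_succ]
    nlinarith

theorem numOf_lt_of_lex {l l' : List ℕ} (h : ∀ d ∈ l, d < q) (hlen : l.length = l'.length)
    (hlex : List.Lex (· < ·) l l') : numOf q l < numOf q l' := by
  induction hlex with
  | nil => simp at hlen
  | @cons a l l' _ ih =>
    simp only [List.length_cons, add_left_inj] at hlen
    have := ih (fun d hd => h d (List.mem_cons_of_mem _ hd)) hlen
    simp only [numOf, hlen]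
    omega
  | @rel a l b l' hab =>
    simp only [List.length_cons, add_left_inj] at hlen
    have h1 : numOf q l < q ^ l.length := numOf_lt fun d hd => h d (List.mem_cons_of_mem _ hd)
    have h2 : (a + 1) * q ^ l'.length ≤ b * q ^ l'.length := Nat.mul_le_mul_right _ hab
    simp only [numOf]
    rw [hlen] at h1 ⊢
    nlinarith

/-- Digit `p` of a number is the entry of the digit list at `p` from the end. -/
theorem digit_numOf (l l' : List ℕ) (d : ℕ) (hl' : ∀ x ∈ l', x < q) (hd : d < q) :
    numOf q (l ++ d :: l') / q ^ l'.length % q = d := by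
  have h1 := numOf_lt hl'
  rw [numOf_append]
  simp only [List.length_cons, numOf]
  rw [show numOf q l * q ^ (l'.length + 1) + (d * q ^ l'.length + numOf q l') =
    numOf q l' + q ^ l'.length * (d + q * numOf q l) by ring,
    Nat.add_mul_div_left _ _ (by omega), Nat.div_eq_of_lt h1, zero_add,
    Nat.add_mul_mod_self_left, Nat.mod_eq_of_lt hd]

theorem digitArray_injective (hq : 2 ≤ q) {x y : ℕ} (h : digitArray q x = digitArray q y) :
    x = y := by
  have key : ∀ p, x % q ^ p = y % q ^ p := by
    intro p
    induction p with
    | zero => simp [Nat.mod_one]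
    | succ p ih =>
      have := congrFun h p
      unfold digitArray at this
      rw [mod_pow_succ_eq, mod_pow_succ_eq, ih, this]
  have h1 : x < q ^ (x + y) := lt_of_le_of_lt (by omega) (Nat.lt_pow_self (by omega))
  have h2 : y < q ^ (x + y) := lt_of_le_of_lt (by omega) (Nat.lt_pow_self (by omega))
  rw [← Nat.mod_eq_of_lt h1, key, Nat.mod_eq_of_lt h2]

end Digits

/-! ### Partitions in a box and their growth -/

section Partitions

/-- The number of partitions of `i` into at most `b` parts, each of them at most `a`. -/
def boxPart : ℕ → ℕ → ℕ → ℕ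
  | 0, _, i => if i = 0 then 1 else 0
  | a + 1, 0, i => boxPart a 0 i
  | a + 1, b + 1, i =>
    boxPart a (b + 1) i + if i < a + 1 then 0 else boxPart (a + 1) b (i - (a + 1))
termination_by a b => a + b

/-- The number of partitions of `i` into at most `b` parts, the largest of them equal to `a`. -/
def topPart (a b i : ℕ) : ℕ := if b = 0 ∨ i < a then 0 else boxPart a (b - 1) (i - a)

theorem boxPart_zero (b i : ℕ) : boxPart 0 b i = if i = 0 then 1 else 0 := by
  rw [boxPart]

theorem boxPart_succ (a b i : ℕ) :
    boxPart (a + 1) b i = boxPart a b i + topPart (a + 1) b i := by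
  cases b with
  | zero => rw [boxPart]; simp [topPart]
  | succ b => rw [boxPart]; simp [topPart]

theorem topPart_le_boxPart {a b : ℕ} (h : a ≠ 0 ∨ b ≠ 0) (i : ℕ) :
    topPart a b i ≤ boxPart a b i := by
  cases a with
  | zero =>
    unfold topPart
    split_ifs
    · exact Nat.zero_le _
    · simp [boxPart_zero]
  | succ a => rw [boxPart_succ]; omega

/-- The product Q_a on the right is the generating function of partitions into parts at most a,
evaluated at x, and a coefficient times x^i is at most the value. The double induction avoids power
series: the recurrence of `boxPart` matches Q_{a+1} = Q_a + x^{a+1} Q_{a+1}. -/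
theorem boxPart_mul_pow_le {x : ℝ} (h0 : 0 < x) (h1 : x < 1) (a b i : ℕ) :
    boxPart a b i * x ^ i ≤ ∏ j ∈ Finset.range a, (1 - x ^ (j + 1))⁻¹ := by
  have hx : ∀ j : ℕ, 0 < 1 - x ^ (j + 1) := fun j => by
    have := pow_lt_one₀ h0.le h1 (by omega : j + 1 ≠ 0)
    linarith
  have hpos : ∀ a, 0 ≤ ∏ j ∈ Finset.range a, (1 - x ^ (j + 1))⁻¹ := fun a =>
    Finset.prod_nonneg fun j _ => (inv_pos.2 (hx j)).le
  induction a generalizing b i with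
  | zero =>
    rw [boxPart_zero]
    split_ifs with h
    · simp [h]
    · simp
  | succ a iha =>
    induction b generalizing i with
    | zero =>
      rw [boxPart_succ]
      have h3 : (1 : ℝ) ≤ (1 - x ^ (a + 1))⁻¹ := (one_le_inv₀ (hx a)).2 (by
        have := pow_pos h0 (a + 1); linarith)
      simp only [topPart, true_or, if_true, add_zero]
      rw [Finset.prod_range_succ]
      exact (iha 0 i).trans (le_mul_of_one_le_right (hpos a) h3)
    | succ b ihb =>
      have hQ : ∏ j ∈ Finset.range (a + 1), (1 - x ^ (j + 1))⁻¹ =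
          (∏ j ∈ Finset.range a, (1 - x ^ (j + 1))⁻¹) +
          x ^ (a + 1) * ∏ j ∈ Finset.range (a + 1), (1 - x ^ (j + 1))⁻¹ := by
        rw [Finset.prod_range_succ]
        have := (hx a).ne'
        field_simp
        ring
      rw [boxPart_succ, hQ]
      push_cast
      rw [add_mul]
      refine add_le_add (iha _ _) ?_
      rw [topPart]
      by_cases h : i < a + 1
      · rw [if_pos (Or.inr h)]
        simp only [Nat.cast_zero, zero_mul]
        exact mul_nonneg (pow_pos h0 _).le (hpos _)
      · rw [if_neg (by omega)]
        have hi : i = (a + 1) + (i - (a + 1)) := by omega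
        have := ihb (i - (a + 1))
        calc (boxPart (a + 1) (b + 1 - 1) (i - (a + 1)) : ℝ) * x ^ i
            = x ^ (a + 1) * (boxPart (a + 1) b (i - (a + 1)) * x ^ (i - (a + 1))) := by
              conv_lhs => rw [hi, pow_add]
              simp
              ring
          _ ≤ _ := mul_le_mul_of_nonneg_left this (pow_pos h0 _).le

/-- The factor 1 - x divides 1 - x^(l+1) with quotient a sum of l + 1 powers, each at least x^l. -/
theorem mul_pow_mul_one_sub_le {x : ℝ} (h0 : 0 < x) (h1 : x < 1) (l : ℕ) :
    (l + 1) * x ^ l * (1 - x) ≤ 1 - x ^ (l + 1) := by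
  rw [← mul_neg_geom_sum x (l + 1), mul_comm]
  refine mul_le_mul_of_nonneg_left ?_ (by linarith)
  calc ((l : ℝ) + 1) * x ^ l = ∑ i ∈ Finset.range (l + 1), x ^ l := by simp
    _ ≤ _ := Finset.sum_le_sum fun i hi =>
      pow_le_pow_of_le_one h0.le h1.le (by have := Finset.mem_range.1 hi; omega)

/-- Expand each logarithm and sum over j first. The geometric sum belonging to the exponent l + 1 is
at most x/(1 - x)/(l + 1) by `mul_pow_mul_one_sub_le`. The logarithmic series supplies another
factor 1/(l + 1), and Σ 1/(l + 1)² = π²/6 ≤ 2. -/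
theorem sum_neg_log_one_sub_pow_le {x : ℝ} (h0 : 0 < x) (h1 : x < 1) (a : ℕ) :
    ∑ j ∈ Finset.range a, -Real.log (1 - x ^ (j + 1)) ≤ 2 * (x / (1 - x)) := by
  have hs : HasSum (fun l : ℕ => ∑ j ∈ Finset.range a, (x ^ (j + 1)) ^ (l + 1) / ((l : ℝ) + 1))
      (∑ j ∈ Finset.range a, -Real.log (1 - x ^ (j + 1))) := by
    refine hasSum_sum fun j _ => ?_
    apply Real.hasSum_pow_div_log_of_abs_lt_one
    rw [abs_of_pos (pow_pos h0 _)]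
    exact pow_lt_one₀ h0.le h1 (by omega : j + 1 ≠ 0)
  have hz : HasSum (fun l : ℕ => x / (1 - x) * (1 / ((l : ℝ) + 1) ^ 2))
      (x / (1 - x) * (Real.pi ^ 2 / 6)) := by
    refine HasSum.mul_left _ ?_
    have := (hasSum_nat_add_iff' (f := fun n : ℕ => 1 / (n : ℝ) ^ 2) 1).2 hasSum_zeta_two
    simpa using this
  have hxp : 0 < x / (1 - x) := div_pos h0 (by linarith)
  refine (hasSum_le (fun l => ?_) hs hz).trans ?_
  · have hy0 : 0 < x ^ (l + 1) := pow_pos h0 _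
    have hy1 : x ^ (l + 1) < 1 := pow_lt_one₀ h0.le h1 (by omega : l + 1 ≠ 0)
    have hl : (0 : ℝ) < l + 1 := by positivity
    rw [← Finset.sum_div]
    have hg : ∑ j ∈ Finset.range a, (x ^ (j + 1)) ^ (l + 1) ≤
        x ^ (l + 1) / (1 - x ^ (l + 1)) := by
      rw [le_div_iff₀ (by linarith)]
      have : ∑ j ∈ Finset.range a, (x ^ (j + 1)) ^ (l + 1) =
          x ^ (l + 1) * ∑ j ∈ Finset.range a, (x ^ (l + 1)) ^ j := by
        rw [Finset.mul_sum]
        refine Finset.sum_congr rfl fun j _ => ?_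
        rw [← pow_mul, ← pow_mul, ← pow_add]
        congr 1
        ring
      rw [this, mul_assoc, mul_comm (∑ j ∈ _, _), mul_neg_geom_sum]
      have := pow_pos hy0 a
      nlinarith
    have h2 := mul_pow_mul_one_sub_le h0 h1 l
    have hx1 : 0 < 1 - x := by linarith
    have h3 : x ^ (l + 1) / (1 - x ^ (l + 1)) ≤ x / (1 - x) * (1 / (l + 1)) := by
      rw [div_mul_div_comm, mul_one, div_le_div_iff₀ (by linarith) (by positivity)]
      calc x ^ (l + 1) * ((1 - x) * (l + 1)) = x * ((l + 1) * x ^ l * (1 - x)) := by ring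
        _ ≤ _ := mul_le_mul_of_nonneg_left h2 h0.le
    calc _ ≤ (x / (1 - x) * (1 / (l + 1))) / ((l : ℝ) + 1) := by gcongr; exact hg.trans h3
      _ = _ := by field_simp
  · have := Real.pi_lt_d2
    have := Real.pi_pos
    have h6 : Real.pi ^ 2 / 6 ≤ 2 := by nlinarith
    nlinarith

/-- Partition numbers grow at most exponentially in the square root. -/
theorem boxPart_lt {s N i : ℕ} (hs : 0 < s) (hN : N ≤ s ^ 2) (hi : i ≤ N) (a b : ℕ) :
    boxPart a b i < 2 ^ (5 * s) := by
  have hs' : (0 : ℝ) < s := by exact_mod_cast hs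
  -- This point makes x/(1 - x) = s, so the product is at most e^(2s), while x^(-i) = (1 + 1/s)^i ≤
  -- e^(i/s) ≤ e^s because i ≤ s².
  set x : ℝ := s / (s + 1) with hx
  have h0 : 0 < x := by positivity
  have h1 : x < 1 := by rw [hx, div_lt_one (by positivity)]; linarith
  have h2 : x / (1 - x) = s := by rw [hx]; field_simp; ring
  have hQ : ∏ j ∈ Finset.range a, (1 - x ^ (j + 1))⁻¹ ≤ Real.exp (2 * s) := by
    have := sum_neg_log_one_sub_pow_le h0 h1 a
    rw [h2] at this
    refine le_trans (le_of_eq ?_) (Real.exp_le_exp.2 this)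
    rw [Real.exp_sum]
    refine Finset.prod_congr rfl fun j _ => ?_
    rw [Real.exp_neg, Real.exp_log]
    have := pow_lt_one₀ h0.le h1 (by omega : j + 1 ≠ 0)
    linarith
  have h3 : (x ^ i)⁻¹ ≤ Real.exp s := by
    rw [← inv_pow]
    have h4 : x⁻¹ ≤ Real.exp (1 / s) := by
      have := Real.add_one_le_exp (1 / (s : ℝ))
      refine le_trans (le_of_eq ?_) this
      rw [hx]; field_simp; ring
    calc x⁻¹ ^ i ≤ Real.exp (1 / s) ^ i := by gcongr
      _ = Real.exp (i / s) := by rw [← Real.exp_nat_mul]; congr 1; ring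
      _ ≤ _ := by
        apply Real.exp_le_exp.2
        rw [div_le_iff₀ hs', ← sq]
        exact_mod_cast hi.trans hN
  have h4 := (boxPart_mul_pow_le h0 h1 a b i).trans hQ
  have h5 : (boxPart a b i : ℝ) ≤ Real.exp (2 * s) * Real.exp s := by
    rw [← le_div_iff₀ (pow_pos h0 i), div_eq_mul_inv] at h4
    exact h4.trans (by gcongr)
  have h6 : Real.exp (2 * s) * Real.exp s = (Real.exp 1 ^ 3) ^ s := by
    rw [← Real.exp_add, ← Real.exp_nat_mul, ← Real.exp_nat_mul]
    congr 1
    push_cast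
    ring
  -- The total bound is e^(3s), and e³ < 32; this is the origin of the constant 5 in the number of
  -- digits.
  have h7 : Real.exp 1 ^ 3 < 2 ^ 5 := by
    have h8 := Real.exp_one_lt_d9
    have h9 : Real.exp 1 < 3 := by linarith
    have := Real.exp_pos 1
    calc Real.exp 1 ^ 3 ≤ (2.8 : ℝ) ^ 3 := by gcongr; linarith
      _ < _ := by norm_num
  have h8 : (Real.exp 1 ^ 3) ^ s < ((2 : ℝ) ^ 5) ^ s := by
    apply pow_lt_pow_left₀ h7 (by positivity) hs.ne'
  rw [← pow_mul 2] at h8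
  rw [h6] at h5
  exact_mod_cast h5.trans_lt h8

end Partitions

/-! ### Ferrers diagrams as lattice paths, and their ranks -/

section Paths

/-- The number of pivots to the left of column `c`, for the pivot indicator `w`. -/
def cnt (w : ℕ → Bool) : ℕ → ℕ
  | 0 => 0
  | c + 1 => cnt w c + if w c then 1 else 0

/-- The number of dots of the Ferrers diagram to the left of column `c`. -/
def siz (w : ℕ → Bool) : ℕ → ℕ
  | 0 => 0
  | c + 1 => siz w c + if w c then 0 else cnt w c

/-- The rank of the Ferrers diagram of the first `c` columns among the diagrams of its size. -/
def pathIdx (w : ℕ → Bool) : ℕ → ℕ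
  | 0 => 0
  | c + 1 => pathIdx w c + if w c then topPart (cnt w c + 1) (c - cnt w c) (siz w c) else 0

/-- The Ferrers diagram of the first `c` columns. -/
def colList (w : ℕ → Bool) : ℕ → List ℕ
  | 0 => []
  | c + 1 => if w c then colList w c else cnt w c :: colList w c

/-- The tableau entries of the first `c` columns. -/
def tabList (w : ℕ → Bool) (M : ℕ → ℕ → ℕ) : ℕ → List ℕ
  | 0 => []
  | c + 1 => if w c then tabList w M c
    else (List.range (cnt w c)).map (fun t => M t c) ++ tabList w M c

variable {w w' : ℕ → Bool}

theorem cnt_le (w : ℕ → Bool) (c : ℕ) : cnt w c ≤ c := by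
  induction c with
  | zero => simp [cnt]
  | succ c ih => simp only [cnt]; split_ifs <;> omega

theorem cnt_mono (w : ℕ → Bool) : Monotone (cnt w) :=
  monotone_nat_of_le_succ fun c => by simp [cnt]

theorem siz_mono (w : ℕ → Bool) : Monotone (siz w) :=
  monotone_nat_of_le_succ fun c => by simp [siz]

theorem siz_le (w : ℕ → Bool) (c : ℕ) : siz w c ≤ cnt w c * (c - cnt w c) := by
  induction c with
  | zero => simp [siz]
  | succ c ih =>
    have h := cnt_le w c
    obtain ⟨d, hd⟩ := Nat.exists_eq_add_of_le h
    simp only [siz, cnt]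
    split_ifs
    · rw [show c + 1 - (cnt w c + 1) = d by omega]
      rw [show c - cnt w c = d by omega] at ih
      nlinarith
    · rw [show c + 1 - (cnt w c + 0) = d + 1 by omega]
      rw [show c - cnt w c = d by omega] at ih
      nlinarith

/-- The recurrence of `boxPart` splits the diagrams by the last matrix column. If it is a pivot, the
rank is the number of diagrams with full first column plus a rank in the narrower box. If not, the
rank is already below that number. -/
theorem pathIdx_lt (w : ℕ → Bool) (c : ℕ) :
    pathIdx w c < boxPart (cnt w c) (c - cnt w c) (siz w c) := by
  induction c with
  | zero => simp [pathIdx, cnt, siz, boxPart_zero]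
  | succ c ih =>
    have h := cnt_le w c
    simp only [pathIdx, siz, cnt]
    split_ifs
    · rw [boxPart_succ, show c + 1 - (cnt w c + 1) = c - cnt w c by omega, add_zero]
      omega
    · have h1 : topPart (cnt w c) (c + 1 - cnt w c) (siz w c + cnt w c) =
          boxPart (cnt w c) (c - cnt w c) (siz w c) := by
        rw [topPart, if_neg (by omega)]
        congr 1 <;> omega
      have h2 := topPart_le_boxPart (a := cnt w c) (b := c + 1 - cnt w c) (by omega)
        (siz w c + cnt w c)
      simp only [add_zero]
      omega

theorem sum_colList (w : ℕ → Bool) (c : ℕ) : (colList w c).sum = siz w c := by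
  induction c with
  | zero => rfl
  | succ c ih =>
    simp only [colList, siz]
    split_ifs
    · rw [ih, add_zero]
    · rw [List.sum_cons, ih, add_comm]

theorem length_colList (w : ℕ → Bool) (c : ℕ) : (colList w c).length + cnt w c = c := by
  induction c with
  | zero => rfl
  | succ c ih =>
    simp only [colList, cnt]
    split_ifs
    · omega
    · rw [List.length_cons]; omega

theorem length_tabList (w : ℕ → Bool) (M : ℕ → ℕ → ℕ) (c : ℕ) :
    (tabList w M c).length = siz w c := by
  induction c with
  | zero => rfl
  | succ c ih =>
    simp only [tabList, siz]
    split_ifs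
    · rw [ih, add_zero]
    · rw [List.length_append, List.length_map, List.length_range, ih, add_comm]

theorem le_cnt_of_mem_colList {c x : ℕ} (h : x ∈ colList w c) : x ≤ cnt w c := by
  induction c with
  | zero => simp [colList] at h
  | succ c ih =>
    refine le_trans ?_ (cnt_mono w c.le_succ)
    simp only [colList] at h
    split_ifs at h
    · exact ih h
    · rcases List.mem_cons.1 h with h | h
      · exact h.le
      · exact ih h

/-- The list is nonempty and all its entries are at most `cnt w c < a`. Thus a diagram whose last
matrix column is a pivot comes strictly after one with the same number of pivots whose last column
is not. -/
theorem not_lex_cons_of_cnt_lt {c a : ℕ} {l : List ℕ} (hc : cnt w c < c) (ha : cnt w c < a) :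
    ¬ List.Lex (· > ·) (colList w c) (a :: l) ∧ colList w c ≠ a :: l := by
  have hlen := length_colList w c
  constructor
  · intro h
    cases hl : colList w c with
    | nil => rw [hl] at hlen; simp at hlen; omega
    | cons x l' =>
      have hx := le_cnt_of_mem_colList (w := w) (c := c) (x := x) (by rw [hl]; simp)
      rw [hl] at h
      cases h with
      | cons h => omega
      | rel h => omega
  · intro h
    have hx := le_cnt_of_mem_colList (w := w) (c := c) (x := a) (by rw [h]; simp)
    omega

theorem cnt_eq_of_succ {c : ℕ} (hw : w c = w' c) (h : cnt w (c + 1) = cnt w' (c + 1)) :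
    cnt w c = cnt w' c := by
  simp only [cnt, hw] at h
  omega

theorem siz_eq_of_succ {c : ℕ} (hw : w c = w' c) (h : cnt w (c + 1) = cnt w' (c + 1))
    (h' : siz w (c + 1) = siz w' (c + 1)) : siz w c = siz w' c := by
  have := cnt_eq_of_succ hw h
  simp only [siz, hw, this] at h'
  omega

/-- The rank is strictly increasing for the order of Ferrers diagrams of a given size. -/
theorem pathIdx_lt_of_lex (c : ℕ) (hcnt : cnt w c = cnt w' c) (hsiz : siz w c = siz w' c)
    (hlex : List.Lex (· > ·) (colList w c) (colList w' c)) : pathIdx w c < pathIdx w' c := by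
  induction c with
  | zero => simp [colList] at hlex
  | succ c ih =>
    have h1 := cnt_le w c
    have h1' := cnt_le w' c
    by_cases hw : w c = w' c
    · have hc := cnt_eq_of_succ hw hcnt
      have hs := siz_eq_of_succ hw hcnt hsiz
      simp only [colList, hw, hc] at hlex
      simp only [pathIdx, hw, hc, hs]
      split_ifs at hlex with h
      · have := ih hc hs hlex
        simp only [h, if_true]
        omega
      · have := ih hc hs (by
          rw [List.lex_cons_iff] at hlex
          exact hlex)
        simp only [h]
        omega
    -- The paths separate at the last column. If only the second has a pivot there, the first rank
    -- is below the `topPart` that the second one adds; the opposite case contradicts the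
    -- lexicographic order.
    · cases hwc : w c
      · have hwc' : w' c = true := by
          cases h : w' c
          · rw [hwc, h] at hw; exact absurd rfl hw
          · rfl
        simp only [cnt, siz, hwc, hwc', if_true] at hcnt hsiz
        have h2 := pathIdx_lt w c
        simp only [pathIdx, hwc, hwc', if_true]
        have h3 : topPart (cnt w' c + 1) (c - cnt w' c) (siz w' c) =
            boxPart (cnt w c) (c - cnt w c) (siz w c) := by
          simp at hcnt hsiz
          rw [topPart, if_neg (by omega)]
          congr 1 <;> omega
        simp
        omega
      · have hwc' : w' c = false := by
          cases h : w' c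
          · rfl
          · rw [hwc, h] at hw; exact absurd rfl hw
        simp [cnt, hwc, hwc'] at hcnt
        simp [colList, hwc, hwc'] at hlex
        exact absurd hlex (not_lex_cons_of_cnt_lt (by omega) (by omega)).1

/-- The Ferrers diagram determines the pivot columns. -/
theorem eq_of_colList_eq (c : ℕ) (hcnt : cnt w c = cnt w' c) (h : colList w c = colList w' c) :
    ∀ x < c, w x = w' x := by
  induction c with
  | zero => intro x hx; omega
  | succ c ih =>
    have h1 := cnt_le w c
    have h1' := cnt_le w' c
    have hw : w c = w' c := by
      cases hwc : w c <;> cases hwc' : w' c <;> try rfl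
      · simp [cnt, hwc, hwc'] at hcnt
        simp [colList, hwc, hwc'] at h
        exact absurd h.symm (not_lex_cons_of_cnt_lt (by omega) (by omega)).2
      · simp [cnt, hwc, hwc'] at hcnt
        simp [colList, hwc, hwc'] at h
        exact absurd h (not_lex_cons_of_cnt_lt (by omega) (by omega)).2
    have hc := cnt_eq_of_succ hw hcnt
    intro x hx
    rcases Nat.lt_succ_iff_lt_or_eq.1 hx with hx | rfl
    · refine ih hc ?_ x hx
      simp only [colList, hw] at h
      split_ifs at h
      · exact h
      · exact (List.cons.inj h).2
    · exact hw

theorem congr_below (c : ℕ) (h : ∀ x < c, w x = w' x) :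
    cnt w c = cnt w' c ∧ siz w c = siz w' c ∧ pathIdx w c = pathIdx w' c := by
  induction c with
  | zero => exact ⟨rfl, rfl, rfl⟩
  | succ c ih =>
    obtain ⟨h1, h2, h3⟩ := ih fun x hx => h x (by omega)
    simp only [cnt, siz, pathIdx, h1, h2, h3, h c (by omega), and_self]

/-- Every rank below the number of diagrams in the box occurs. -/
theorem exists_path (c a b i u : ℕ) (hc : a + b = c) (hu : u < boxPart a b i) :
    ∃ w, cnt w c = a ∧ siz w c = i ∧ pathIdx w c = u := by
  induction c generalizing a b i u with
  | zero =>
    obtain ⟨rfl, rfl⟩ : a = 0 ∧ b = 0 := by omega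
    rw [boxPart_zero] at hu
    split_ifs at hu
    · exact ⟨fun _ => false, rfl, by simp [siz]; omega, by simp [pathIdx]; omega⟩
    · omega
  | succ c ih =>
    -- The diagrams with full first column occupy the initial ranks, so this comparison decides
    -- whether the last column is a pivot. The decoder performs the same test.
    by_cases h : u < topPart a b i
    · unfold topPart at h
      split_ifs at h with hb
      · omega
      · push Not at hb
        obtain ⟨w, h1, h2, h3⟩ := ih a (b - 1) (i - a) u (by omega) h
        obtain ⟨g1, g2, g3⟩ := congr_below (w := Function.update w c false) (w' := w) c
          fun x hx => Function.update_of_ne hx.ne _ _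
        refine ⟨Function.update w c false, ?_, ?_, ?_⟩
        · simp [cnt, g1, h1]
        · simp [siz, g1, g2, h1, h2]; omega
        · simp [pathIdx, g3, h3]
    · cases a with
      | zero =>
        refine absurd ?_ h
        rw [boxPart_zero] at hu
        rw [topPart, if_neg (by omega), boxPart_zero]
        simpa using hu
      | succ a =>
        rw [boxPart_succ] at hu
        obtain ⟨w, h1, h2, h3⟩ := ih a b i (u - topPart (a + 1) b i) (by omega) (by omega)
        obtain ⟨g1, g2, g3⟩ := congr_below (w := Function.update w c true) (w' := w) c
          fun x hx => Function.update_of_ne hx.ne _ _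
        refine ⟨Function.update w c true, ?_, ?_, ?_⟩
        · simp [cnt, g1, h1]
        · simp [siz, g2, h2]
        · simp [pathIdx, g1, g2, g3, h1, h2, h3, show c - a = b by omega]; omega

/-- Every row has its pivot. -/
theorem exists_cnt_eq {n r : ℕ} (h : r < cnt w n) : ∃ c < n, w c = true ∧ cnt w c = r := by
  induction n with
  | zero => simp [cnt] at h
  | succ n ih =>
    by_cases h' : r < cnt w n
    · obtain ⟨c, h1, h2⟩ := ih h'
      exact ⟨c, by omega, h2⟩
    · simp only [cnt] at h
      split_ifs at h with hw
      · exact ⟨n, by omega, hw, by omega⟩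
      · omega

theorem cnt_lt_cnt {c c' : ℕ} (h : c < c') (hw : w c = true) : cnt w c < cnt w c' := by
  have h1 := cnt_mono w (show c + 1 ≤ c' from h)
  simp [cnt, hw] at h1
  omega

theorem siz_add_cnt_le {c c' : ℕ} (h : c < c') (hw : w c = false) :
    siz w c + cnt w c ≤ siz w c' := by
  have h1 := siz_mono w (show c + 1 ≤ c' from h)
  simpa [siz, hw] using h1

theorem mem_tabList_lt {q : ℕ} {M : ℕ → ℕ → ℕ} (hM : ∀ t c, M t c < q) (c : ℕ) :
    ∀ x ∈ tabList w M c, x < q := by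
  induction c with
  | zero => simp [tabList]
  | succ c ih =>
    intro x hx
    simp only [tabList] at hx
    split_ifs at hx
    · exact ih x hx
    · rcases List.mem_append.1 hx with hx | hx
      · obtain ⟨t, -, rfl⟩ := List.mem_map.1 hx
        exact hM t c
      · exact ih x hx

/-- The position of an entry of the tableau among the digits of the number it represents. -/
theorem digit_tabList {q : ℕ} {M : ℕ → ℕ → ℕ} (hM : ∀ t c, M t c < q) {c n t : ℕ}
    (hc : c < n) (hw : w c = false) (ht : t < cnt w c) :
    digitArray q (numOf q (tabList w M n)) (siz w c + cnt w c - 1 - t) = M t c := by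
  -- The columns to the right of `c` only contribute more significant digits, so the position is
  -- counted from the end of the list, inside the first `c + 1` columns.
  obtain ⟨l, hl⟩ : ∃ l, tabList w M n = l ++ tabList w M (c + 1) := by
    clear ht
    induction n with
    | zero => omega
    | succ n ih =>
      rcases Nat.lt_succ_iff_lt_or_eq.1 hc with h | rfl
      · obtain ⟨l, hl⟩ := ih h
        by_cases hn : w n
        · exact ⟨l, by simp [tabList, hn, hl]⟩
        · exact ⟨(List.range (cnt w n)).map (fun t => M t n) ++ l, by
            simp [tabList, hn] at hl ⊢; exact hl⟩
      · exact ⟨[], rfl⟩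
  have h2 : tabList w M (c + 1) = (List.range t).map (fun t => M t c) ++ M t c ::
      ((List.range (cnt w c - 1 - t)).map (fun x => M (t + 1 + x) c) ++ tabList w M c) := by
    simp only [tabList, hw]
    have : List.range (cnt w c) = List.range t ++ t ::
        (List.range (cnt w c - 1 - t)).map (t + 1 + ·) := by
      rw [show cnt w c = t + 1 + (cnt w c - 1 - t) by omega, List.range_add, List.range_succ]
      simp
    rw [this]
    simp [Function.comp_def]
  rw [hl, h2, ← List.append_assoc]
  unfold digitArray
  have h3 := digit_numOf (l ++ (List.range t).map (fun t => M t c))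
    ((List.range (cnt w c - 1 - t)).map (fun x => M (t + 1 + x) c) ++ tabList w M c)
    (M t c) ?_ (hM t c)
  · rw [show ((List.range (cnt w c - 1 - t)).map (fun x => M (t + 1 + x) c) ++
      tabList w M c).length = siz w c + cnt w c - 1 - t by
        simp [length_tabList]; omega] at h3
    exact h3
  · intro x hx
    rcases List.mem_append.1 hx with hx | hx
    · obtain ⟨t, -, rfl⟩ := List.mem_map.1 hx
      exact hM _ c
    · exact mem_tabList_lt hM c x hx

/-- Every digit position below the size of the diagram belongs to a dot. -/
theorem exists_dot {n p : ℕ} (hp : p < siz w n) :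
    ∃ c t, c < n ∧ w c = false ∧ t < cnt w c ∧ siz w c + cnt w c - 1 - t = p := by
  induction n with
  | zero => simp [siz] at hp
  | succ n ih =>
    by_cases h : p < siz w n
    · obtain ⟨c, t, h1, h2⟩ := ih h
      exact ⟨c, t, by omega, h2⟩
    · simp only [siz] at hp
      split_ifs at hp with hw
      · omega
      · exact ⟨n, siz w n + cnt w n - 1 - p, by omega, by simpa using hw, by omega, by omega⟩

/-- The number of subspaces with at least `m` dots. -/
def tailCount (q k h N m : ℕ) : ℕ := ∑ i ∈ Finset.Ico m (N + 1), boxPart k h i * q ^ i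

theorem tailCount_eq (q k h : ℕ) {N m : ℕ} (hm : m ≤ N) :
    tailCount q k h N m = boxPart k h m * q ^ m + tailCount q k h N (m + 1) :=
  Finset.sum_eq_sum_Ico_succ_bot (by omega) _

theorem tailCount_anti (q k h N : ℕ) : Antitone (tailCount q k h N) := fun _ _ h =>
  Finset.sum_le_sum_of_subset (Finset.Ico_subset_Ico_left h)

/-- By induction the sum of the first M terms plus q^L is at most q^(L+M): the extra q^L makes the
induction close, with q ≥ 2 used to absorb the doubling. Hence all indices fit into L + N + 1
digits. -/
theorem tailCount_lt {q k h N L : ℕ} (hq : 2 ≤ q) (hP : ∀ i ≤ N, boxPart k h i < q ^ L) :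
    tailCount q k h N 0 < q ^ (L + N + 1) := by
  have key : ∀ M ≤ N + 1, ∑ i ∈ Finset.range M, boxPart k h i * q ^ i + q ^ L ≤ q ^ (L + M) := by
    intro M
    induction M with
    | zero => simp
    | succ M ih =>
      intro hM
      rw [Finset.sum_range_succ]
      have h1 := ih (by omega)
      have h2 : (boxPart k h M + 1) * q ^ M ≤ q ^ L * q ^ M :=
        Nat.mul_le_mul_right _ (hP M (by omega))
      rw [← pow_add, add_mul] at h2
      have h3 : 2 * q ^ (L + M) ≤ q * q ^ (L + M) := Nat.mul_le_mul_right _ hq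
      rw [← add_assoc, pow_succ, mul_comm _ q]
      omega
  have := key (N + 1) le_rfl
  have h0 : 0 < q ^ L := by positivity
  unfold tailCount
  rw [Nat.Ico_zero_eq_range, add_assoc]
  omega

/-- The tails decrease to 0, so some consecutive pair of them encloses `z`; the lower index of the
pair is the number of dots. -/
theorem exists_tailCount {q k h N z : ℕ} (hz : z < tailCount q k h N 0) :
    ∃ m ≤ N, ∃ y < boxPart k h m * q ^ m, z = tailCount q k h N (m + 1) + y := by
  have key : ∀ d m, m + d = N + 1 → z < tailCount q k h N m →
      ∃ m ≤ N, ∃ y < boxPart k h m * q ^ m, z = tailCount q k h N (m + 1) + y := by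
    intro d
    induction d with
    | zero =>
      intro m hm hz
      simp [tailCount, show m = N + 1 by omega] at hz
    | succ d ih =>
      intro m hm hz
      by_cases hlt : z < tailCount q k h N (m + 1)
      · exact ih (m + 1) (by omega) hlt
      · rw [tailCount_eq q k h (by omega)] at hz
        exact ⟨m, by omega, z - tailCount q k h N (m + 1), by omega, by omega⟩
  exact key (N + 1) 0 (by omega) hz

end Paths

/-! ### Ferrers diagrams and tableaux in terms of pivot indicators -/

section Entries

variable {F : Type*} {n k q : ℕ}

/-- The entries of a matrix as digits. -/
def entryFn (e : F ≃ Fin q) (M : Matrix (Fin k) (Fin n) F) (t c : ℕ) : ℕ :=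
  if h : t < k ∧ c < n then (e (M ⟨t, h.1⟩ ⟨c, h.2⟩) : ℕ) else 0

theorem entryFn_val (e : F ≃ Fin q) (M : Matrix (Fin k) (Fin n) F) (t : Fin k)
    (c : Fin n) : entryFn e M t c = e (M t c) := by
  simp [entryFn]

theorem entryFn_lt (hq : 0 < q) (e : F ≃ Fin q) (M : Matrix (Fin k) (Fin n) F) (t c : ℕ) :
    entryFn e M t c < q := by
  unfold entryFn
  split_ifs
  · exact Fin.is_lt _
  · exact hq

/-- The indicator function of the pivot columns. -/
def pivotFn (v : Finset (Fin n)) (c : ℕ) : Bool :=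
  if h : c < n then decide ((⟨c, h⟩ : Fin n) ∈ v) else false

theorem pivotFn_eq_true {v : Finset (Fin n)} {c : ℕ} :
    pivotFn v c = true ↔ ∃ h : c < n, (⟨c, h⟩ : Fin n) ∈ v := by
  unfold pivotFn
  split_ifs with h <;> simp [h]

theorem pivotFn_val (v : Finset (Fin n)) (c : Fin n) : pivotFn v c = decide (c ∈ v) := by
  simp [pivotFn]

theorem card_filter_val_lt (v : Finset (Fin n)) {c : ℕ} (hc : c ≤ n) :
    (v.filter fun x => x.val < c).card = cnt (pivotFn v) c := by
  induction c with
  | zero => simp [cnt]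
  | succ c ih =>
    rw [cnt, ← ih (by omega)]
    have hd : v.filter (fun x => x.val < c + 1) =
        v.filter (fun x => x.val < c) ∪ v.filter (fun x => x = (⟨c, hc⟩ : Fin n)) := by
      ext x
      simp only [Finset.mem_filter, Finset.mem_union, Fin.ext_iff]
      constructor
      · rintro ⟨h1, h2⟩
        by_cases h : x.val = c
        · exact Or.inr ⟨h1, h⟩
        · exact Or.inl ⟨h1, by omega⟩
      · rintro (⟨h1, h2⟩ | ⟨h1, h2⟩)
        · exact ⟨h1, by omega⟩
        · exact ⟨h1, by omega⟩
    rw [hd, Finset.card_union_of_disjoint, Finset.filter_eq']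
    · have : pivotFn v c = decide ((⟨c, hc⟩ : Fin n) ∈ v) := pivotFn_val v ⟨c, hc⟩
      rw [this]
      by_cases h : (⟨c, hc⟩ : Fin n) ∈ v <;> simp [h]
    · rw [Finset.disjoint_left]
      intro x hx hx'
      have h1 := (Finset.mem_filter.1 hx).2
      have h2 := (Finset.mem_filter.1 hx').2
      rw [h2] at h1
      simp at h1

theorem dots_eq_cnt (v : Finset (Fin n)) (c : Fin n) : dots v c = cnt (pivotFn v) c := by
  rw [← card_filter_val_lt v c.2.le]
  rfl

theorem map_val_ferrersCols (v : Finset (Fin n)) :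
    (ferrersCols v).map Fin.val = (List.range n).reverse.filter fun c => !pivotFn v c := by
  rw [ferrersCols, ← List.map_coe_finRange_eq_range, ← List.map_reverse, List.filter_map]
  congr 2
  funext c
  simp [pivotFn_val]

theorem map_cnt_reverse_range (w : ℕ → Bool) (n : ℕ) :
    ((List.range n).reverse.filter fun c => !w c).map (cnt w) = colList w n := by
  induction n with
  | zero => rfl
  | succ n ih =>
    rw [List.range_succ, List.reverse_append, List.reverse_singleton, List.singleton_append,
      List.filter_cons, colList, ← ih]
    cases hw : w n <;> rfl

theorem flatMap_reverse_range (w : ℕ → Bool) (M : ℕ → ℕ → ℕ) (n : ℕ) :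
    (((List.range n).reverse.filter fun c => !w c).flatMap fun c =>
      (List.range (cnt w c)).map fun t => M t c) = tabList w M n := by
  induction n with
  | zero => rfl
  | succ n ih =>
    rw [List.range_succ, List.reverse_append, List.reverse_singleton, List.singleton_append,
      List.filter_cons, tabList, ← ih]
    cases hw : w n <;> rfl

theorem ferrers_eq (v : Finset (Fin n)) : ferrers v = colList (pivotFn v) n := by
  have h1 : ferrers v = ((ferrersCols v).map Fin.val).map (cnt (pivotFn v)) := by
    rw [List.map_map]
    exact List.map_congr_left fun c _ => dots_eq_cnt v c
  rw [h1, map_val_ferrersCols, map_cnt_reverse_range]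

theorem tableau_eq (e : F ≃ Fin q) (v : Finset (Fin n)) (M : Matrix (Fin k) (Fin n) F)
    (hk : cnt (pivotFn v) n ≤ k) :
    ((tableau v M).map e).map Fin.val = tabList (pivotFn v) (entryFn e M) n := by
  have h1 : ((tableau v M).map e).map Fin.val = ((ferrersCols v).map Fin.val).flatMap fun c =>
      (List.range (cnt (pivotFn v) c)).map fun t => entryFn e M t c := by
    rw [tableau, List.map_flatMap, List.map_flatMap, List.flatMap_map]
    refine List.flatMap_congr fun c _ => ?_
    rw [List.map_map, List.map_map]
    have hck : cnt (pivotFn v) c ≤ k := (cnt_mono _ c.2.le).trans hk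
    have h2 : ((List.finRange k).filter fun r : Fin k => r.val < dots v c).map Fin.val =
        List.range (cnt (pivotFn v) c) := by
      rw [dots_eq_cnt]
      have h3 : ((List.finRange k).filter fun r : Fin k => r.val < cnt (pivotFn v) c).map Fin.val =
          (List.range k).filter fun r => r < cnt (pivotFn v) c := by
        rw [← List.map_coe_finRange_eq_range, List.filter_map]
        rfl
      rw [h3]
      obtain ⟨d, hd⟩ := Nat.exists_eq_add_of_le hck
      rw [hd, List.range_add, List.filter_append, List.filter_eq_self.2, List.filter_eq_nil_iff.2,
        List.append_nil]
      · intro a ha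
        obtain ⟨x, -, rfl⟩ := List.mem_map.1 ha
        simp
      · intro a ha
        simpa using ha
    rw [← h2, List.map_map]
    refine List.map_congr_left fun r _ => ?_
    simp [entryFn_val]
  rw [h1, map_val_ferrersCols, flatMap_reverse_range]

end Entries

/-! ### Uniqueness and shape of reduced row echelon forms -/

section Echelon

variable {F : Type*} [Field F] {n k : ℕ}

theorem IsLead.unique {M : Matrix (Fin k) (Fin n) F} {r : Fin k} {c c' : Fin n}
    (h : IsLead M r c) (h' : IsLead M r c') : c = c' := by
  rcases lt_trichotomy c c' with hlt | rfl | hlt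
  · exact absurd (h'.2 c hlt) h.1
  · rfl
  · exact absurd (h.2 c' hlt) h'.1

theorem IsRREF.exists_pivot {M : Matrix (Fin k) (Fin n) F} (hM : IsRREF M) :
    ∃ p : Fin k → Fin n, StrictMono p ∧ (∀ r c, IsLead M r c ↔ c = p r) ∧
      ∀ r s, M r (p s) = if r = s then 1 else 0 := by
  choose p hp using hM.exists_lead
  refine ⟨p, fun r s h => hM.lead_lt h (hp r) (hp s), fun r c => ⟨fun h => h.unique (hp r), ?_⟩,
    fun r s => ?_⟩
  · rintro rfl
    exact hp r
  · split_ifs with h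
    · subst h
      exact hM.lead_eq_one (hp r)
    · exact hM.eq_zero_of_lead (hp s) r h

theorem linearIndependent_row {M : Matrix (Fin k) (Fin n) F} {p : Fin k → Fin n}
    (hp : ∀ r s, M r (p s) = if r = s then 1 else 0) : LinearIndependent F M.row := by
  rw [Fintype.linearIndependent_iff]
  intro g hg r
  have := congrFun hg (p r)
  simpa [Matrix.row, hp] using this

/-- The pivot columns form an identity matrix, so the coefficients of a vector of the row space are
its entries there. -/
theorem eq_sum_of_mem_span {M : Matrix (Fin k) (Fin n) F} {p : Fin k → Fin n}
    (hp : ∀ r s, M r (p s) = if r = s then 1 else 0) {x : Fin n → F}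
    (hx : x ∈ Submodule.span F (Set.range M.row)) : x = ∑ r, x (p r) • M.row r := by
  obtain ⟨g, rfl⟩ := Submodule.mem_span_range_iff_exists_fun F |>.1 hx
  refine Finset.sum_congr rfl fun r _ => ?_
  congr 1
  simp [Matrix.row, hp]

/-- The leading position of a vector of the row space is a pivot. -/
theorem mem_range_pivot {M : Matrix (Fin k) (Fin n) F} {p : Fin k → Fin n}
    (hl : ∀ r c, IsLead M r c ↔ c = p r)
    (hp : ∀ r s, M r (p s) = if r = s then 1 else 0) {x : Fin n → F}
    (hx : x ∈ Submodule.span F (Set.range M.row)) {c : Fin n} (h0 : x c ≠ 0)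
    (hlt : ∀ c' < c, x c' = 0) : c ∈ Set.range p := by
  by_contra hc
  apply h0
  rw [eq_sum_of_mem_span hp hx, Finset.sum_apply]
  refine Finset.sum_eq_zero fun r _ => ?_
  rcases lt_trichotomy c (p r) with h | h | h
  · have := ((hl r (p r)).2 rfl).2 c h
    simp [Matrix.row, this]
  · exact absurd ⟨r, h.symm⟩ hc
  · simp [hlt _ h]

/-- The pivots are the leading positions of the vectors of the row space, so they depend on the
space only. Each row is then the vector of the space with prescribed entries at the pivots. -/
theorem IsRREF.ext {M M' : Matrix (Fin k) (Fin n) F} (hM : IsRREF M) (hM' : IsRREF M')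
    (h : Submodule.span F (Set.range M.row) = Submodule.span F (Set.range M'.row)) : M = M' := by
  obtain ⟨p, h1, h2, h3⟩ := hM.exists_pivot
  obtain ⟨p', h1', h2', h3'⟩ := hM'.exists_pivot
  have hpp : p = p' := by
    refine (StrictMono.range_inj h1 h1').1 (Set.Subset.antisymm ?_ ?_)
    · rintro _ ⟨r, rfl⟩
      have hr := (h2 r _).2 rfl
      exact mem_range_pivot h2' h3' (x := M.row r)
        (h ▸ Submodule.subset_span ⟨r, rfl⟩) hr.1 hr.2
    · rintro _ ⟨r, rfl⟩
      have hr := (h2' r _).2 rfl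
      exact mem_range_pivot h2 h3 (x := M'.row r)
        (h ▸ Submodule.subset_span ⟨r, rfl⟩) hr.1 hr.2
  subst hpp
  funext r
  have hr := eq_sum_of_mem_span h3' (x := M.row r) (h ▸ Submodule.subset_span ⟨r, rfl⟩)
  change M.row r = M'.row r
  rw [hr, Finset.sum_eq_single r]
  · simp [Matrix.row, h3]
  · intro s _ hs
    simp [Matrix.row, h3, hs.symm]
  · simp

theorem rref_spec (X : Grassmannian F n k) : IsRREFOf (rref X) X.1 :=
  Classical.choose_spec (exists_isRREFOf X)

theorem eq_of_rref_eq {X Y : Grassmannian F n k} (h : rref X = rref Y) : X = Y := by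
  apply Subtype.ext
  rw [← (rref_spec X).2, ← (rref_spec Y).2, h]

theorem IsRREF.exists_rref_eq {M : Matrix (Fin k) (Fin n) F} (hM : IsRREF M) :
    ∃ X : Grassmannian F n k, rref X = M := by
  obtain ⟨p, -, -, h3⟩ := hM.exists_pivot
  refine ⟨⟨Submodule.span F (Set.range M.row), ?_⟩, ?_⟩
  · rw [finrank_span_eq_card (linearIndependent_row h3), Fintype.card_fin]
  · exact (rref_spec _).1.ext hM (rref_spec _).2

/-- The shape of a matrix in reduced row echelon form, in terms of its pivot columns. -/
structure Shape (w : ℕ → Bool) (M : Matrix (Fin k) (Fin n) F) : Prop where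
  pivot_lt : ∀ c, w c = true → c < n
  cnt_eq : cnt w n = k
  pivot : ∀ (r : Fin k) (c : Fin n), w c = true → M r c = if r.val = cnt w c then 1 else 0
  zero : ∀ (r : Fin k) (c : Fin n), w c = false → cnt w c ≤ r → M r c = 0

/-- By monotonicity the rows with pivot to the left of `c` form an initial segment, so a row belongs
to it exactly when its number is below the size. This is why the dots of a column are in the top
rows. -/
theorem lt_card_filter_iff {p : Fin k → Fin n} (hp : StrictMono p) (r : Fin k) (c : ℕ) :
    r.val < (Finset.univ.filter fun r => (p r).val < c).card ↔ (p r).val < c := by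
  constructor
  · intro h
    by_contra hc
    have h1 : (Finset.univ.filter fun r => (p r).val < c) ⊆ Finset.Iio r := by
      intro s hs
      have hs := (Finset.mem_filter.1 hs).2
      rw [Finset.mem_Iio]
      by_contra h2
      have : p r ≤ p s := hp.monotone (not_lt.1 h2)
      have : (p r).val ≤ (p s).val := this
      omega
    have := Finset.card_le_card h1
    rw [Fin.card_Iio] at this
    omega
  · intro h
    have h1 : Finset.Iic r ⊆ Finset.univ.filter fun r => (p r).val < c := by
      intro s hs
      have : p s ≤ p r := hp.monotone (Finset.mem_Iic.1 hs)
      have : (p s).val ≤ (p r).val := this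
      simp only [Finset.mem_filter, Finset.mem_univ, true_and]
      omega
    have := Finset.card_le_card h1
    rw [Fin.card_Iic] at this
    omega

theorem shape_rref (X : Grassmannian F n k) : Shape (pivotFn (idVec X)) (rref X) := by
  classical
  obtain ⟨p, h1, h2, h3⟩ := (rref_spec X).1.exists_pivot
  have hv : idVec X = Finset.univ.image p := by
    ext c
    simp [idVec, h2, eq_comm]
  have hcnt : ∀ c ≤ n, cnt (pivotFn (idVec X)) c =
      (Finset.univ.filter fun r => (p r).val < c).card := by
    intro c hc
    rw [← card_filter_val_lt _ hc, hv, Finset.filter_image,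
      Finset.card_image_of_injective _ h1.injective]
  have hiff : ∀ (r : Fin k) (c : ℕ), c ≤ n → (r.val < cnt (pivotFn (idVec X)) c ↔ (p r).val < c) :=
    fun r c hc => by rw [hcnt c hc]; exact lt_card_filter_iff h1 r c
  refine ⟨fun c hc => (pivotFn_eq_true.1 hc).1, ?_, ?_, ?_⟩
  · rw [hcnt n le_rfl, Finset.filter_true_of_mem fun r _ => (p r).2]
    simp
  · intro r c hc
    obtain ⟨_, hc⟩ := pivotFn_eq_true.1 hc
    rw [hv] at hc
    obtain ⟨s, -, hs⟩ := Finset.mem_image.1 hc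
    have hs : p s = c := hs
    have h4 : cnt (pivotFn (idVec X)) c = s := by
      have h5 := hiff s c c.2.le
      rw [hs] at h5
      rcases lt_trichotomy (cnt (pivotFn (idVec X)) c) s with h | h | h
      · have h6 := hiff ⟨_, h.trans s.2⟩ c c.2.le
        have : p ⟨_, h.trans s.2⟩ < p s := h1 h
        rw [hs] at this
        have := h6.2 this
        simp at this
      · exact h
      · exact absurd (h5.1 h) (lt_irrefl _)
    rw [h4, ← hs, h3]
    simp [Fin.ext_iff]
  · intro r c hc hle
    by_contra h0
    have h5 := hiff r c c.2.le
    have h6 : c < p r := by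
      rcases lt_trichotomy (p r) c with h | h | h
      · have := h5.2 h
        omega
      · have : pivotFn (idVec X) c = true := by
          rw [pivotFn_eq_true]
          exact ⟨c.2, by rw [hv]; exact Finset.mem_image.2 ⟨r, Finset.mem_univ _, h⟩⟩
        rw [this] at hc
        cases hc
      · exact h
    exact h0 (((h2 r (p r)).2 rfl).2 c h6)

theorem Shape.isLead_iff {w : ℕ → Bool} {M : Matrix (Fin k) (Fin n) F} (h : Shape w M)
    (r : Fin k) (c : Fin n) : IsLead M r c ↔ w c = true ∧ cnt w c = r := by
  have key : ∀ (r : Fin k) (c : Fin n), w c = true → cnt w c = r → IsLead M r c := by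
    intro r c hw hc
    refine ⟨by simp [h.pivot r c hw, hc], fun c' hc' => ?_⟩
    cases hw' : w c'
    · exact h.zero r c' hw' (by rw [← hc]; exact cnt_mono w (Fin.val_fin_le.2 hc'.le))
    · have := cnt_lt_cnt (w := w) (Fin.lt_def.1 hc') hw'
      rw [h.pivot r c' hw', if_neg (by omega)]
  refine ⟨fun hl => ?_, fun hc => key r c hc.1 hc.2⟩
  obtain ⟨c', h1, h2, h3⟩ := exists_cnt_eq (w := w) (n := n) (r := r) (by rw [h.cnt_eq]; exact r.2)
  have := hl.unique (key r ⟨c', h1⟩ h2 h3)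
  subst this
  exact ⟨h2, h3⟩

theorem Shape.isRREF {w : ℕ → Bool} {M : Matrix (Fin k) (Fin n) F} (h : Shape w M) :
    IsRREF M where
  exists_lead r := by
    obtain ⟨c, h1, h2, h3⟩ := exists_cnt_eq (w := w) (n := n) (r := r) (by rw [h.cnt_eq]; exact r.2)
    exact ⟨⟨c, h1⟩, (h.isLead_iff _ _).2 ⟨h2, h3⟩⟩
  lead_lt r r' c c' hr hc hc' := by
    obtain ⟨h1, h2⟩ := (h.isLead_iff _ _).1 hc
    obtain ⟨h1', h2'⟩ := (h.isLead_iff _ _).1 hc'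
    by_contra hlt
    have := cnt_mono w (Fin.val_fin_le.2 (not_lt.1 hlt))
    have : r.val < r'.val := hr
    omega
  lead_eq_one r c hc := by
    obtain ⟨h1, h2⟩ := (h.isLead_iff _ _).1 hc
    simp [h.pivot r c h1, h2]
  eq_zero_of_lead r c hc r' hr := by
    obtain ⟨h1, h2⟩ := (h.isLead_iff _ _).1 hc
    rw [h.pivot r' c h1, if_neg]
    rw [h2]
    exact fun h => hr (Fin.ext h)

/-- The converse of `shape_rref`: pivot columns and arbitrary entries at the dots always come from a
subspace. It supplies the subspace with a prescribed index. -/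
theorem Shape.exists_rref {w : ℕ → Bool} {M : Matrix (Fin k) (Fin n) F} (h : Shape w M) :
    ∃ X : Grassmannian F n k, rref X = M ∧ pivotFn (idVec X) = w := by
  classical
  obtain ⟨X, hX⟩ := h.isRREF.exists_rref_eq
  refine ⟨X, hX, ?_⟩
  funext c
  rw [Bool.eq_iff_iff, pivotFn_eq_true]
  constructor
  · rintro ⟨h1, h2⟩
    obtain ⟨r, hr⟩ := (Finset.mem_filter.1 h2).2
    rw [hX] at hr
    exact ((h.isLead_iff _ _).1 hr).1
  · intro hw
    have hc := h.pivot_lt c hw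
    refine ⟨hc, Finset.mem_filter.2 ⟨Finset.mem_univ _, ⟨cnt w c, ?_⟩, ?_⟩⟩
    · rw [← h.cnt_eq]
      exact cnt_lt_cnt hc hw
    · rw [hX, h.isLead_iff]
      exact ⟨hw, rfl⟩

end Echelon

/-! ### The explicit formula for the index -/

section Index

variable {F : Type*} [Field F] {n k q : ℕ}

/-- The number represented by the tableau of `X`. -/
noncomputable def tabNum (e : F ≃ Fin q) (X : Grassmannian F n k) : ℕ :=
  numOf q (tabList (pivotFn (idVec X)) (entryFn e (rref X)) n)

/-- The number of dots of the Ferrers diagram of `X`. -/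
noncomputable def dotNum (X : Grassmannian F n k) : ℕ := siz (pivotFn (idVec X)) n

/-- The explicit formula for the index of `X`. -/
noncomputable def grassIdx (e : F ≃ Fin q) (X : Grassmannian F n k) : ℕ :=
  tailCount q k (n - k) (k * (n - k)) (dotNum X + 1) +
    (q ^ dotNum X * pathIdx (pivotFn (idVec X)) n + tabNum e X)

theorem dotNum_le (X : Grassmannian F n k) : dotNum X ≤ k * (n - k) := by
  have h := siz_le (pivotFn (idVec X)) n
  rwa [(shape_rref X).cnt_eq] at h

theorem tabNum_lt (hq : 0 < q) (e : F ≃ Fin q) (X : Grassmannian F n k) :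
    tabNum e X < q ^ dotNum X := by
  have := numOf_lt (mem_tabList_lt (w := pivotFn (idVec X)) (entryFn_lt hq e (rref X)) n)
  rwa [length_tabList] at this

theorem pathIdx_idVec_lt (X : Grassmannian F n k) :
    pathIdx (pivotFn (idVec X)) n < boxPart k (n - k) (dotNum X) := by
  have h := pathIdx_lt (pivotFn (idVec X)) n
  rwa [(shape_rref X).cnt_eq] at h

theorem digits_lt (hq : 0 < q) (e : F ≃ Fin q) (X : Grassmannian F n k) :
    q ^ dotNum X * pathIdx (pivotFn (idVec X)) n + tabNum e X <
      boxPart k (n - k) (dotNum X) * q ^ dotNum X := by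
  have h1 := tabNum_lt hq e X
  have h2 : (pathIdx (pivotFn (idVec X)) n + 1) * q ^ dotNum X ≤
    boxPart k (n - k) (dotNum X) * q ^ dotNum X := Nat.mul_le_mul_right _ (pathIdx_idVec_lt X)
  rw [add_mul, mul_comm] at h2
  omega

/-- The subspaces with m dots get indices between `tailCount` at m + 1 and at m; these intervals are
disjoint and follow each other as m decreases. -/
theorem grassIdx_lt (hq : 0 < q) (e : F ≃ Fin q) (X : Grassmannian F n k) :
    grassIdx e X < tailCount q k (n - k) (k * (n - k)) (dotNum X) := by
  have h1 := digits_lt hq e X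
  rw [tailCount_eq q k (n - k) (dotNum_le X), grassIdx]
  omega

theorem lex_val_map {q : ℕ} {l l' : List (Fin q)} (h : List.Lex (· < ·) l l') :
    List.Lex (· < ·) (l.map Fin.val) (l'.map Fin.val) := by
  induction h with
  | nil => exact .nil
  | cons _ ih => exact .cons ih
  | rel h => exact .rel h

theorem map_tableau (e : F ≃ Fin q) (X : Grassmannian F n k) :
    ((tableau (idVec X) (rref X)).map e).map Fin.val =
      tabList (pivotFn (idVec X)) (entryFn e (rref X)) n :=
  tableau_eq e _ _ (shape_rref X).cnt_eq.le

theorem pivotFn_eq_of_ferrers_eq {X Y : Grassmannian F n k}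
    (h : ferrers (idVec X) = ferrers (idVec Y)) : pivotFn (idVec X) = pivotFn (idVec Y) := by
  rw [ferrers_eq, ferrers_eq] at h
  have h1 := eq_of_colList_eq n (by rw [(shape_rref X).cnt_eq, (shape_rref Y).cnt_eq]) h
  funext c
  by_cases hc : c < n
  · exact h1 c hc
  · simp [pivotFn, hc]

/-- The three summands correspond to the three levels of the order. A larger size gives a lower
interval; for equal sizes a smaller rank wins because the tableau number is below q^m; for equal
diagrams the tableaux have equal length, and lexicographic order is numerical order. -/
theorem grassIdx_lt_of_grassLT (hq : 0 < q) (e : F ≃ Fin q) {X Y : Grassmannian F n k}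
    (h : GrassLT e X Y) : grassIdx e X < grassIdx e Y := by
  have hX := grassIdx_lt hq e X
  rcases h with (h | ⟨h1, h2⟩) | ⟨h1, h2⟩
  · rw [ferrers_eq, ferrers_eq, sum_colList, sum_colList] at h
    refine hX.trans_le (le_trans (tailCount_anti q k _ _ h) ?_)
    exact Nat.le_add_right _ _
  · rw [ferrers_eq, ferrers_eq] at h1 h2
    rw [sum_colList, sum_colList] at h1
    have h3 := pathIdx_lt_of_lex n (by rw [(shape_rref X).cnt_eq, (shape_rref Y).cnt_eq]) h1 h2
    have h4 := tabNum_lt hq e X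
    have h5 : dotNum X = dotNum Y := h1
    have h6 := Nat.mul_le_mul_left (q ^ dotNum Y) (Nat.succ_le_of_lt h3)
    rw [Nat.succ_eq_add_one, mul_add] at h6
    unfold grassIdx
    rw [h5] at h4 ⊢
    omega
  · have h3 := pivotFn_eq_of_ferrers_eq h1
    have h4 : tabNum e X < tabNum e Y := by
      have h2 := lex_val_map h2
      rw [map_tableau, map_tableau] at h2
      refine numOf_lt_of_lex (mem_tabList_lt (entryFn_lt hq e _) n) ?_ h2
      rw [length_tabList, length_tabList, h3]
    unfold grassIdx
    rw [show dotNum X = dotNum Y by unfold dotNum; rw [h3], h3]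
    omega

theorem rref_entry_eq {w : ℕ → Bool} {M M' : Matrix (Fin k) (Fin n) F} (h : Shape w M)
    (h' : Shape w M')
    (hd : ∀ (r : Fin k) (c : Fin n), w c = false → r.val < cnt w c → M r c = M' r c) :
    M = M' := by
  ext r c
  cases hw : w c
  · by_cases hr : r.val < cnt w c
    · exact hd r c hw hr
    · rw [h.zero r c hw (by omega), h'.zero r c hw (by omega)]
  · rw [h.pivot r c hw, h'.pivot r c hw]

/-- The diagram determines the pivots, and every entry that is not forced by the shape appears in
the tableau. -/
theorem eq_of_tableau_eq (hq : 0 < q) (e : F ≃ Fin q) {X Y : Grassmannian F n k}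
    (h1 : ferrers (idVec X) = ferrers (idVec Y))
    (h2 : (tableau (idVec X) (rref X)).map e = (tableau (idVec Y) (rref Y)).map e) : X = Y := by
  have h3 := pivotFn_eq_of_ferrers_eq h1
  have h2 := congrArg (List.map Fin.val) h2
  rw [map_tableau, map_tableau, h3] at h2
  have hX := shape_rref X
  rw [h3] at hX
  refine eq_of_rref_eq (rref_entry_eq hX (shape_rref Y) fun r c hw hr => ?_)
  have h4 := digit_tabList (entryFn_lt hq e (rref X)) c.2 hw hr
  rw [h2, digit_tabList (entryFn_lt hq e (rref Y)) c.2 hw hr, entryFn_val, entryFn_val] at h4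
  exact (e.injective (Fin.ext h4)).symm

theorem grassLT_trichotomy (hq : 0 < q) (e : F ≃ Fin q) (X Y : Grassmannian F n k) :
    GrassLT e X Y ∨ X = Y ∨ GrassLT e Y X := by
  unfold GrassLT FerrersLT
  rcases lt_trichotomy (ferrers (idVec X)).sum (ferrers (idVec Y)).sum with h | h | h
  · exact Or.inr (Or.inr (Or.inl (Or.inl h)))
  · rcases trichotomous_of (List.Lex (· > ·)) (ferrers (idVec X)) (ferrers (idVec Y))
      with h' | h' | h'
    · exact Or.inl (Or.inl (Or.inr ⟨h, h'⟩))
    · rcases trichotomous_of (List.Lex (· < ·)) ((tableau (idVec X) (rref X)).map e)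
        ((tableau (idVec Y) (rref Y)).map e) with h'' | h'' | h''
      · exact Or.inl (Or.inr ⟨h', h''⟩)
      · exact Or.inr (Or.inl (eq_of_tableau_eq hq e h' h''))
      · exact Or.inr (Or.inr (Or.inr ⟨h'.symm, h''⟩))
    · exact Or.inr (Or.inr (Or.inl (Or.inr ⟨h.symm, h'⟩)))
  · exact Or.inl (Or.inl (Or.inl h))

theorem grassLT_iff (hq : 0 < q) (e : F ≃ Fin q) (X Y : Grassmannian F n k) :
    GrassLT e X Y ↔ grassIdx e X < grassIdx e Y := by
  refine ⟨grassIdx_lt_of_grassLT hq e, fun h => ?_⟩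
  rcases grassLT_trichotomy hq e X Y with h' | rfl | h'
  · exact h'
  · omega
  · have := grassIdx_lt_of_grassLT hq e h'
    omega

theorem grassIdx_injective (hq : 0 < q) (e : F ≃ Fin q) :
    Function.Injective (grassIdx (n := n) (k := k) e) := by
  intro X Y h
  rcases grassLT_trichotomy hq e X Y with h' | rfl | h'
  · have := grassIdx_lt_of_grassLT hq e h'
    omega
  · rfl
  · have := grassIdx_lt_of_grassLT hq e h'
    omega

/-- The formula is inverted level by level: the enclosing tails give the size m, the quotient by q^m
the rank and hence the pivots, and the remainder the digits of the tableau. -/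
theorem exists_grassIdx_eq (hq : 2 ≤ q) (e : F ≃ Fin q) (hk : k ≤ n) {z : ℕ}
    (hz : z < tailCount q k (n - k) (k * (n - k)) 0) :
    ∃ X : Grassmannian F n k, grassIdx e X = z := by
  have hq0 : 0 < q := by omega
  obtain ⟨m, -, y, hy, rfl⟩ := exists_tailCount hz
  have hy' : y / q ^ m < boxPart k (n - k) m := (Nat.div_lt_iff_lt_mul (by positivity)).2 hy
  obtain ⟨w₀, h1, h2, h3⟩ := exists_path n k (n - k) m _ (by omega) hy'
  -- `Shape` demands that there be no pivot beyond the last column, so the path is cut off at `n`;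
  -- this changes none of its counts.
  obtain ⟨w, hw, h1, h2, h3⟩ : ∃ w : ℕ → Bool, (∀ c, w c = true → c < n) ∧ cnt w n = k ∧
      siz w n = m ∧ pathIdx w n = y / q ^ m := by
    obtain ⟨g1, g2, g3⟩ := congr_below (w := fun c => decide (c < n) && w₀ c) (w' := w₀) n
      fun x hx => by simp [hx]
    refine ⟨fun c => decide (c < n) && w₀ c, fun c hc => ?_, by rw [g1, h1], by rw [g2, h2],
      by rw [g3, h3]⟩
    simp at hc
    exact hc.1
  have hs : Shape w (Matrix.of fun (r : Fin k) (c : Fin n) => if w c = true then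
      (if r.val = cnt w c then 1 else 0) else if r.val < cnt w c then
      e.symm ⟨_, digitArray_lt hq0 (y % q ^ m) (siz w c + cnt w c - 1 - r)⟩ else 0) := by
    refine ⟨hw, h1, fun r c hc => ?_, fun r c hc hr => ?_⟩
    · simp [hc]
    · simp [hc]
      omega
  obtain ⟨X, hX, hv⟩ := hs.exists_rref
  have hdot : dotNum X = m := by rw [dotNum, hv, h2]
  have htab : tabNum e X = y % q ^ m := by
    -- Each position below m belongs to a dot, where the matrix was built from the wanted digit;
    -- from m on both numbers have zero digits.
    apply digitArray_injective hq
    funext p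
    by_cases hp : p < siz w n
    · obtain ⟨c, t, g1, g2, g3, rfl⟩ := exists_dot hp
      have htk : t < k := by
        rw [← h1]
        exact g3.trans_le (cnt_mono w g1.le)
      rw [tabNum, hv, digit_tabList (entryFn_lt hq0 e _) g1 g2 g3, hX]
      simp [entryFn, htk, g1, g2, g3]
    · rw [digitArray_eq_zero hq0 (tabNum_lt hq0 e X) (by omega),
        digitArray_eq_zero hq0 (Nat.mod_lt y (by positivity)) (show m ≤ p by omega)]
  refine ⟨X, ?_⟩
  rw [grassIdx, hdot, htab, hv, h3, Nat.div_add_mod]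

theorem grassIdx_lt_tailCount (hq : 0 < q) (e : F ≃ Fin q) (X : Grassmannian F n k) :
    grassIdx e X < tailCount q k (n - k) (k * (n - k)) 0 :=
  (grassIdx_lt hq e X).trans_le (tailCount_anti _ _ _ _ (Nat.zero_le _))

theorem card_grassmannian (hq : 2 ≤ q) (e : F ≃ Fin q) (hk : k ≤ n) :
    Nat.card (Grassmannian F n k) = tailCount q k (n - k) (k * (n - k)) 0 := by
  have hq0 : 0 < q := by omega
  rw [← Nat.card_fin (tailCount q k (n - k) (k * (n - k)) 0)]
  refine Nat.card_congr (Equiv.ofBijective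
    (fun X => ⟨grassIdx e X, grassIdx_lt_tailCount hq0 e X⟩) ⟨fun X Y h => ?_, fun z => ?_⟩)
  · exact grassIdx_injective hq0 e (Fin.mk.inj h)
  · obtain ⟨X, hX⟩ := exists_grassIdx_eq hq e hk z.2
    exact ⟨X, Fin.ext hX⟩

/-- The index of a subspace is given by the explicit formula. -/
theorem ind₁_eq_grassIdx (hq : 2 ≤ q) (e : F ≃ Fin q) (hk : k ≤ n) (X : Grassmannian F n k) :
    ind₁ e X = grassIdx e X := by
  have hq0 : 0 < q := by omega
  rw [ind₁, ← Nat.card_fin (grassIdx e X)]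
  refine Nat.card_congr (Equiv.ofBijective
    (fun Y => ⟨grassIdx e Y.1, (grassLT_iff hq0 e _ _).1 Y.2⟩) ⟨fun Y Z h => ?_, fun z => ?_⟩)
  · exact Subtype.ext (grassIdx_injective hq0 e (Fin.mk.inj h))
  · obtain ⟨Y, hY⟩ := exists_grassIdx_eq hq e hk (z.2.trans (grassIdx_lt_tailCount hq0 e X))
    exact ⟨⟨Y, (grassLT_iff hq0 e _ _).2 (hY ▸ z.2)⟩, Fin.ext hY⟩

end Index

/-! ### Parameters, table addresses and the integer square root -/

section Setup

/-- The parameters of a run: `h` is the codimension, `N` the dimension of the Grassmannian,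
`L` the number of digits of the partition numbers, and `D` bounds the registers. -/
structure Params (q n k h N L D : ℕ) : Prop where
  two_le : 2 ≤ q
  n_eq : n = k + h
  k_pos : 0 < k
  h_pos : 0 < h
  N_eq : N = k * h
  part_lt : ∀ a b i, i ≤ N → boxPart a b i < q ^ L
  le_D : (k + 1) * (h + 1) * (N + 1) * L + n + N + L + 10 ≤ D

/-- The parameters are in registers `0, …, 6`. -/
structure Env (q n k h N L : ℕ) (s : State) : Prop where
  r0 : s.reg 0 = q
  r1 : s.reg 1 = n
  r2 : s.reg 2 = k
  r3 : s.reg 3 = h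
  r4 : s.reg 4 = N
  r5 : s.reg 5 = L
  r6 : s.reg 6 = L + N + 1

theorem Env.congr {q n k h N L : ℕ} {s s' : State} (hs : Env q n k h N L s)
    (h' : ∀ r < 7, s'.reg r = s.reg r) : Env q n k h N L s' :=
  ⟨by rw [h' 0 (by omega), hs.r0], by rw [h' 1 (by omega), hs.r1], by rw [h' 2 (by omega), hs.r2],
    by rw [h' 3 (by omega), hs.r3], by rw [h' 4 (by omega), hs.r4], by rw [h' 5 (by omega), hs.r5],
    by rw [h' 6 (by omega), hs.r6]⟩

/-- The address of the digits of `boxPart a b i` in the table. -/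
def addr (h N L a b i : ℕ) : ℕ := ((a * (h + 1) + b) * (N + 1) + i) * L

theorem slot_lt {k h N a b i : ℕ} (ha : a ≤ k) (hb : b ≤ h) (hi : i ≤ N) :
    (a * (h + 1) + b) * (N + 1) + i < (k + 1) * (h + 1) * (N + 1) := by
  have h1 : a * (h + 1) + b + 1 ≤ (k + 1) * (h + 1) := by nlinarith
  have h2 := Nat.mul_le_mul_right (N + 1) h1
  nlinarith

theorem addr_add_le {k h N L a b i : ℕ} (ha : a ≤ k) (hb : b ≤ h) (hi : i ≤ N) :
    addr h N L a b i + L ≤ (k + 1) * (h + 1) * (N + 1) * L := by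
  have h1 := Nat.mul_le_mul_right L (slot_lt ha hb hi)
  unfold addr
  nlinarith

theorem Params.addr_le {q n k h N L D a b i : ℕ} (hp : Params q n k h N L D) (ha : a ≤ k)
    (hb : b ≤ h) (hi : i ≤ N) : addr h N L a b i ≤ D := by
  have h1 := addr_add_le (L := L) ha hb hi
  have h2 := hp.le_D
  omega

/-- A slot is a number in mixed radix with digits `i` below `N + 1` and `b` below `h + 1`. -/
theorem slot_inj {h N a b i a' b' i' : ℕ} (hb : b ≤ h) (hi : i ≤ N) (hb' : b' ≤ h) (hi' : i' ≤ N)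
    (heq : (a * (h + 1) + b) * (N + 1) + i = (a' * (h + 1) + b') * (N + 1) + i') :
    a = a' ∧ b = b' ∧ i = i' := by
  have e1 : a * (h + 1) + b = a' * (h + 1) + b' := by
    have := congrArg (· / (N + 1)) heq
    simpa [Nat.mul_add_div, mul_comm _ (N + 1), Nat.div_eq_of_lt (Nat.lt_succ_of_le hi),
      Nat.div_eq_of_lt (Nat.lt_succ_of_le hi')] using this
  have e2 : a = a' := by
    have := congrArg (· / (h + 1)) e1
    simpa [Nat.mul_add_div, mul_comm _ (h + 1), Nat.div_eq_of_lt (Nat.lt_succ_of_le hb),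
      Nat.div_eq_of_lt (Nat.lt_succ_of_le hb')] using this
  subst e2
  have e3 : b = b' := by omega
  subst e3
  exact ⟨rfl, rfl, by omega⟩

/-- The expression for the address of the digits of `boxPart a b i`. -/
def addrExpr (a b i : Expr) : Expr :=
  .mul (.add (.mul (.add (.mul a (.add (.reg 3) (.lit 1))) b) (.add (.reg 4) (.lit 1))) i) (.reg 5)

theorem addrExpr_val {q n k h N L : ℕ} {s : State} (hs : Env q n k h N L s) (a b i : Expr) :
    (addrExpr a b i).val s = addr h N L (a.val s) (b.val s) (i.val s) := by
  simp [addrExpr, Expr.val, addr, hs.r3, hs.r4, hs.r5]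

/-- Compute the parameters in registers `3, …, 6`. -/
def setupProg : Prog :=
  .seq (.set 3 (.sub (.reg 1) (.reg 2))) <|
  .seq (.set 4 (.mul (.reg 2) (.reg 3))) <|
  .seq (.set 5 (.lit 0)) <|
  .seq (.forLoop 10 (.reg 4)
    (.ite (.lt (.mul (.add (.reg 5) (.lit 1)) (.add (.reg 5) (.lit 1))) (.add (.reg 4) (.lit 1)))
      (.set 5 (.add (.reg 5) (.lit 1))) .skip)) <|
  .seq (.set 5 (.mul (.lit 5) (.add (.reg 5) (.lit 1)))) <|
  .set 6 (.add (.add (.reg 5) (.reg 4)) (.lit 1))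

theorem setupProg_spec {q n k h N L D : ℕ} (hp : Params q n k h N L D)
    (hL : L = 5 * (Nat.sqrt N + 1)) {s : State} (h0 : s.reg 0 = q) (h1 : s.reg 1 = n)
    (h2 : s.reg 2 = k) :
    Tri q D setupProg (100 * (N + 1)) (fun s' => Env q n k h N L s' ∧ s'.arr = s.arr) s := by
  have hD := hp.le_D
  have hn := hp.n_eq
  have hN := hp.N_eq
  have e3 : n - k = h := by omega
  refine Tri.time (Tri.set_seq (by decide) (fun _ => ?_) <|
    Tri.set_seq (by decide) (fun _ => ?_) <|
    Tri.set_seq (by decide) (fun _ => ?_) <|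
    Tri.seq (T₂ := 50) (Tri.forLoop (m := N) (T := 50)
      -- The square root is found by counting up. The disjunction says that the counter has never
      -- been refused an increment or has already reached √N; after N passes either alternative
      -- gives √N.
      (fun j s' => s'.reg 0 = q ∧ s'.reg 1 = n ∧ s'.reg 2 = k ∧ s'.reg 3 = h ∧ s'.reg 4 = N ∧
        s'.reg 5 * s'.reg 5 ≤ N ∧ s'.reg 5 ≤ j ∧ (s'.reg 5 = j ∨ N < (s'.reg 5 + 1) * (s'.reg 5 + 1))
        ∧ s'.arr = s.arr)
      (by decide) (by omega) (fun j s' h => h.2.2.2.2.1) ?_ ?_) ?_) ?_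
  · simp [Expr.val, h1, h2]; omega
  · simp [Expr.val, h1, h2, e3, ← hN]; omega
  · simp [Expr.val]
  · simp [Expr.val, h0, h1, h2, e3, hN]
  · intro j s' hj h10 _ ⟨i0, i1, i2, i3, i4, i5, i6, i7, i8⟩
    refine Tri.time (Tri.ite (T₁ := 4) (T₂ := 1) (by decide) (fun hb => ?_) (fun hb => ?_))
      (by decide)
    · refine Tri.set (by decide) (fun _ => ?_) ?_
      · simp [Expr.val]; omega
      · simp [Expr.val, i4] at hb
        simp [Expr.val, i0, i1, i2, i3, i4, h10, i8]
        refine ⟨by omega, by omega, ?_⟩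
        rcases i7 with i7 | i7
        · left; exact i7
        · omega
    · refine Tri.skip ?_
      simp [Expr.val, i4] at hb
      simp [i0, i1, i2, i3, i4, h10, i8]
      refine ⟨by omega, by omega, ?_⟩
      right; omega
  · intro s' ⟨_, i0, i1, i2, i3, i4, i5, i6, i7, i8⟩
    have hsq : s'.reg 5 = Nat.sqrt N := by
      rw [Nat.eq_sqrt]
      refine ⟨i5, ?_⟩
      rcases i7 with i7 | i7
      · rw [i7]; nlinarith
      · exact i7
    refine Tri.time (Tri.set_seq (by decide) (fun _ => ?_) <|
      Tri.set (by decide) (fun _ => ?_) ?_) (by decide)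
    · simp [Expr.val, hsq]; omega
    · simp [Expr.val, hsq, i4]; omega
    · simp only [Expr.val]
      refine ⟨⟨?_, ?_, ?_, ?_, ?_, ?_, ?_⟩, ?_⟩ <;> simp [i0, i1, i2, i3, i4, i8, hsq, hL]
  · simp [Expr.cost]
    omega

end Setup

/-! ### The table of partition numbers -/

section Table

theorem Expr.val_lt_le_one (s : State) (e f : Expr) : (Expr.lt e f).val s ≤ 1 := by
  simp only [Expr.val]; split <;> omega

theorem Expr.val_eq_le_one (s : State) (e f : Expr) : (Expr.eq e f).val s ≤ 1 := by
  simp only [Expr.val]; split <;> omega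

/-- One digit of an addition: register `v` holds the sum of two digits and the carry, the digit
goes to cell `i` of array `a` and the new carry to register `r`. -/
def putDigit (a : ℕ) (i : Expr) (v r : ℕ) : Prog :=
  .ite (.lt (.reg v) (.reg 0))
    (.seq (.store a i (.reg v)) (.set r (.lit 0)))
    (.seq (.store a i (.sub (.reg v) (.reg 0))) (.set r (.lit 1)))

theorem putDigit_spec {q D a v r : ℕ} {i : Expr} (hi : i.Small) {s : State} (h0 : s.reg 0 = q)
    (hv : s.reg v < 2 * q) {Q : State → Prop}
    (hQ : Q ((s.setCell a (i.val s) (s.reg v % q)).setReg r (s.reg v / q))) :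
    Tri q D (putDigit a i v r) (20 + 2 * i.cost) Q s := by
  have hq : 0 < q := by omega
  refine Tri.time (Tri.ite (T₁ := 4 + i.cost) (T₂ := 6 + i.cost)
    (by simp [Expr.Small, Expr.leaves, Expr.maxLit]) (fun hb => ?_) (fun hb => ?_)) ?_
  · simp only [Expr.val, h0] at hb
    have hlt : s.reg v < q := by
      by_contra h; simp [h] at hb
    refine Tri.time (Tri.store_seq hi (by simp [Expr.Small, Expr.leaves, Expr.maxLit]) (fun _ => hlt) <|
      Tri.set (by decide) (fun _ => Nat.zero_le _) ?_) (by simp [Expr.cost]; omega)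
    rw [Nat.mod_eq_of_lt hlt, Nat.div_eq_of_lt hlt] at hQ
    exact hQ
  · simp only [Expr.val, h0] at hb
    have hlt : q ≤ s.reg v := by
      by_contra h; simp [not_le.1 h] at hb
    have e1 : s.reg v % q = s.reg v - q := by
      rw [Nat.mod_eq_sub_mod hlt, Nat.mod_eq_of_lt (by omega)]
    have e2 : s.reg v / q = 1 := by
      rw [Nat.div_eq_sub_div hq hlt, Nat.div_eq_of_lt (by omega)]
    refine Tri.time (Tri.store_seq hi (by simp [Expr.Small, Expr.leaves, Expr.maxLit])
      (fun _ => ?_) <|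
      Tri.set (by decide) (fun hs => ?_) ?_) (by simp [Expr.cost]; omega)
    · simp only [Expr.val, h0]; omega
    · have := hs.five_le
      simp only [Expr.val]; omega
    · rw [e1, e2] at hQ
      simp only [Expr.val, h0]
      exact hQ
  · simp [Expr.cost]; omega

/-- Add two numbers of the table: flags in registers `17`, `18`, addresses in registers `14`, `15`,
carry in register `13`; the sum goes to the address in register `16`. -/
def sumProg : Prog :=
  .forLoop 19 (.reg 5)
    (.seq (.set 20 (.add (.add (.mul (.reg 17) (.cell 2 (.add (.reg 14) (.reg 19))))
        (.mul (.reg 18) (.cell 2 (.add (.reg 15) (.reg 19))))) (.reg 13)))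
      (putDigit 2 (.add (.reg 16) (.reg 19)) 20 13))

/-- The operands are read while the result is being written from the address in register `16` on.
The hypotheses therefore speak of any array `u` that agrees with the present one below that address.
A zero flag makes an operand vanish whatever its address contains. -/
theorem sumProg_spec {q n k h N L D x y : ℕ} (hp : Params q n k h N L D) {s : State}
    (hs : Env q n k h N L s)
    (hx : ∀ j < L, ∀ u : ℕ → ℕ, (∀ i < s.reg 16, u i = s.arr 2 i) →
      s.reg 17 * u (s.reg 14 + j) = x / q ^ j % q)
    (hy : ∀ j < L, ∀ u : ℕ → ℕ, (∀ i < s.reg 16, u i = s.arr 2 i) →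
      s.reg 18 * u (s.reg 15 + j) = y / q ^ j % q)
    (hc : s.reg 13 ≤ 1) :
    Tri q D sumProg (100 * (L + 1)) (fun s' => (∀ r < 13, s'.reg r = s.reg r) ∧
      (∀ a, a ≠ 2 → s'.arr a = s.arr a) ∧ (∀ i < s.reg 16, s'.arr 2 i = s.arr 2 i) ∧
      ∀ j < L, s'.arr 2 (s.reg 16 + j) = (x + y + s.reg 13) / q ^ j % q) s := by
  have hD := hp.le_D
  have hq := hp.two_le
  refine Tri.mono (Tri.forLoop (m := L) (T := 60)
    (fun j s' => (∀ r < 13, s'.reg r = s.reg r) ∧ (∀ r, 14 ≤ r → r ≤ 18 → s'.reg r = s.reg r) ∧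
      (∀ a, a ≠ 2 → s'.arr a = s.arr a) ∧ (∀ i < s.reg 16, s'.arr 2 i = s.arr 2 i) ∧
      s'.reg 13 = carry q (s.reg 13) x y j ∧
      ∀ j' < j, s'.arr 2 (s.reg 16 + j') = (x + y + s.reg 13) / q ^ j' % q)
    (by decide) (by omega) (fun j s' h => ?_) ?_ ?_) ?_ ?_
  · simp only [Expr.val, h.1 5 (by omega), hs.r5]
  · refine ⟨fun r hr => ?_, fun r hr hr' => ?_, fun a _ => rfl, fun i _ => rfl, ?_, ?_⟩
    · simp; omega
    · simp; omega
    · simp [carry_zero]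
    · intro j hj; omega
  · intro j s' hj h19 hg ⟨i1, i2, i3, i4, i5, i6⟩
    have hcar := carry_le_one (q := q) (by omega) hc x y j
    have dx := Nat.mod_lt (x / q ^ j) (show 0 < q by omega)
    have dy := Nat.mod_lt (y / q ^ j) (show 0 < q by omega)
    have hval : s'.reg 17 * s'.arr 2 (s'.reg 14 + s'.reg 19) +
        s'.reg 18 * s'.arr 2 (s'.reg 15 + s'.reg 19) + s'.reg 13 =
        x / q ^ j % q + y / q ^ j % q + carry q (s.reg 13) x y j := by
      rw [i2 17 (by omega) (by omega), i2 14 (by omega) (by omega), i2 18 (by omega) (by omega),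
        i2 15 (by omega) (by omega), h19, i5, hx j hj _ i4, hy j hj _ i4]
    refine Tri.time (Tri.set_seq (by decide) (fun _ => ?_) <|
      putDigit_spec (by decide) ?_ ?_ ?_) (by decide)
    · have := hg.two_mul_le
      simp only [Expr.val, hval]
      omega
    · simp [i1, hs.r0]
    · simp only [Expr.val, hval, State.setReg_reg, if_true]
      omega
    · simp only [Expr.val, hval, State.setReg_reg, if_true]
      rw [← digit_add (by omega), ← carry_succ (by omega)]
      refine ⟨by simp [h19], ?_, ?_, ?_, ?_, ?_, ?_⟩
      · intro r hr
        simp [show r ≠ 19 by omega, show r ≠ 13 by omega, show r ≠ 20 by omega, i1 r hr]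
      · intro r hr hr'
        simp [show r ≠ 19 by omega, show r ≠ 13 by omega, show r ≠ 20 by omega, i2 r hr hr']
      · intro a ha
        simp [State.setCell_arr_ne _ _ _ ha, i3 a ha]
      · intro i hi
        simp [i2, h19, i4 i hi]
        omega
      · simp
      · intro j' hj'
        simp only [State.setReg_arr, State.setCell_arr_self]
        simp [i2, h19]
        split_ifs with hne
        · rw [hne]
        · exact i6 j' (by omega)
  · simp [Expr.cost]; omega
  · rintro s' ⟨-, i1, -, i3, i4, -, i6⟩
    exact ⟨i1, i3, i4, i6⟩

/-- The entries of the table up to the slot `t` are correct. -/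
def Filled (q k h N L t : ℕ) (f : ℕ → ℕ) : Prop :=
  ∀ a ≤ k, ∀ b ≤ h, ∀ i ≤ N, (a * (h + 1) + b) * (N + 1) + i < t →
    ∀ j < L, f (addr h N L a b i + j) = boxPart a b i / q ^ j % q

/-- Prepare the addition that computes one entry of the table. -/
def entryArgs : Prog :=
  .seq (.set 13 (.eq (.add (.reg 10) (.reg 12)) (.lit 0))) <|
  .seq (.set 14 (addrExpr (.sub (.reg 10) (.lit 1)) (.reg 11) (.reg 12))) <|
  .seq (.set 15 (addrExpr (.reg 10) (.sub (.reg 11) (.lit 1)) (.sub (.reg 12) (.reg 10)))) <|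
  .seq (.set 16 (addrExpr (.reg 10) (.reg 11) (.reg 12))) <|
  .seq (.set 17 (.lt (.lit 0) (.reg 10))) <|
  .set 18 (.mul (.lt (.lit 0) (.reg 10)) (.mul (.lt (.lit 0) (.reg 11))
    (.sub (.lit 1) (.lt (.reg 12) (.reg 10)))))

theorem Env.setReg {q n k h N L r v : ℕ} {s : State} (hs : Env q n k h N L s) (hr : 7 ≤ r) :
    Env q n k h N L (s.setReg r v) :=
  hs.congr fun r' hr' => by rw [State.setReg_reg, if_neg (by omega)]

theorem entryArgs_spec {q n k h N L D a b i : ℕ} (hp : Params q n k h N L D) {s : State}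
    (hs : Env q n k h N L s) (ha : a ≤ k) (hb : b ≤ h) (hi : i ≤ N)
    (h10 : s.reg 10 = a) (h11 : s.reg 11 = b) (h12 : s.reg 12 = i) :
    Tri q D entryArgs 100 (fun s' => (∀ r < 13, s'.reg r = s.reg r) ∧ s'.arr = s.arr ∧
      s'.reg 13 = (if a + i = 0 then 1 else 0) ∧ s'.reg 14 = addr h N L (a - 1) b i ∧
      s'.reg 15 = addr h N L a (b - 1) (i - a) ∧ s'.reg 16 = addr h N L a b i ∧
      s'.reg 17 = (if 0 < a then 1 else 0) ∧
      s'.reg 18 = (if 0 < a ∧ 0 < b ∧ a ≤ i then 1 else 0)) s := by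
  have hD := hp.le_D
  have a1 := hp.addr_le (a := a - 1) (by omega) hb hi
  have a2 := hp.addr_le (b := b - 1) (i := i - a) ha (by omega) (by omega)
  have a3 := hp.addr_le ha hb hi
  refine Tri.time (Tri.set_seq (by decide) (fun _ => ?_) <| Tri.set_seq (by decide) (fun _ => ?_) <|
    Tri.set_seq (by decide) (fun _ => ?_) <| Tri.set_seq (by decide) (fun _ => ?_) <|
    Tri.set_seq (by decide) (fun _ => ?_) <| Tri.set (by decide) (fun _ => ?_) ?_)
    (by simp [Expr.cost, addrExpr])
  · exact (Expr.val_eq_le_one _ _ _).trans (by omega)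
  · rw [addrExpr_val (hs.setReg (by omega))]
    simpa [Expr.val, h10, h11, h12] using a1
  · rw [addrExpr_val ((hs.setReg (by omega)).setReg (by omega))]
    simpa [Expr.val, h10, h11, h12] using a2
  · rw [addrExpr_val (((hs.setReg (by omega)).setReg (by omega)).setReg (by omega))]
    simpa [Expr.val, h10, h11, h12] using a3
  · exact (Expr.val_lt_le_one _ _ _).trans (by omega)
  · exact (Nat.mul_le_mul (Expr.val_lt_le_one _ _ _) (Nat.mul_le_mul (Expr.val_lt_le_one _ _ _)
      (Nat.sub_le 1 _))).trans (by omega)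
  · rw [addrExpr_val (hs.setReg (by omega)),
      addrExpr_val ((hs.setReg (by omega)).setReg (by omega)),
      addrExpr_val (((hs.setReg (by omega)).setReg (by omega)).setReg (by omega))]
    refine ⟨fun r hr => ?_, rfl, ?_, ?_, ?_, ?_, ?_, ?_⟩
    · simp [show r ≠ 13 by omega, show r ≠ 14 by omega, show r ≠ 15 by omega,
        show r ≠ 16 by omega, show r ≠ 17 by omega, show r ≠ 18 by omega]
    · simp [Expr.val, h10, h12]
    · simp [Expr.val, h10, h11, h12]
    · simp [Expr.val, h10, h11, h12]
    · simp [Expr.val, h10, h11, h12]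
    · simp [Expr.val, h10]
    · simp only [Expr.val, State.setReg_reg]
      simp only [Nat.reduceEqDiff, if_false, if_true, h10, h11, h12]
      by_cases h1 : 0 < a <;> by_cases h2 : 0 < b <;> by_cases h3 : i < a <;>
        simp [h1, h2, h3]

/-- Compute one entry of the table. -/
def entryProg : Prog := .seq entryArgs sumProg

theorem addr_add_lt_addr {h N L a b i a' b' i' j : ℕ} (hj : j < L)
    (hlt : (a * (h + 1) + b) * (N + 1) + i < (a' * (h + 1) + b') * (N + 1) + i') :
    addr h N L a b i + j < addr h N L a' b' i' := by
  have := Nat.mul_le_mul_right L hlt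
  unfold addr
  nlinarith

/-- The recurrence with its case distinctions turned into flags. The seed 1 for a = i = 0 enters the
addition as initial carry, and the truncated indices are harmless because the flags vanish where
truncation occurs. -/
theorem boxPart_eq_flags (a b i : ℕ) :
    (if 0 < a then 1 else 0) * boxPart (a - 1) b i +
      (if 0 < a ∧ 0 < b ∧ a ≤ i then 1 else 0) * boxPart a (b - 1) (i - a) +
      (if a + i = 0 then 1 else 0) = boxPart a b i := by
  cases a with
  | zero => simp [boxPart_zero]
  | succ a =>
    rw [boxPart_succ a b i, topPart]
    by_cases h : b = 0 ∨ i < a + 1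
    · rw [if_pos h, if_neg (show ¬ (0 < a + 1 ∧ 0 < b ∧ a + 1 ≤ i) by omega)]
      simp
    · rw [if_neg h, if_pos (show 0 < a + 1 ∧ 0 < b ∧ a + 1 ≤ i by omega)]
      simp

/-- Both summands that are switched on lie in earlier slots for the order (a, b, i), hence are
already filled and are not overwritten. -/
theorem entryProg_spec {q n k h N L D a b i : ℕ} (hp : Params q n k h N L D) {s : State}
    (hs : Env q n k h N L s) (ha : a ≤ k) (hb : b ≤ h) (hi : i ≤ N)
    (h10 : s.reg 10 = a) (h11 : s.reg 11 = b) (h12 : s.reg 12 = i)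
    (hF : Filled q k h N L ((a * (h + 1) + b) * (N + 1) + i) (s.arr 2)) :
    Tri q D entryProg (300 * (L + 1)) (fun s' => (∀ r < 13, s'.reg r = s.reg r) ∧
      (∀ a, a ≠ 2 → s'.arr a = s.arr a) ∧
      Filled q k h N L ((a * (h + 1) + b) * (N + 1) + i + 1) (s'.arr 2)) s := by
  refine Tri.time (Tri.seq (entryArgs_spec hp hs ha hb hi h10 h11 h12) (T₂ := 100 * (L + 1)) ?_)
    (by omega)
  intro s₁ ⟨g1, g2, g3, g4, g5, g6, g7, g8⟩
  refine Tri.post (sumProg_spec (x := (if 0 < a then 1 else 0) * boxPart (a - 1) b i)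
    (y := (if 0 < a ∧ 0 < b ∧ a ≤ i then 1 else 0) * boxPart a (b - 1) (i - a)) hp
    (hs.congr fun r hr => g1 r (by omega)) ?_ ?_ ?_) ?_
  · intro j hj u hu
    rw [g6, g2] at hu
    rw [g7, g4]
    by_cases h0 : 0 < a
    · have hlt : ((a - 1) * (h + 1) + b) * (N + 1) + i < (a * (h + 1) + b) * (N + 1) + i := by
        obtain ⟨a', rfl⟩ := Nat.exists_eq_add_of_lt h0
        simp only [zero_add, Nat.add_sub_cancel]
        nlinarith
      rw [hu _ (addr_add_lt_addr hj hlt), hF (a - 1) (by omega) b hb i hi hlt j hj]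
      simp only [if_pos h0, one_mul]
    · simp only [if_neg h0, zero_mul, Nat.zero_div, Nat.zero_mod]
  · intro j hj u hu
    rw [g6, g2] at hu
    rw [g8, g5]
    by_cases h0 : 0 < a ∧ 0 < b ∧ a ≤ i
    · have hlt : (a * (h + 1) + (b - 1)) * (N + 1) + (i - a) < (a * (h + 1) + b) * (N + 1) + i := by
        obtain ⟨b', rfl⟩ := Nat.exists_eq_add_of_lt h0.2.1
        simp only [zero_add, Nat.add_sub_cancel]
        have : i - a ≤ i := Nat.sub_le _ _
        nlinarith
      rw [hu _ (addr_add_lt_addr hj hlt), hF a ha (b - 1) (by omega) (i - a) (by omega) hlt j hj]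
      simp only [if_pos h0, one_mul]
    · simp only [if_neg h0, zero_mul, Nat.zero_div, Nat.zero_mod]
  · rw [g3]
    split <;> omega
  · rintro s' - ⟨k1, k2, k3, k4⟩
    rw [g6] at k3 k4
    rw [g2] at k2 k3
    rw [g3, boxPart_eq_flags] at k4
    refine ⟨fun r hr => by rw [k1 r hr, g1 r hr], k2, ?_⟩
    intro a' ha' b' hb' i' hi' hlt j hj
    rcases Nat.lt_succ_iff_lt_or_eq.1 hlt with hlt | heq
    · rw [k3 _ (addr_add_lt_addr hj hlt), hF a' ha' b' hb' i' hi' hlt j hj]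
    · obtain ⟨rfl, rfl, rfl⟩ := slot_inj hb' hi' hb hi heq
      exact k4 j hj

/-- Compute the table of the partition numbers. -/
def tableProg : Prog :=
  .forLoop 10 (.add (.reg 2) (.lit 1)) <| .forLoop 11 (.add (.reg 3) (.lit 1)) <|
    .forLoop 12 (.add (.reg 4) (.lit 1)) entryProg

/-- The dominating cost: (k + 1)(h + 1)(N + 1) additions of L digits, that is O(N^(5/2)). The
constants 300, 400, 500, 1000 of the nested loops grow to absorb their overhead. -/
theorem tableProg_spec {q n k h N L D : ℕ} (hp : Params q n k h N L D) {s : State}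
    (hs : Env q n k h N L s) :
    Tri q D tableProg (1000 * ((k + 1) * (h + 1) * (N + 1) * (L + 1)))
      (fun s' => (∀ r < 10, s'.reg r = s.reg r) ∧ (∀ a, a ≠ 2 → s'.arr a = s.arr a) ∧
      Filled q k h N L ((k + 1) * (h + 1) * (N + 1)) (s'.arr 2)) s := by
  have hD := hp.le_D
  have hkD : k + h = n := hp.n_eq.symm
  refine Tri.mono (Tri.forLoop (m := k + 1) (T := 500 * ((h + 1) * (N + 1) * (L + 1)))
    (fun a s' => (∀ r < 10, s'.reg r = s.reg r) ∧ (∀ a, a ≠ 2 → s'.arr a = s.arr a) ∧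
      Filled q k h N L (a * (h + 1) * (N + 1)) (s'.arr 2))
    (by decide) (by omega) (fun j s' h => ?_) ?_ ?_) ?_ ?_
  · simp only [Expr.val, h.1 2 (by omega), hs.r2]
  · refine ⟨fun r hr => by simp; omega, fun a _ => rfl, fun a _ b _ i _ hlt => ?_⟩
    simp at hlt
  · intro a s₁ ha h10 _ ⟨i1, i2, i3⟩
    refine Tri.mono (Tri.forLoop (m := h + 1) (T := 400 * ((N + 1) * (L + 1)))
      (fun b s' => s'.reg 10 = a ∧ (∀ r < 10, s'.reg r = s.reg r) ∧
        (∀ a, a ≠ 2 → s'.arr a = s.arr a) ∧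
        Filled q k h N L ((a * (h + 1) + b) * (N + 1)) (s'.arr 2))
      (by decide) (by omega) (fun j s' h => ?_) ?_ ?_) ?_ ?_
    · simp only [Expr.val, h.2.1 3 (by omega), hs.r3]
    · refine ⟨by simp [h10], fun r hr => ?_, i2, i3⟩
      simp [show r ≠ 11 by omega, i1 r hr]
    · intro b s₂ hb h11 _ ⟨j0, j1, j2, j3⟩
      refine Tri.mono (Tri.forLoop (m := N + 1) (T := 300 * (L + 1))
        (fun i s' => s'.reg 10 = a ∧ s'.reg 11 = b ∧ (∀ r < 10, s'.reg r = s.reg r) ∧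
          (∀ a, a ≠ 2 → s'.arr a = s.arr a) ∧
          Filled q k h N L ((a * (h + 1) + b) * (N + 1) + i) (s'.arr 2))
        (by decide) (by omega) (fun j s' h => ?_) ?_ ?_) ?_ ?_
      · simp only [Expr.val, h.2.2.1 4 (by omega), hs.r4]
      · refine ⟨by simp [j0], by simp [h11], fun r hr => ?_, j2, j3⟩
        simp [show r ≠ 12 by omega, j1 r hr]
      · intro i s₃ hi h12 _ ⟨l0, l1, l2, l3, l4⟩
        refine Tri.post (entryProg_spec hp (hs.congr fun r hr => l2 r (by omega)) (by omega)
          (by omega) (by omega) l0 l1 h12 l4) ?_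
        rintro s₄ - ⟨m1, m2, m3⟩
        refine ⟨by rw [m1 12 (by omega), h12], by simp [m1 10, l0], by simp [m1 11, l1],
          fun r hr => ?_, fun a ha => ?_, m3⟩
        · simp [show r ≠ 12 by omega, m1 r (by omega), l2 r hr]
        · simp [m2 a ha, l3 a ha]
      · simp [Expr.cost]; nlinarith
      · rintro s' ⟨-, m0, m1, m2, m3, m4⟩
        refine ⟨m1, by simp [m0], fun r hr => ?_, m3, ?_⟩
        · simp [show r ≠ 11 by omega, m2 r hr]
        · rw [State.setReg_arr]
          convert m4 using 1; ring
    · simp [Expr.cost]; nlinarith [Nat.zero_le (N * L), Nat.zero_le (h * (N * L)), Nat.zero_le (h * N), Nat.zero_le (h * L)]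
    · rintro s' ⟨-, m0, m1, m2, m3⟩
      refine ⟨m0, fun r hr => ?_, m2, ?_⟩
      · simp [show r ≠ 10 by omega, m1 r hr]
      · rw [State.setReg_arr]
        convert m3 using 1; ring
  · simp only [Expr.cost]
    have h1 : 1 ≤ (h + 1) * (N + 1) * (L + 1) := Nat.one_le_iff_ne_zero.2 (by positivity)
    have h2 : (k + 1) * (h + 1) * (N + 1) * (L + 1) = (k + 1) * ((h + 1) * (N + 1) * (L + 1)) := by
      ring
    rw [h2]
    generalize (h + 1) * (N + 1) * (L + 1) = Z at *
    nlinarith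
  · rintro s' ⟨-, m1, m2, m3⟩
    exact ⟨m1, m2, m3⟩

end Table

/-! ### Shifted addition, subtraction and comparison of long numbers -/

section Arithmetic

/-- The digit at position register `31` of the number of the table at the address in register `20`,
shifted by register `21` and multiplied by the flag in register `22`. -/
def windowExpr : Expr :=
  .mul (.mul (.sub (.lit 1) (.lt (.reg 31) (.reg 21)))
    (.lt (.sub (.reg 31) (.reg 21)) (.reg 5)))
    (.mul (.reg 22) (.cell 2 (.add (.reg 20) (.sub (.reg 31) (.reg 21)))))

/-- The number selected by the registers `20` and `22` is `y`. -/
def Selects (q L y : ℕ) (s : State) : Prop :=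
  y < q ^ L ∧ ∀ j < L, s.reg 22 * s.arr 2 (s.reg 20 + j) = y / q ^ j % q

/-- Multiplication by a power of q is done by shifting the position read. The two comparisons blank
out the digits below the shift and those beyond the L stored ones. -/
theorem windowExpr_val {q L y p o : ℕ} (hq : 2 ≤ q) {s : State} (h5 : s.reg 5 = L)
    (h21 : s.reg 21 = o) (h31 : s.reg 31 = p) (hy : Selects q L y s) :
    windowExpr.val s = y * q ^ o / q ^ p % q := by
  rw [digit_mul_pow (by omega)]
  simp only [windowExpr, Expr.val, h5, h21, h31]
  by_cases h1 : p < o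
  · simp [h1]
  · by_cases h2 : p - o < L
    · simp [h1, h2, hy.2 _ h2]
    · have h3 : y / q ^ (p - o) % q = 0 :=
        digit_eq_zero (hy.1.trans_le (Nat.pow_le_pow_right (by omega) (by omega)))
      simp [h1, h2, h3]

/-- Add the selected number, shifted by register `21`, to the number in array `1`. -/
def addProg : Prog :=
  .seq (.set 30 (.lit 0)) <|
  .forLoop 31 (.reg 6)
    (.seq (.set 32 (.add (.add (.cell 1 (.reg 31)) windowExpr) (.reg 30)))
      (putDigit 1 (.reg 31) 32 30))

theorem addProg_spec {q n k h N L D y z o : ℕ} (hp : Params q n k h N L D) {s : State}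
    (hs : Env q n k h N L s) (h21 : s.reg 21 = o) (hy : Selects q L y s)
    (hz : s.arr 1 = digitArray q z) (hlt : z + y * q ^ o < q ^ (L + N + 1)) :
    Tri q D addProg (100 * (L + N + 2)) (fun s' => (∀ r < 30, s'.reg r = s.reg r) ∧
      (∀ a, a ≠ 1 → s'.arr a = s.arr a) ∧ s'.arr 1 = digitArray q (z + y * q ^ o)) s := by
  have hD := hp.le_D
  have hq := hp.two_le
  refine Tri.time (Tri.set_seq (by decide) (fun _ => Nat.zero_le _) <|
    Tri.post (Tri.forLoop (m := L + N + 1) (T := 80)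
    (fun p s' => (∀ r < 30, s'.reg r = s.reg r) ∧ (∀ a, a ≠ 1 → s'.arr a = s.arr a) ∧
      s'.reg 30 = carry q 0 z (y * q ^ o) p ∧
      (∀ i < p, s'.arr 1 i = digitArray q (z + y * q ^ o) i) ∧
      (∀ i, p ≤ i → s'.arr 1 i = digitArray q z i))
    (by decide) (by omega) (fun j s' h => ?_) ?_ ?_) ?_) ?_
  · simp only [Expr.val, h.1 6 (by omega), hs.r6]
  · refine ⟨fun r hr => ?_, fun a _ => rfl, ?_, ?_, ?_⟩
    · simp [show r ≠ 30 by omega, show r ≠ 31 by omega]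
    · simp [carry_zero, Expr.val]
    · intro i hi; omega
    · intro i _; simp [hz]
  · intro p s' hp' h31 hg ⟨i1, i2, i3, i4, i5⟩
    have hcar := carry_le_one (q := q) (by omega) (Nat.zero_le 1) z (y * q ^ o) p
    have dz := Nat.mod_lt (z / q ^ p) (show 0 < q by omega)
    have dy := Nat.mod_lt (y * q ^ o / q ^ p) (show 0 < q by omega)
    have hw : windowExpr.val s' = y * q ^ o / q ^ p % q := by
      refine windowExpr_val hq (by rw [i1 5 (by omega), hs.r5]) (by rw [i1 21 (by omega), h21]) h31
        ⟨hy.1, fun j hj => ?_⟩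
      rw [i1 22 (by omega), i1 20 (by omega), i2 2 (by omega), hy.2 j hj]
    have hval : (Expr.add (.add (.cell 1 (.reg 31)) windowExpr) (.reg 30)).val s' =
        z / q ^ p % q + y * q ^ o / q ^ p % q + carry q 0 z (y * q ^ o) p := by
      simp only [Expr.val, h31, i3, i5 p le_rfl] at hw ⊢
      rw [hw]
      rfl
    have hdig := digit_add (q := q) (by omega) 0 z (y * q ^ o) p
    have hcs := carry_succ (q := q) (by omega) 0 z (y * q ^ o) p
    rw [← hval] at hdig hcs
    refine Tri.time (Tri.set_seq (by decide) (fun _ => ?_) <|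
      putDigit_spec (by decide) ?_ ?_ ?_) (by decide)
    · have := hg.two_mul_le
      rw [hval]
      omega
    · simp [i1, hs.r0]
    · rw [State.setReg_reg, if_pos rfl, hval]
      omega
    · have e32 : ∀ E, (s'.setReg 32 E).reg 32 = E := fun E => by simp
      rw [e32, ← hdig, ← hcs]
      refine ⟨by simp [h31], ?_, ?_, ?_, ?_, ?_⟩
      · intro r hr
        simp [show r ≠ 30 by omega, show r ≠ 31 by omega, show r ≠ 32 by omega, i1 r hr]
      · intro a ha
        simp [State.setCell_arr_ne _ _ _ ha, i2 a ha]
      · simp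
      · intro i hi
        simp only [State.setReg_arr, State.setCell_arr_self]
        simp only [Expr.val, State.setReg_reg]
        simp only [Nat.reduceEqDiff, if_false, h31]
        split_ifs with hne
        · rw [hne]; rfl
        · exact i4 i (by omega)
      · intro i hi
        simp only [State.setReg_arr, State.setCell_arr_self]
        simp only [Expr.val, State.setReg_reg]
        simp only [Nat.reduceEqDiff, if_false, h31]
        rw [if_neg (by omega), i5 i (by omega)]
  · rintro s' - ⟨-, i1, i2, -, i4, i5⟩
    refine ⟨i1, i2, ?_⟩
    funext i
    by_cases hi : i < L + N + 1
    · exact i4 i hi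
    · rw [i5 i (by omega), digitArray_eq_zero (by omega) hlt (by omega),
        digitArray_eq_zero (W := L + N + 1) (by omega) (by omega) (by omega)]
  · simp [Expr.cost]; omega

/-- Subtract the selected number, shifted by register `21`, from the number in array `0`; the
digits of the difference go to array `a` and the borrow to register `30`. -/
def subProg (a : ℕ) : Prog :=
  .seq (.set 30 (.lit 0)) <|
  .forLoop 31 (.reg 6)
    (.seq (.set 32 (.add windowExpr (.reg 30))) <|
      .ite (.lt (.cell 0 (.reg 31)) (.reg 32))
        (.seq (.store a (.reg 31) (.sub (.add (.cell 0 (.reg 31)) (.reg 0)) (.reg 32)))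
          (.set 30 (.lit 1)))
        (.seq (.store a (.reg 31) (.sub (.cell 0 (.reg 31)) (.reg 32))) (.set 30 (.lit 0))))

/-- The final borrow decides whether the shifted number is at most `z`. With a scratch array as
target this is a comparison that leaves `z` intact; with array `0` it is the subtraction itself,
since each digit is read before it is overwritten. -/
theorem subProg_spec {q n k h N L D y z o : ℕ} (hp : Params q n k h N L D) {s : State}
    (hs : Env q n k h N L s) (h21 : s.reg 21 = o) (hy : Selects q L y s) {a : ℕ} (ha2 : a ≠ 2)
    (hz : s.arr 0 = digitArray q z) (hzlt : z < q ^ (L + N + 1))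
    (hylt : y * q ^ o < q ^ (L + N + 1)) :
    Tri q D (subProg a) (100 * (L + N + 2)) (fun s' => (∀ r < 30, s'.reg r = s.reg r) ∧
      (∀ a', a' ≠ a → s'.arr a' = s.arr a') ∧ (s'.reg 30 = 0 ↔ y * q ^ o ≤ z) ∧
      (a = 0 → y * q ^ o ≤ z → s'.arr 0 = digitArray q (z - y * q ^ o))) s := by
  have hD := hp.le_D
  have hq := hp.two_le
  refine Tri.time (Tri.set_seq (by decide) (fun _ => Nat.zero_le _) <|
    Tri.post (Tri.forLoop (m := L + N + 1) (T := 80)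
    (fun p s' => (∀ r < 30, s'.reg r = s.reg r) ∧ (∀ a', a' ≠ a → s'.arr a' = s.arr a') ∧
      s'.reg 30 = borrow q z (y * q ^ o) p ∧
      (∀ i < p, s'.arr a i + (y * q ^ o / q ^ i % q + borrow q z (y * q ^ o) i) =
        z / q ^ i % q + q * borrow q z (y * q ^ o) (i + 1)) ∧
      (∀ i, p ≤ i → s'.arr 0 i = digitArray q z i))
    (by decide) (by omega) (fun j s' h => ?_) ?_ ?_) ?_) ?_
  · simp only [Expr.val, h.1 6 (by omega), hs.r6]
  · refine ⟨fun r hr => ?_, fun a _ => rfl, ?_, ?_, ?_⟩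
    · simp [show r ≠ 30 by omega, show r ≠ 31 by omega]
    · simp [borrow_zero, Expr.val]
    · intro i hi; omega
    · intro i _; simp [hz]
  · intro p s' hp' h31 hg ⟨i1, i2, i3, i4, i5⟩
    have hbor := borrow_le_one q z (y * q ^ o) p
    have dz := Nat.mod_lt (z / q ^ p) (show 0 < q by omega)
    have dy := Nat.mod_lt (y * q ^ o / q ^ p) (show 0 < q by omega)
    have hw : windowExpr.val s' = y * q ^ o / q ^ p % q := by
      refine windowExpr_val hq (by rw [i1 5 (by omega), hs.r5]) (by rw [i1 21 (by omega), h21]) h31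
        ⟨hy.1, fun j hj => ?_⟩
      rw [i1 22 (by omega), i1 20 (by omega), i2 2 (by omega), hy.2 j hj]
    have hval : (Expr.add windowExpr (.reg 30)).val s' =
        y * q ^ o / q ^ p % q + borrow q z (y * q ^ o) p := by
      simp only [Expr.val, i3] at hw ⊢
      rw [hw]
    have hbs := borrow_succ (q := q) (by omega) z (y * q ^ o) p
    have hcell : s'.arr 0 p = z / q ^ p % q := i5 p le_rfl
    -- The two branches differ only in the digit stored and the new borrow; the invariant for the
    -- next position follows from the digit equation alone.
    have fin : ∀ v b, b = borrow q z (y * q ^ o) (p + 1) →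
        v + (y * q ^ o / q ^ p % q + borrow q z (y * q ^ o) p) = z / q ^ p % q + q * b →
        ∀ w, (((s'.setReg 32 w).setCell a p v).setReg 30 b).reg 31 = p ∧
        (∀ r < 30, ((((s'.setReg 32 w).setCell a p v).setReg 30 b).setReg 31 (p + 1)).reg r =
          s.reg r) ∧
        (∀ a', a' ≠ a → ((((s'.setReg 32 w).setCell a p v).setReg 30 b).setReg 31 (p + 1)).arr a' =
          s.arr a') ∧
        ((((s'.setReg 32 w).setCell a p v).setReg 30 b).setReg 31 (p + 1)).reg 30 =
          borrow q z (y * q ^ o) (p + 1) ∧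
        (∀ i < p + 1, ((((s'.setReg 32 w).setCell a p v).setReg 30 b).setReg 31 (p + 1)).arr a i +
          (y * q ^ o / q ^ i % q + borrow q z (y * q ^ o) i) =
          z / q ^ i % q + q * borrow q z (y * q ^ o) (i + 1)) ∧
        (∀ i, p + 1 ≤ i → ((((s'.setReg 32 w).setCell a p v).setReg 30 b).setReg 31 (p + 1)).arr 0 i =
          digitArray q z i) := by
      intro v b hb hv w
      refine ⟨by simp [h31], ?_, ?_, ?_, ?_, ?_⟩
      · intro r hr
        simp [show r ≠ 30 by omega, show r ≠ 31 by omega, show r ≠ 32 by omega, i1 r hr]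
      · intro a' ha
        simp [State.setCell_arr_ne _ _ _ ha, i2 a' ha]
      · simp [hb]
      · intro i hi
        simp only [State.setReg_arr, State.setCell_arr_self]
        split_ifs with hne
        · rw [hne, hv, hb]
        · exact i4 i (by omega)
      · intro i hi
        simp only [State.setReg_arr, State.setCell_arr]
        rw [if_neg (by omega), i5 i (by omega)]
    have e31 : ∀ E, (Expr.reg 31).val (s'.setReg 32 E) = p := fun E => by simp [Expr.val, h31]
    refine Tri.time (Tri.set_seq (by decide) (fun _ => ?_) <|
      Tri.ite (T₁ := 20) (T₂ := 20) (by decide) (fun hb => ?_) (fun hb => ?_)) (by decide)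
    · have := hg.two_mul_le
      rw [hval]
      omega
    · simp only [Expr.val, State.setReg_reg, State.setReg_arr] at hb hval
      simp only [Nat.reduceEqDiff, if_false, if_true, h31, hval, hcell] at hb
      have hlt : z / q ^ p % q < y * q ^ o / q ^ p % q + borrow q z (y * q ^ o) p := by
        by_contra hc; simp [hc] at hb
      rw [if_pos hlt] at hbs
      refine Tri.time (Tri.store_seq (by decide) (by decide) (fun _ => ?_) <|
        Tri.set (by decide) (fun _ => ?_) ?_) (by decide)
      · simp only [Expr.val, State.setReg_reg, State.setReg_arr]
        simp only [Nat.reduceEqDiff, if_false, if_true, h31, hval, hcell]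
        simp [i1, hs.r0]
        omega
      · simp only [Expr.val]; omega
      · rw [e31]
        refine fin _ 1 hbs.symm ?_ _
        simp only [Expr.val, State.setReg_reg, State.setReg_arr]
        simp only [Nat.reduceEqDiff, if_false, if_true, h31, hval, hcell]
        simp [i1, hs.r0]
        omega
    · simp only [Expr.val, State.setReg_reg, State.setReg_arr] at hb hval
      simp only [Nat.reduceEqDiff, if_false, if_true, h31, hval, hcell] at hb
      have hlt : ¬ z / q ^ p % q < y * q ^ o / q ^ p % q + borrow q z (y * q ^ o) p := by
        intro hc; simp [hc] at hb
      rw [if_neg hlt] at hbs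
      refine Tri.time (Tri.store_seq (by decide) (by decide) (fun _ => ?_) <|
        Tri.set (by decide) (fun _ => ?_) ?_) (by decide)
      · simp only [Expr.val, State.setReg_reg, State.setReg_arr]
        simp only [Nat.reduceEqDiff, if_false, if_true, h31, hval, hcell]
        omega
      · simp only [Expr.val]; omega
      · rw [e31]
        refine fin _ 0 hbs.symm ?_ _
        simp only [Expr.val, State.setReg_reg, State.setReg_arr]
        simp only [Nat.reduceEqDiff, if_false, if_true, h31, hval, hcell]
        omega
  · rintro s' - ⟨-, i1, i2, i3, i4, i5⟩
    refine ⟨i1, i2, ?_, ?_⟩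
    · rw [i3, borrow_eq_zero_iff hzlt hylt]
    · rintro rfl hle
      funext i
      by_cases hi : i < L + N + 1
      · have h1 := i4 i hi
        have h2 := digit_sub (q := q) (by omega) hle i
        unfold digitArray
        omega
      · rw [i5 i (by omega), digitArray_eq_zero (by omega) hzlt (by omega),
          digitArray_eq_zero (W := L + N + 1) (by omega) (by omega) (by omega)]
  · simp [Expr.cost]; omega

end Arithmetic

/-! ### The encoding program -/

section Encoder

theorem pathIdx_mono (w : ℕ → Bool) : Monotone (pathIdx w) :=
  monotone_nat_of_le_succ fun c => by simp [pathIdx]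

theorem sub_cnt_mono (w : ℕ → Bool) : Monotone fun c => c - cnt w c :=
  monotone_nat_of_le_succ fun c => by
    have := cnt_le w c
    simp only [cnt]
    split <;> omega

/-- A matrix in reduced row echelon form with its entries read as digits. -/
structure Coded (q n k h N L : ℕ) (w : ℕ → Bool) (M : ℕ → ℕ → ℕ) : Prop where
  cnt_eq : cnt w n = k
  entry_lt : ∀ t c, M t c < q
  pivot : ∀ c < n, w c = true → ∀ t, M t c = if t = cnt w c then 1 else 0
  zero : ∀ c < n, w c = false → ∀ t, cnt w c ≤ t → M t c = 0
  idx_lt : tailCount q k h N (siz w n + 1) +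
    (q ^ siz w n * pathIdx w n + numOf q (tabList w M n)) < q ^ (L + N + 1)

namespace Coded

variable {q n k h N L D : ℕ} {w : ℕ → Bool} {M : ℕ → ℕ → ℕ}

/-- With r pivots seen so far, the entry in row r (rows counted from 0) is 1 if the column is the
next pivot and lies below the dots otherwise. One cell thus recognises a pivot column. -/
theorem entry_ne_zero_iff (hc : Coded q n k h N L w M) {c : ℕ} (h : c < n) :
    M (cnt w c) c ≠ 0 ↔ w c = true := by
  cases hw : w c
  · simp [hc.zero c h hw _ le_rfl]
  · simp [hc.pivot c h hw]

theorem cnt_le_k (hc : Coded q n k h N L w M) {c : ℕ} (h : c ≤ n) : cnt w c ≤ k :=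
  hc.cnt_eq ▸ cnt_mono w h

theorem sub_cnt_le (hp : Params q n k h N L D) (hc : Coded q n k h N L w M) {c : ℕ} (hcn : c ≤ n) :
    c - cnt w c ≤ h := by
  have h1 := sub_cnt_mono w hcn
  have h2 := hp.n_eq
  simp only [hc.cnt_eq] at h1
  omega

theorem siz_le_N (hp : Params q n k h N L D) (hc : Coded q n k h N L w M) {c : ℕ} (hcn : c ≤ n) :
    siz w c ≤ N := by
  have h1 := siz_le w n
  have h2 := hp.n_eq
  rw [hc.cnt_eq, show n - k = h by omega, ← hp.N_eq] at h1
  exact (siz_mono w hcn).trans h1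

theorem tab_lt (hc : Coded q n k h N L w M) : numOf q (tabList w M n) < q ^ siz w n := by
  have := numOf_lt (mem_tabList_lt (w := w) hc.entry_lt n)
  rwa [length_tabList] at this

end Coded

/-- The condition that column register `10` is a pivot column. -/
def pivotExpr : Expr := .cell 0 (.add (.mul (.reg 7) (.reg 1)) (.reg 10))

/-- Copy the tableau to array `1`, and its size to register `8`. -/
def tableauProg : Prog :=
  .seq (.set 7 (.lit 0)) <| .seq (.set 8 (.lit 0)) <|
  .forLoop 10 (.reg 1) <|
    .ite pivotExpr (.set 7 (.add (.reg 7) (.lit 1))) <|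
      .seq (.forLoop 11 (.reg 7)
        (.store 1 (.sub (.sub (.add (.reg 8) (.reg 7)) (.lit 1)) (.reg 11))
          (.cell 0 (.add (.mul (.reg 11) (.reg 1)) (.reg 10)))))
        (.set 8 (.add (.reg 8) (.reg 7)))

/-- Scanning from left to right produces the tableau from its least significant end: column `c`
occupies the positions from `siz w c` on, its top entry being the most significant. -/
theorem tableauProg_spec {q n k h N L D : ℕ} {w : ℕ → Bool} {M : ℕ → ℕ → ℕ}
    (hp : Params q n k h N L D) (hc : Coded q n k h N L w M) {s : State}
    (hs : Env q n k h N L s) (hA : ∀ t, ∀ c < n, s.arr 0 (t * n + c) = M t c)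
    (h1 : ∀ i, s.arr 1 i = 0) :
    Tri q D tableauProg (200 * (n * (k + 1) + 1)) (fun s' => (∀ r < 7, s'.reg r = s.reg r) ∧
      s'.reg 8 = siz w n ∧ (∀ a, a ≠ 1 → s'.arr a = s.arr a) ∧
      s'.arr 1 = digitArray q (numOf q (tabList w M n))) s := by
  have hD := hp.le_D
  have hq := hp.two_le
  set T := numOf q (tabList w M n) with hT
  refine Tri.time (Tri.set_seq (by decide) (fun _ => Nat.zero_le _) <|
    Tri.set_seq (by decide) (fun _ => Nat.zero_le _) <|
    Tri.post (Tri.forLoop (m := n) (T := 100 * (k + 1))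
      (fun c s' => (∀ r < 7, s'.reg r = s.reg r) ∧ s'.reg 7 = cnt w c ∧ s'.reg 8 = siz w c ∧
        (∀ a, a ≠ 1 → s'.arr a = s.arr a) ∧ (∀ p < siz w c, s'.arr 1 p = digitArray q T p) ∧
        ∀ p, siz w c ≤ p → s'.arr 1 p = 0)
      (by decide) (by omega) (fun j s' h => ?_) ?_ ?_) ?_) ?_
  · simp only [Expr.val, h.1 1 (by omega), hs.r1]
  · refine ⟨fun r hr => ?_, by simp [Expr.val, cnt], by simp [Expr.val, siz], fun a _ => rfl, ?_, ?_⟩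
    · simp [show r ≠ 7 by omega, show r ≠ 8 by omega, show r ≠ 10 by omega]
    · intro p hp; simp [siz] at hp
    · intro p _; simp [h1]
  · intro c s₁ hcn h10 _ ⟨i1, i2, i3, i4, i5, i6⟩
    have hk := hc.cnt_le_k hcn.le
    have hkn := hp.n_eq
    have hcell : ∀ t, s₁.arr 0 (t * n + c) = M t c := fun t => by
      rw [i4 0 (by omega), hA t c hcn]
    have hb : pivotExpr.val s₁ = M (cnt w c) c := by
      simp only [pivotExpr, Expr.val, i2, h10, i1 1 (by omega), hs.r1, hcell]
    have hiff := hc.entry_ne_zero_iff hcn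
    refine Tri.time (Tri.ite (T₁ := 4) (T₂ := 80 * k + 50) (by decide) (fun hb' => ?_)
      (fun hb' => ?_)) ?_
    · rw [hb, hiff] at hb'
      refine Tri.set (by decide) (fun _ => ?_) ?_
      · simp only [Expr.val, i2]; omega
      · refine ⟨by simp [h10], fun r hr => ?_, ?_, ?_, i4, ?_, ?_⟩
        · simp [show r ≠ 7 by omega, show r ≠ 10 by omega, i1 r hr]
        · simp [Expr.val, i2, cnt, hb']
        · simp [i3, siz, hb']
        · simpa [siz, hb'] using i5
        · simpa [siz, hb'] using i6
    · have hw : w c = false := by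
        rw [hb] at hb'
        cases hw : w c
        · rfl
        · exact absurd hb' (hiff.2 hw)
      have hsz : siz w (c + 1) = siz w c + cnt w c := by simp [siz, hw]
      have hN := hc.siz_le_N hp (show c + 1 ≤ n from hcn)
      refine Tri.time (Tri.seq (T₂ := 4) (Tri.forLoop (m := cnt w c) (T := 30)
        (fun t s' => (∀ r < 11, s'.reg r = s₁.reg r) ∧ (∀ a, a ≠ 1 → s'.arr a = s₁.arr a) ∧
          (∀ p < siz w c, s'.arr 1 p = digitArray q T p) ∧
          (∀ t' < t, s'.arr 1 (siz w c + cnt w c - 1 - t') =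
            digitArray q T (siz w c + cnt w c - 1 - t')) ∧
          ∀ p, siz w c + cnt w c ≤ p → s'.arr 1 p = 0)
        (by decide) (by omega) (fun j s' h => ?_) ?_ ?_) ?_)
        (show _ ≤ 80 * k + 50 from ?_)
      · simp only [Expr.val, h.1 7 (by omega), i2]
      · refine ⟨fun r hr => by simp; omega, fun a _ => rfl, i5, ?_, fun p hp => i6 p (by omega)⟩
        intro t ht; omega
      · intro t s₂ ht h11 hg ⟨j1, j2, j3, j4, j5⟩
        have hv : (Expr.cell 0 (.add (.mul (.reg 11) (.reg 1)) (.reg 10))).val s₂ =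
            digitArray q T (siz w c + cnt w c - 1 - t) := by
          rw [hT, digit_tabList hc.entry_lt hcn hw ht]
          simp only [Expr.val, h11, j1 1 (by omega), i1 1 (by omega), hs.r1, j1 10 (by omega), h10,
            j2 0 (by omega), hcell]
        have hi : (Expr.sub (.sub (.add (.reg 8) (.reg 7)) (.lit 1)) (.reg 11)).val s₂ =
            siz w c + cnt w c - 1 - t := by
          simp only [Expr.val, j1 8 (by omega), j1 7 (by omega), i2, i3, h11]
        refine Tri.time (Tri.store (by decide) (by decide) (fun _ => ?_) ?_) (by decide)
        · rw [hv]; exact digitArray_lt (by omega) _ _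
        · rw [hv, hi]
          refine ⟨by simp [h11], fun r hr => ?_, ?_, ?_, ?_, ?_⟩
          · simp [show r ≠ 11 by omega, j1 r hr]
          · intro a ha
            simp [State.setCell_arr_ne _ _ _ ha, j2 a ha]
          · intro p hp
            simp only [State.setReg_arr, State.setCell_arr_self]
            rw [if_neg (by omega), j3 p hp]
          · intro t' ht'
            simp only [State.setReg_arr, State.setCell_arr_self]
            split_ifs with he
            · rw [he]
            · exact j4 t' (by
                rcases Nat.lt_succ_iff_lt_or_eq.1 ht' with h | rfl
                · exact h
                · exact absurd rfl he)
          · intro p hp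
            simp only [State.setReg_arr, State.setCell_arr_self]
            rw [if_neg (by omega), j5 p hp]
      · intro s₂ ⟨_, j1, j2, j3, j4, j5⟩
        refine Tri.set (by decide) (fun _ => ?_) ?_
        · simp only [Expr.val, j1 8 (by omega), j1 7 (by omega), i2, i3]; omega
        · refine ⟨?_, fun r hr => ?_, ?_, ?_, ?_, ?_, ?_⟩
          · simp [j1 10, h10]
          · simp [show r ≠ 8 by omega, show r ≠ 10 by omega, j1 r (by omega), i1 r hr]
          · simp [cnt, hw, j1 7, i2]
          · simp [hsz, Expr.val, j1 8, j1 7, i2, i3]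
          · intro a ha
            simp [j2 a ha, i4 a ha]
          · intro p hp
            simp only [State.setReg_arr]
            by_cases h : p < siz w c
            · exact j3 p h
            · have := j4 (siz w c + cnt w c - 1 - p) (by omega)
              rwa [show siz w c + cnt w c - 1 - (siz w c + cnt w c - 1 - p) = p by omega] at this
          · intro p hp
            simp only [State.setReg_arr]
            exact j5 p (by omega)
      · simp only [Expr.cost]
        have := Nat.mul_le_mul_right 38 hk
        omega
    · simp [pivotExpr, Expr.cost]; omega
  · rintro s' - ⟨-, i1, i2, i3, i4, i5, i6⟩
    refine ⟨i1, i3, i4, ?_⟩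
    funext p
    by_cases hp : p < siz w n
    · exact i5 p hp
    · rw [i6 p (by omega), digitArray_eq_zero (by omega) hc.tab_lt (by omega)]
  · simp [Expr.cost]; nlinarith

/-- Select `boxPart k h i`, for `i` in register `21`. -/
def boxArgs : Prog :=
  .seq (.set 20 (addrExpr (.reg 2) (.reg 3) (.reg 21))) (.set 22 (.lit 1))

theorem boxArgs_spec {q n k h N L D i : ℕ} (hp : Params q n k h N L D) {s : State}
    (hs : Env q n k h N L s) (hF : Filled q k h N L ((k + 1) * (h + 1) * (N + 1)) (s.arr 2))
    (h21 : s.reg 21 = i) (hi : i ≤ N) :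
    Tri q D boxArgs 30 (fun s' => (∀ r < 20, s'.reg r = s.reg r) ∧ s'.arr = s.arr ∧
      s'.reg 21 = i ∧ Selects q L (boxPart k h i) s') s := by
  have hD := hp.le_D
  have ha := hp.addr_le le_rfl le_rfl hi
  have hv : (addrExpr (.reg 2) (.reg 3) (.reg 21)).val s = addr h N L k h i := by
    rw [addrExpr_val hs]
    simp only [Expr.val, hs.r2, hs.r3, h21]
  refine Tri.time (Tri.set_seq (by decide) (fun _ => ?_) <|
    Tri.set (by decide) (fun _ => ?_) ?_) (by simp [Expr.cost, addrExpr])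
  · rw [hv]; exact ha
  · simp only [Expr.val]; omega
  · rw [hv]
    refine ⟨fun r hr => ?_, rfl, by simp [h21], hp.part_lt _ _ _ hi, fun j hj => ?_⟩
    · simp [show r ≠ 20 by omega, show r ≠ 22 by omega]
    · simp only [State.setReg_reg, State.setReg_arr]
      simp only [Nat.reduceEqDiff, if_false, if_true, Expr.val, one_mul]
      exact hF k le_rfl h le_rfl i hi (slot_lt le_rfl le_rfl hi) j hj

/-- Select `topPart a (c + 1 - a) r`, for `a`, `r`, `c` in registers `7`, `8`, `12`, with the shift
from register `9`. -/
def topArgs : Prog :=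
  .seq (.set 20 (addrExpr (.reg 7) (.sub (.reg 12) (.reg 7)) (.sub (.reg 8) (.reg 7)))) <|
  .seq (.set 21 (.reg 9))
    (.set 22 (.mul (.lt (.reg 7) (.add (.reg 12) (.lit 1)))
      (.sub (.lit 1) (.lt (.reg 8) (.reg 7)))))

/-- `topPart` needs no table of its own: removing the largest part leads to `boxPart a (c - a) (r -
a)`, and the flag covers the cases in which it is 0. -/
theorem topArgs_spec {q n k h N L D a c r m : ℕ} (hp : Params q n k h N L D) {s : State}
    (hs : Env q n k h N L s) (hF : Filled q k h N L ((k + 1) * (h + 1) * (N + 1)) (s.arr 2))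
    (h7 : s.reg 7 = a) (h8 : s.reg 8 = r) (h9 : s.reg 9 = m) (h12 : s.reg 12 = c)
    (ha : a ≤ k) (hc : c - a ≤ h) (hr : r ≤ N) :
    Tri q D topArgs 50 (fun s' => (∀ r < 20, s'.reg r = s.reg r) ∧ s'.arr = s.arr ∧
      s'.reg 21 = m ∧ Selects q L (topPart a (c + 1 - a) r) s') s := by
  have hD := hp.le_D
  have hq := hp.two_le
  have had := hp.addr_le ha hc (show r - a ≤ N by omega)
  have hv : (addrExpr (.reg 7) (.sub (.reg 12) (.reg 7)) (.sub (.reg 8) (.reg 7))).val s =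
      addr h N L a (c - a) (r - a) := by
    rw [addrExpr_val hs]
    simp only [Expr.val, h7, h8, h12]
  refine Tri.time (Tri.set_seq (by decide) (fun _ => ?_) <|
    Tri.set_seq (by decide) (fun hg => ?_) <|
    Tri.set (by decide) (fun _ => ?_) ?_) (by simp [Expr.cost, addrExpr])
  · rw [hv]; exact had
  · exact hg.reg_le 9
  · exact (Nat.mul_le_mul (Expr.val_lt_le_one _ _ _) (Nat.sub_le 1 _)).trans (by omega)
  · rw [hv]
    refine ⟨fun r hr => ?_, rfl, by simp [Expr.val, h9], ?_, fun j hj => ?_⟩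
    · simp [show r ≠ 20 by omega, show r ≠ 21 by omega, show r ≠ 22 by omega]
    · unfold topPart
      split
      · positivity
      · exact hp.part_lt _ _ _ (by omega)
    · simp only [State.setReg_reg, State.setReg_arr]
      simp only [Nat.reduceEqDiff, if_false, if_true, Expr.val, State.setReg_reg, h7, h8, h12]
      rw [hF a ha (c - a) hc (r - a) (by omega) (slot_lt ha hc (by omega)) j hj, topPart]
      by_cases h1 : a < c + 1
      · by_cases h2 : r < a
        · simp [h2]
        · rw [if_neg (show ¬ (c + 1 - a = 0 ∨ r < a) by omega), show c + 1 - a - 1 = c - a by omega]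
          simp [h1, h2]
      · rw [if_pos (show c + 1 - a = 0 ∨ r < a by omega)]
        simp [h1]

/-- Add the numbers of subspaces with more dots. -/
def tailProg : Prog :=
  .seq (.set 9 (.reg 8)) <|
  .forLoop 10 (.sub (.reg 4) (.reg 9)) <|
    .seq (.set 21 (.add (.add (.reg 9) (.lit 1)) (.reg 10))) <| .seq boxArgs addProg

/-- At most N additions of numbers with L + N + 1 digits, hence O(N²). The partial sums stay below
the final one, so no addition overflows. -/
theorem tailProg_spec {q n k h N L D m z : ℕ} (hp : Params q n k h N L D) {s : State}
    (hs : Env q n k h N L s) (hF : Filled q k h N L ((k + 1) * (h + 1) * (N + 1)) (s.arr 2))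
    (h8 : s.reg 8 = m) (hm : m ≤ N) (hz : s.arr 1 = digitArray q z)
    (hlt : z + tailCount q k h N (m + 1) < q ^ (L + N + 1)) :
    Tri q D tailProg (300 * ((N + 1) * (L + N + 2))) (fun s' => (∀ r < 7, s'.reg r = s.reg r) ∧
      s'.reg 9 = m ∧ (∀ a, a ≠ 1 → s'.arr a = s.arr a) ∧
      s'.arr 1 = digitArray q (z + tailCount q k h N (m + 1))) s := by
  have hD := hp.le_D
  refine Tri.time (Tri.set_seq (by decide) (fun hg => hg.reg_le 8) <|
    Tri.post (Tri.forLoop (m := N - m) (T := 150 * (L + N + 2))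
      (fun j s' => (∀ r < 7, s'.reg r = s.reg r) ∧ s'.reg 9 = m ∧
        (∀ a, a ≠ 1 → s'.arr a = s.arr a) ∧ s'.arr 1 = digitArray q
          (z + ∑ i ∈ Finset.Ico (m + 1) (m + 1 + j), boxPart k h i * q ^ i))
      (by decide) (by omega) (fun j s' h => ?_) ?_ ?_) ?_) ?_
  · simp only [Expr.val, h.1 4 (by omega), h.2.1, hs.r4]
  · refine ⟨fun r hr => ?_, by simp [Expr.val, h8], fun a _ => rfl, by simp [hz]⟩
    simp [show r ≠ 9 by omega, show r ≠ 10 by omega]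
  · intro j s₁ hj h10 _ ⟨i1, i2, i3, i4⟩
    have he : (Expr.add (.add (.reg 9) (.lit 1)) (.reg 10)).val s₁ = m + 1 + j := by
      simp only [Expr.val, i2, h10]
    have hs₁ := hs.congr i1
    refine Tri.time (Tri.set_seq (by decide) (fun _ => ?_) <|
      Tri.seq (T₂ := 100 * (L + N + 2)) (boxArgs_spec (i := m + 1 + j) hp
        (hs₁.setReg (by omega)) ?_ ?_ (by omega)) ?_) ?_
    · rw [he]; omega
    · rw [State.setReg_arr, i3 2 (by omega)]; exact hF
    · rw [he]; simp
    · rintro s₂ ⟨j1, j2, j3, j4⟩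
      have hsum : ∑ i ∈ Finset.Ico (m + 1) (m + 1 + (j + 1)), boxPart k h i * q ^ i =
          ∑ i ∈ Finset.Ico (m + 1) (m + 1 + j), boxPart k h i * q ^ i +
            boxPart k h (m + 1 + j) * q ^ (m + 1 + j) := by
        rw [← add_assoc, Finset.sum_Ico_succ_top (by omega)]
      have hle : ∑ i ∈ Finset.Ico (m + 1) (m + 1 + (j + 1)), boxPart k h i * q ^ i ≤
          tailCount q k h N (m + 1) :=
        Finset.sum_le_sum_of_subset (Finset.Ico_subset_Ico_right (by omega))
      have hreg : ∀ r < 20, s₂.reg r = s₁.reg r := fun r hr => by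
        rw [j1 r hr, State.setReg_reg, if_neg (by omega)]
      refine Tri.post (addProg_spec hp (hs₁.congr fun r hr => hreg r (by omega)) j3 j4
        (by rw [j2, State.setReg_arr, i4]) (by omega)) ?_
      rintro s₃ - ⟨k1, k2, k3⟩
      refine ⟨?_, fun r hr => ?_, ?_, fun a ha => ?_, ?_⟩
      · rw [k1 10 (by omega), hreg 10 (by omega), h10]
      · rw [State.setReg_reg, if_neg (by omega), k1 r (by omega), hreg r (by omega), i1 r hr]
      · rw [State.setReg_reg, if_neg (by omega), k1 9 (by omega), hreg 9 (by omega), i2]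
      · rw [State.setReg_arr, k2 a ha, j2, State.setReg_arr, i3 a ha]
      · rw [State.setReg_arr, k3, hsum, add_assoc]
    · simp [Expr.cost]; omega
  · rintro s' - ⟨-, i1, i2, i3, i4⟩
    refine ⟨i1, i2, i3, ?_⟩
    rw [i4, tailCount, show m + 1 + (N - m) = N + 1 by omega]
  · simp only [Expr.cost]
    have : (N - m) * (150 * (L + N + 2) + (1 + 1 + 1) + 7) ≤ N * (150 * (L + N + 2) + 10) :=
      Nat.mul_le_mul (by omega) (by omega)
    nlinarith

/-- Add the rank of the Ferrers diagram. -/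
def pathProg : Prog :=
  .seq (.set 7 (.lit 0)) <| .seq (.set 8 (.lit 0)) <|
  .forLoop 10 (.reg 1) <|
    .ite pivotExpr
      (.seq (.set 7 (.add (.reg 7) (.lit 1))) <| .seq (.set 12 (.reg 10)) <|
        .seq topArgs addProg)
      (.set 8 (.add (.reg 8) (.reg 7)))

/-- The ranks are accumulated directly in units of q^m, above the tableau. The increment is selected
after register `7` has been raised, so it counts the new pivot, while the size in register `8` is
unchanged in a pivot column. -/
theorem pathProg_spec {q n k h N L D m z : ℕ} {w : ℕ → Bool} {M : ℕ → ℕ → ℕ}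
    (hp : Params q n k h N L D) (hc : Coded q n k h N L w M) {s : State}
    (hs : Env q n k h N L s) (hF : Filled q k h N L ((k + 1) * (h + 1) * (N + 1)) (s.arr 2))
    (hA : ∀ t, ∀ c < n, s.arr 0 (t * n + c) = M t c)
    (h9 : s.reg 9 = m) (hz : s.arr 1 = digitArray q z)
    (hlt : z + pathIdx w n * q ^ m < q ^ (L + N + 1)) :
    Tri q D pathProg (300 * ((n + 1) * (L + N + 2))) (fun s' =>
      s'.arr 1 = digitArray q (z + pathIdx w n * q ^ m)) s := by
  have hD := hp.le_D
  refine Tri.time (Tri.set_seq (by decide) (fun _ => Nat.zero_le _) <|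
    Tri.set_seq (by decide) (fun _ => Nat.zero_le _) <|
    Tri.post (Tri.forLoop (m := n) (T := 200 * (L + N + 2))
      (fun c s' => (∀ r < 7, s'.reg r = s.reg r) ∧ s'.reg 7 = cnt w c ∧ s'.reg 8 = siz w c ∧
        s'.reg 9 = m ∧ (∀ a, a ≠ 1 → s'.arr a = s.arr a) ∧
        s'.arr 1 = digitArray q (z + pathIdx w c * q ^ m))
      (by decide) (by omega) (fun j s' h => ?_) ?_ ?_) ?_) ?_
  · simp only [Expr.val, h.1 1 (by omega), hs.r1]
  · refine ⟨fun r hr => ?_, by simp [Expr.val, cnt], by simp [Expr.val, siz], by simp [h9],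
      fun a _ => rfl, by simp [hz, pathIdx]⟩
    simp [show r ≠ 7 by omega, show r ≠ 8 by omega, show r ≠ 10 by omega]
  · intro c s₁ hcn h10 _ ⟨i1, i2, i3, i4, i5, i6⟩
    have hs₁ := hs.congr i1
    have hk := hc.cnt_le_k hcn.le
    have hkn := hp.n_eq
    have hb : pivotExpr.val s₁ = M (cnt w c) c := by
      simp only [pivotExpr, Expr.val, i2, h10, i1 1 (by omega), hs.r1, i5 0 (by omega),
        hA _ c hcn]
    have hiff := hc.entry_ne_zero_iff hcn
    have hN1 := hc.siz_le_N hp (show c + 1 ≤ n from hcn)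
    have hN0 := hc.siz_le_N hp hcn.le
    refine Tri.time (Tri.ite (T₁ := 100 * (L + N + 2) + 60) (T₂ := 4) (by decide) (fun hb' => ?_)
      (fun hb' => ?_)) ?_
    · rw [hb, hiff] at hb'
      have hk1 : cnt w c + 1 ≤ k := by
        have := hc.cnt_le_k (show c + 1 ≤ n from hcn)
        simpa [cnt, hb'] using this
      have hch := hc.sub_cnt_le hp hcn.le
      have e7 : (Expr.add (.reg 7) (.lit 1)).val s₁ = cnt w c + 1 := by simp only [Expr.val, i2]
      refine Tri.time (Tri.set_seq (by decide) (fun _ => ?_) <|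
        Tri.set_seq (by decide) (fun hg => hg.reg_le 10) <|
        Tri.seq (T₂ := 100 * (L + N + 2)) (topArgs_spec (a := cnt w c + 1) (c := c) (r := siz w c)
          (m := m) hp ((hs₁.setReg (by omega)).setReg (by omega)) ?_ ?_ ?_ ?_ ?_ hk1 (by omega)
          hN0) ?_) ?_
      · rw [e7]; omega
      · rw [State.setReg_arr, State.setReg_arr, i5 2 (by omega)]; exact hF
      · rw [e7]; simp
      · simp [i3]
      · simp [i4]
      · simp [Expr.val, h10]
      · rintro s₂ ⟨j1, j2, j3, j4⟩
        have hstep : pathIdx w (c + 1) =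
            pathIdx w c + topPart (cnt w c + 1) (c + 1 - (cnt w c + 1)) (siz w c) := by
          simp [pathIdx, hb']
        have hle : pathIdx w (c + 1) * q ^ m ≤ pathIdx w n * q ^ m :=
          Nat.mul_le_mul_right _ (pathIdx_mono w hcn)
        rw [hstep, add_mul] at hle
        refine Tri.post (addProg_spec hp (hs₁.congr fun r hr => ?_) j3 j4
          (by rw [j2, State.setReg_arr, State.setReg_arr, i6]) (by omega)) ?_
        · rw [j1 r (by omega)]
          simp [show r ≠ 7 by omega, show r ≠ 12 by omega]
        rintro s₃ - ⟨k1, k2, k3⟩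
        refine ⟨?_, fun r hr => ?_, ?_, ?_, ?_, fun a ha => ?_, ?_⟩
        · rw [k1 10 (by omega), j1 10 (by omega)]
          simp [h10]
        · rw [State.setReg_reg, if_neg (by omega), k1 r (by omega), j1 r (by omega)]
          simp [show r ≠ 7 by omega, show r ≠ 12 by omega, i1 r hr]
        · rw [State.setReg_reg, if_neg (by omega), k1 7 (by omega), j1 7 (by omega), e7]
          simp [cnt, hb']
        · rw [State.setReg_reg, if_neg (by omega), k1 8 (by omega), j1 8 (by omega)]
          simp [siz, hb', i3]
        · rw [State.setReg_reg, if_neg (by omega), k1 9 (by omega), j1 9 (by omega)]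
          simp [i4]
        · rw [State.setReg_arr, k2 a ha, j2, State.setReg_arr, State.setReg_arr, i5 a ha]
        · rw [State.setReg_arr, k3, hstep, add_mul, add_assoc]
      · simp [Expr.cost]; omega
    · have hw : w c = false := by
        rw [hb] at hb'
        cases hw : w c
        · rfl
        · exact absurd hb' (hiff.2 hw)
      have hsz : siz w (c + 1) = siz w c + cnt w c := by simp [siz, hw]
      refine Tri.set (by decide) (fun _ => ?_) ?_
      · simp only [Expr.val, i2, i3]; omega
      · refine ⟨by simp [h10], fun r hr => ?_, ?_, ?_, by simp [i4], i5, ?_⟩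
        · simp [show r ≠ 8 by omega, show r ≠ 10 by omega, i1 r hr]
        · simp [i2, cnt, hw]
        · simp [Expr.val, i3, i2, hsz]
        · simp [pathIdx, hw, i6]
    · simp [pivotExpr, Expr.cost]; omega
  · rintro s' - ⟨-, -, -, -, -, -, i6⟩
    exact i6
  · simp only [Expr.cost]
    nlinarith

/-- The encoding program. -/
def encProg : Prog :=
  .seq setupProg <| .seq tableProg <| .seq tableauProg <| .seq tailProg pathProg

theorem encProg_spec {q n k h N L D : ℕ} {w : ℕ → Bool} {M : ℕ → ℕ → ℕ}
    (hp : Params q n k h N L D) (hc : Coded q n k h N L w M)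
    (hL : L = 5 * (Nat.sqrt N + 1)) {s : State} (h0 : s.reg 0 = q) (h1 : s.reg 1 = n)
    (h2 : s.reg 2 = k) (hA : ∀ t, ∀ c < n, s.arr 0 (t * n + c) = M t c)
    (hz : ∀ i, s.arr 1 i = 0) :
    Tri q D encProg (100 * (N + 1) + 1000 * ((k + 1) * (h + 1) * (N + 1) * (L + 1)) +
        200 * (n * (k + 1) + 1) + 300 * ((N + 1) * (L + N + 2)) + 300 * ((n + 1) * (L + N + 2)))
      (fun s' => s'.arr 1 = digitArray q (tailCount q k h N (siz w n + 1) +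
        (q ^ siz w n * pathIdx w n + numOf q (tabList w M n)))) s := by
  have hlt := hc.idx_lt
  rw [mul_comm (q ^ siz w n)] at hlt ⊢
  refine Tri.time (Tri.seq (setupProg_spec hp hL h0 h1 h2) fun s₁ ⟨i1, i2⟩ =>
    Tri.seq (tableProg_spec hp i1) fun s₂ ⟨j1, j2, j3⟩ =>
    have hs₂ := i1.congr fun r hr => j1 r (by omega)
    Tri.seq (tableauProg_spec hp hc hs₂
      (fun t c h => by rw [j2 0 (by omega), i2, hA t c h])
      (fun i => by rw [j2 1 (by omega), i2, hz i])) fun s₃ ⟨k1, k2, k3, k4⟩ =>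
    have hs₃ := hs₂.congr k1
    Tri.seq (tailProg_spec hp hs₃ (by rw [k3 2 (by omega)]; exact j3) k2
      (hc.siz_le_N hp le_rfl) k4 (by omega)) fun s₄ ⟨l1, l2, l3, l4⟩ =>
    Tri.post (pathProg_spec hp hc (hs₃.congr l1)
      (by rw [l3 2 (by omega), k3 2 (by omega)]; exact j3)
      (fun t c h => by rw [l3 0 (by omega), k3 0 (by omega), j2 0 (by omega), i2, hA t c h])
      l2 l4 (by omega)) ?_) ?_
  · intro s' _ hs'
    rw [hs']
    congr 1
    omega
  · omega

end Encoder

/-! ### The decoding program -/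

section Decoder

theorem Selects.congr {q L y : ℕ} {s s' : State} (h : Selects q L y s)
    (h20 : s'.reg 20 = s.reg 20) (h22 : s'.reg 22 = s.reg 22) (h2 : s'.arr 2 = s.arr 2) :
    Selects q L y s' :=
  ⟨h.1, fun j hj => by rw [h20, h22, h2, h.2 j hj]⟩

/-- Find the number of dots (in register `9`) and subtract the numbers of subspaces with more
dots. -/
def sizeProg : Prog :=
  .seq (.set 9 (.reg 4)) <|
  .forLoop 10 (.reg 4) <|
    .seq (.set 21 (.reg 9)) <| .seq boxArgs <| .seq (subProg 5) <|
      .ite (.reg 30) .skip (.seq (subProg 0) (.set 9 (.sub (.reg 9) (.lit 1))))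

theorem sizeProg_spec {q n k h N L D m R : ℕ} (hp : Params q n k h N L D) {s : State}
    (hs : Env q n k h N L s) (hF : Filled q k h N L ((k + 1) * (h + 1) * (N + 1)) (s.arr 2))
    (hm : m ≤ N) (hR : R < boxPart k h m * q ^ m)
    (hz : s.arr 0 = digitArray q (tailCount q k h N (m + 1) + R))
    (hlt : tailCount q k h N (m + 1) + R < q ^ (L + N + 1)) :
    Tri q D sizeProg (500 * ((N + 1) * (L + N + 2))) (fun s' => (∀ r < 7, s'.reg r = s.reg r) ∧
      s'.reg 9 = m ∧ s'.arr 1 = s.arr 1 ∧ s'.arr 2 = s.arr 2 ∧ s'.arr 0 = digitArray q R) s := by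
  have hD := hp.le_D
  have hq := hp.two_le
  refine Tri.time (Tri.set_seq (by decide) (fun hg => hg.reg_le 4) <|
    Tri.post (Tri.forLoop (m := N) (T := 300 * (L + N + 2))
      -- The candidate size descends from N while the subtraction is possible and then stays at m.
      -- The number left plus the tail already removed is the input.
      (fun j s' => (∀ r < 7, s'.reg r = s.reg r) ∧ s'.reg 9 = max m (N - j) ∧
        s'.arr 1 = s.arr 1 ∧ s'.arr 2 = s.arr 2 ∧ ∃ z, s'.arr 0 = digitArray q z ∧
          z + tailCount q k h N (max m (N - j) + 1) = tailCount q k h N (m + 1) + R)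
      (by decide) (by omega) (fun j s' h => ?_) ?_ ?_) ?_) ?_
  · simp only [Expr.val, h.1 4 (by omega), hs.r4]
  · refine ⟨fun r hr => ?_, ?_, rfl, rfl, tailCount q k h N (m + 1) + R, hz, ?_⟩
    · simp [show r ≠ 9 by omega, show r ≠ 10 by omega]
    · simp [Expr.val, hs.r4, hm]
    · simp [hm, tailCount]
  · intro j s₁ hj h10 _ ⟨i1, i2, i3, i4, z, i5, i6⟩
    have hs₁ := hs.congr i1
    generalize hμ : max m (N - j) = μ at *
    have hμN : μ ≤ N := by omega
    have htail := tailCount_eq q k h hμN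
    have hyt : boxPart k h μ * q ^ μ < q ^ (L + N + 1) :=
      lt_of_le_of_lt (by
        have := tailCount_anti q k h N (Nat.zero_le μ)
        omega) (tailCount_lt hq fun i hi => hp.part_lt k h i hi)
    refine Tri.time (Tri.set_seq (by decide) (fun hg => hg.reg_le 9) <|
      Tri.seq (T₂ := 200 * (L + N + 2) + 50) (boxArgs_spec (i := μ) hp
        (hs₁.setReg (by omega)) ?_ ?_ hμN) ?_) ?_
    · rw [State.setReg_arr, i4]; exact hF
    · simp [Expr.val, i2]
    · rintro s₂ ⟨j1, j2, j3, j4⟩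
      have r2 : ∀ r < 20, s₂.reg r = s₁.reg r := fun r hr => by
        rw [j1 r hr, State.setReg_reg, if_neg (by omega)]
      have hs₂ := hs₁.congr fun r hr => r2 r (by omega)
      have a2 : s₂.arr = s₁.arr := by rw [j2, State.setReg_arr]
      refine Tri.time (Tri.seq (T₂ := 100 * (L + N + 2) + 20) (subProg_spec (a := 5) hp hs₂ j3 j4
        (by omega) (by rw [a2, i5]) (by omega) hyt) ?_) (show _ ≤ 200 * (L + N + 2) + 50 by omega)
      rintro s₃ ⟨k1, k2, k3, -⟩
      have hs₃ := hs₂.congr fun r hr => k1 r (by omega)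
      have r3 : ∀ r < 20, s₃.reg r = s₁.reg r := fun r hr => by rw [k1 r (by omega), r2 r hr]
      have a3 : ∀ a, a ≠ 5 → s₃.arr a = s₁.arr a := fun a ha => by rw [k2 a ha, a2]
      refine Tri.time (Tri.ite (T₁ := 1) (T₂ := 100 * (L + N + 2) + 4) (by decide) (fun hb => ?_)
        (fun hb => ?_)) (by simp [Expr.cost]; omega)
      · refine Tri.skip ?_
        have hgt : ¬ boxPart k h μ * q ^ μ ≤ z := fun hle => hb (k3.2 hle)
        -- For a candidate above m the tail still contained in the number includes the whole term of
        -- that candidate, so the comparison can fail only at m.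
        have hμm : μ = m := by
          by_contra hne
          have := tailCount_anti q k h N (show m + 1 ≤ μ by omega)
          omega
        have hμ' : max m (N - (j + 1)) = μ := by omega
        refine ⟨by rw [r3 10 (by omega), h10], fun r hr => ?_, ?_, ?_, ?_, z, ?_, ?_⟩
        · rw [State.setReg_reg, if_neg (by omega), r3 r (by omega), i1 r hr]
        · rw [State.setReg_reg, if_neg (by omega), r3 9 (by omega), i2, hμ']
        · rw [State.setReg_arr, a3 1 (by omega), i3]
        · rw [State.setReg_arr, a3 2 (by omega), i4]
        · rw [State.setReg_arr, a3 0 (by omega), i5]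
        · rw [hμ', i6]
      · have hle : boxPart k h μ * q ^ μ ≤ z := k3.1 hb
        have hμm : m < μ := by
          by_contra hne
          -- At m itself what is left is `R`, which is below the term by `hR`.
          obtain rfl : μ = m := by omega
          omega
        have hμ' : max m (N - (j + 1)) = μ - 1 := by omega
        have hμ'' : μ - 1 + 1 = μ := by omega
        refine Tri.time (Tri.seq (T₂ := 4) (subProg_spec (a := 0) hp hs₃ (by rw [k1 21 (by omega), j3])
          (j4.congr (k1 20 (by omega)) (k1 22 (by omega)) (k2 2 (by omega))) (by omega)
          (by rw [a3 0 (by omega), i5]) (by omega) hyt) ?_) le_rfl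
        rintro s₄ ⟨l1, l2, -, l4⟩
        have r4 : ∀ r < 20, s₄.reg r = s₁.reg r := fun r hr => by rw [l1 r (by omega), r3 r hr]
        refine Tri.set (by decide) (fun hg => ?_) ?_
        · have := hg.reg_le 9
          simp only [Expr.val]; omega
        · refine ⟨by simp [r4 10, h10], fun r hr => ?_, ?_, ?_, ?_,
            z - boxPart k h μ * q ^ μ, ?_, ?_⟩
          · rw [State.setReg_reg, if_neg (by omega), State.setReg_reg, if_neg (by omega),
              r4 r (by omega), i1 r hr]
          · simp [Expr.val, r4 9, i2, hμ']
          · simp only [State.setReg_arr]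
            rw [l2 1 (by omega), a3 1 (by omega), i3]
          · simp only [State.setReg_arr]
            rw [l2 2 (by omega), a3 2 (by omega), i4]
          · simp only [State.setReg_arr]
            exact l4 rfl hle
          · rw [hμ', hμ'']
            omega
    · simp [Expr.cost]; omega
  · rintro s' - ⟨-, i1, i2, i3, i4, z, i5, i6⟩
    rw [Nat.sub_self, max_eq_left (Nat.zero_le _)] at i2 i6
    refine ⟨i1, i2, i3, i4, ?_⟩
    rw [i5]
    congr 1
    omega
  · simp only [Expr.cost]
    nlinarith

/-- Write a non-pivot column: the number of its dots is in register `7`, and register `8` is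
diminished by it. -/
def columnProg : Prog :=
  .seq (.set 8 (.sub (.reg 8) (.reg 7))) <|
    .forLoop 11 (.reg 7)
      (.store 1 (.add (.mul (.reg 11) (.reg 1)) (.reg 12))
        (.cell 0 (.sub (.sub (.add (.reg 8) (.reg 7)) (.lit 1)) (.reg 11))))

theorem mul_add_inj {n t t' x x' : ℕ} (hx : x < n) (hx' : x' < n)
    (h : t * n + x = t' * n + x') : t = t' ∧ x = x' := by
  have h1 : t = t' := by
    have := congrArg (· / n) h
    simpa [mul_comm _ n, Nat.mul_add_div (show n > 0 by omega), Nat.div_eq_of_lt hx,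
      Nat.div_eq_of_lt hx'] using this
  subst h1
  exact ⟨rfl, by omega⟩

theorem columnProg_spec {q n k h N L D c a r : ℕ} (hp : Params q n k h N L D) {s : State}
    (hs : Env q n k h N L s) (ha : a ≤ k) (hcn : c < n) (h7 : s.reg 7 = a)
    (h8 : s.reg 8 = r + a) (h12 : s.reg 12 = c) :
    Tri q D columnProg (100 * (k + 1)) (fun s' => (∀ r < 8, s'.reg r = s.reg r) ∧
      s'.reg 8 = r ∧ s'.reg 9 = s.reg 9 ∧ s'.reg 10 = s.reg 10 ∧
      (∀ a', a' ≠ 1 → s'.arr a' = s.arr a') ∧ ∀ t, ∀ x < n, s'.arr 1 (t * n + x) =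
        if x = c ∧ t < a then s.arr 0 (r + a - 1 - t) else s.arr 1 (t * n + x)) s := by
  have hD := hp.le_D
  have hkn := hp.n_eq
  refine Tri.time (Tri.set_seq (by decide) (fun hg => ?_) <|
    Tri.post (Tri.forLoop (m := a) (T := 30)
      (fun j s' => (∀ r < 8, s'.reg r = s.reg r) ∧
        s'.reg 8 = r ∧ s'.reg 9 = s.reg 9 ∧ s'.reg 10 = s.reg 10 ∧ s'.reg 12 = c ∧
        (∀ a', a' ≠ 1 → s'.arr a' = s.arr a') ∧ ∀ t, ∀ x < n, s'.arr 1 (t * n + x) =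
          if x = c ∧ t < j then s.arr 0 (r + a - 1 - t) else s.arr 1 (t * n + x))
      (by decide) (by omega) (fun j s' h => ?_) ?_ ?_) ?_) ?_
  · have := hg.reg_le 8
    simp only [Expr.val]; omega
  · simp only [Expr.val, h.1 7 (by omega), h7]
  · refine ⟨fun r hr => ?_, ?_, by simp, by simp, by simp [h12], fun a _ => rfl, ?_⟩
    · simp [show r ≠ 8 by omega, show r ≠ 11 by omega]
    · simp [Expr.val, h7, h8]
    · intro t x hx
      simp
  · intro j s₁ hj h11 hg ⟨i1, i2, i3, i4, i5, i6, i7⟩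
    have hv : (Expr.cell 0 (.sub (.sub (.add (.reg 8) (.reg 7)) (.lit 1)) (.reg 11))).val s₁ =
        s.arr 0 (r + a - 1 - j) := by
      simp only [Expr.val, i2, i1 7 (by omega), h7, h11, i6 0 (by omega)]
    have hi : (Expr.add (.mul (.reg 11) (.reg 1)) (.reg 12)).val s₁ = j * n + c := by
      simp only [Expr.val, i1 1 (by omega), hs.r1, h11, i5]
    refine Tri.time (Tri.store (by decide) (by decide) (fun hg => ?_) ?_) (by decide)
    · exact hg.arr_lt _ _
    · rw [hv, hi]
      refine ⟨by simp [h11], fun r hr => ?_, by simp [i2], by simp [i3], by simp [i4],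
        by simp [i5], fun a' ha' => ?_, ?_⟩
      · simp [show r ≠ 11 by omega, i1 r hr]
      · simp [State.setCell_arr_ne _ _ _ ha', i6 a' ha']
      · intro t x hx
        simp only [State.setReg_arr, State.setCell_arr_self]
        by_cases he : t * n + x = j * n + c
        · obtain ⟨rfl, rfl⟩ := mul_add_inj hx hcn he
          simp
        · rw [if_neg he, i7 t x hx]
          have : (x = c ∧ t < j + 1) ↔ (x = c ∧ t < j) := by
            constructor
            · rintro ⟨rfl, h⟩
              refine ⟨rfl, lt_of_le_of_ne (Nat.lt_succ_iff.1 h) ?_⟩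
              rintro rfl
              exact he rfl
            · rintro ⟨h1, h2⟩
              exact ⟨h1, by omega⟩
          simp only [this]
  · rintro s' - ⟨-, i1, i2, i3, i4, -, i6, i7⟩
    exact ⟨i1, i2, i3, i4, i6, i7⟩
  · simp only [Expr.cost]
    have := Nat.mul_le_mul_right 38 ha
    omega

/-- Reconstruct the columns, from right to left. -/
def columnsProg : Prog :=
  .seq (.set 7 (.reg 2)) <| .seq (.set 8 (.reg 9)) <|
  .forLoop 10 (.reg 1) <|
    .seq (.set 12 (.sub (.sub (.reg 1) (.lit 1)) (.reg 10))) <| .seq topArgs <|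
      .seq (subProg 5) <|
      .ite (.reg 30) columnProg <|
        .seq (subProg 0) <| .seq (.set 7 (.sub (.reg 7) (.lit 1)))
          (.store 1 (.add (.mul (.reg 7) (.reg 1)) (.reg 12)) (.lit 1))

/-- The tableau occupies only the lowest m digits, so comparing the whole number with a multiple of
q^m compares the ranks. -/
theorem mul_pow_le_iff {q m y u T : ℕ} (hT : T < q ^ m) :
    y * q ^ m ≤ q ^ m * u + T ↔ y ≤ u := by
  constructor
  · intro h
    by_contra hlt
    have := Nat.mul_le_mul_right (q ^ m) (show u + 1 ≤ y by omega)
    rw [add_mul, mul_comm u] at this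
    omega
  · intro h
    have := Nat.mul_le_mul_right (q ^ m) h
    rw [mul_comm u] at this
    omega

/-- The path is undone from its end. Only multiples of q^m are subtracted, so the tableau stays in
the low digits and the entries of a non-pivot column can be copied from there. Entries that are 0
need not be written, since the output array starts with zeros. -/
theorem columnsProg_spec {q n k h N L D T : ℕ} {w : ℕ → Bool} {M : ℕ → ℕ → ℕ}
    (hp : Params q n k h N L D) (hc : Coded q n k h N L w M) {s : State}
    (hs : Env q n k h N L s) (hF : Filled q k h N L ((k + 1) * (h + 1) * (N + 1)) (s.arr 2))
    (hT : T = numOf q (tabList w M n)) (h9 : s.reg 9 = siz w n)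
    (hz : s.arr 0 = digitArray q (q ^ siz w n * pathIdx w n + T)) (h1 : ∀ i, s.arr 1 i = 0) :
    Tri q D columnsProg (500 * ((n + 1) * (L + N + k + 3))) (fun s' =>
      ∀ t, ∀ x < n, s'.arr 1 (t * n + x) = M t x) s := by
  have hD := hp.le_D
  have hq := hp.two_le
  have hkn := hp.n_eq
  have hTlt : T < q ^ siz w n := hT ▸ hc.tab_lt
  have hidx := hc.idx_lt
  rw [← hT] at hidx
  refine Tri.time (Tri.set_seq (by decide) (fun hg => hg.reg_le 2) <|
    Tri.set_seq (by decide) (fun hg => hg.reg_le 9) <|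
    Tri.post (Tri.forLoop (m := n) (T := 400 * (L + N + k + 3))
      (fun j s' => (∀ r < 7, s'.reg r = s.reg r) ∧ s'.reg 7 = cnt w (n - j) ∧
        s'.reg 8 = siz w (n - j) ∧ s'.reg 9 = siz w n ∧ s'.arr 2 = s.arr 2 ∧
        s'.arr 0 = digitArray q (q ^ siz w n * pathIdx w (n - j) + T) ∧
        ∀ t, ∀ x < n, s'.arr 1 (t * n + x) = if n - j ≤ x then M t x else 0)
      (by decide) (by omega) (fun j s' h => ?_) ?_ ?_) ?_) ?_
  · simp only [Expr.val, h.1 1 (by omega), hs.r1]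
  · refine ⟨fun r hr => ?_, ?_, ?_, by simp [h9], rfl, hz, ?_⟩
    · simp [show r ≠ 7 by omega, show r ≠ 8 by omega, show r ≠ 10 by omega]
    · simp [Expr.val, hs.r2, hc.cnt_eq]
    · simp [Expr.val, h9]
    · intro t x hx
      rw [if_neg (by omega)]
      simp [h1]
  · intro j s₁ hj h10 _ ⟨i1, i2, i3, i4, i5, i6, i7⟩
    have hs₁ := hs.congr i1
    obtain ⟨c, hcj⟩ : ∃ c, n - j = c + 1 := ⟨n - j - 1, by omega⟩
    have hcn : c < n := by omega
    have hcj' : n - (j + 1) = c := by omega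
    rw [hcj] at i2 i3 i6 i7
    have hk1 := hc.cnt_le_k (show c + 1 ≤ n from hcn)
    have hk0 := hc.cnt_le_k hcn.le
    have hh1 := hc.sub_cnt_le hp (show c + 1 ≤ n from hcn)
    have hN1 := hc.siz_le_N hp (show c + 1 ≤ n from hcn)
    have hcl := cnt_le w c
    -- The decision rule: a pivot column has added `topPart` to the rank, whereas for a non-pivot
    -- column the rank is still below it.
    have hy : (w c = true → topPart (cnt w (c + 1)) (c + 1 - cnt w (c + 1)) (siz w (c + 1)) +
        pathIdx w c = pathIdx w (c + 1)) ∧ (w c = false → pathIdx w (c + 1) <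
        topPart (cnt w (c + 1)) (c + 1 - cnt w (c + 1)) (siz w (c + 1))) := by
      constructor
      · intro hw
        simp [cnt, siz, pathIdx, hw, add_comm]
      · intro hw
        simp only [cnt, siz, pathIdx, hw]
        have := pathIdx_lt w c
        simp only [Bool.false_eq_true, if_false, add_zero]
        rw [topPart, if_neg (by omega), Nat.add_sub_cancel,
          show c + 1 - cnt w c - 1 = c - cnt w c by omega]
        exact this
    generalize hY : topPart (cnt w (c + 1)) (c + 1 - cnt w (c + 1)) (siz w (c + 1)) = Y at hy
    have hYlt : Y * q ^ siz w n < q ^ (L + N + 1) := by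
      have hYP : Y ≤ boxPart (cnt w (c + 1)) (c + 1 - cnt w (c + 1)) (siz w (c + 1)) :=
        hY ▸ topPart_le_boxPart (by omega) _
      have h3 : Y < q ^ L := hYP.trans_lt (hp.part_lt _ _ _ hN1)
      calc Y * q ^ siz w n < q ^ L * q ^ siz w n := Nat.mul_lt_mul_of_pos_right h3 (by positivity)
        _ = q ^ (L + siz w n) := (pow_add _ _ _).symm
        _ ≤ _ := Nat.pow_le_pow_right (by omega) (by
          have := hc.siz_le_N hp le_rfl
          omega)
    have hzlt : q ^ siz w n * pathIdx w (c + 1) + T < q ^ (L + N + 1) := by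
      have := Nat.mul_le_mul_left (q ^ siz w n) (pathIdx_mono w (show c + 1 ≤ n from hcn))
      omega
    have hiff := mul_pow_le_iff (y := Y) (u := pathIdx w (c + 1)) hTlt
    have e12 : (Expr.sub (.sub (.reg 1) (.lit 1)) (.reg 10)).val s₁ = c := by
      simp only [Expr.val, i1 1 (by omega), hs.r1, h10]; omega
    refine Tri.time (Tri.set_seq (by decide) (fun _ => ?_) <|
      Tri.seq (T₂ := 200 * (L + N + 2) + 100 * (k + 1) + 100) (topArgs_spec (a := cnt w (c + 1))
        (c := c) (r := siz w (c + 1)) (m := siz w n) hp (hs₁.setReg (by omega)) ?_ ?_ ?_ ?_ ?_ hk1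
        (by omega) hN1) ?_) ?_
    · rw [e12]; omega
    · rw [State.setReg_arr, i5]; exact hF
    · simp [i2]
    · simp [i3]
    · simp [i4]
    · rw [e12]; simp
    · rintro s₂ ⟨j1, j2, j3, j4⟩
      rw [e12] at j1
      rw [hY] at j4
      have hs₂ := (hs₁.setReg (v := c) (show 7 ≤ 12 by omega)).congr fun r hr => j1 r (by omega)
      have r2 : ∀ r < 12, s₂.reg r = s₁.reg r := fun r hr => by
        rw [j1 r (by omega), State.setReg_reg, if_neg (by omega)]
      have r12 : s₂.reg 12 = c := by rw [j1 12 (by omega)]; simp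
      have a2 : s₂.arr = s₁.arr := by rw [j2, State.setReg_arr]
      refine Tri.time (Tri.seq (T₂ := 100 * (L + N + 2) + 100 * (k + 1) + 50)
        (subProg_spec (a := 5) hp hs₂ j3 j4 (by omega) (by rw [a2, i6]) hzlt hYlt) ?_)
        (show _ ≤ 200 * (L + N + 2) + 100 * (k + 1) + 100 by omega)
      rintro s₃ ⟨k1, k2, k3, -⟩
      have hs₃ := hs₂.congr fun r hr => k1 r (by omega)
      have r3 : ∀ r < 12, s₃.reg r = s₁.reg r := fun r hr => by rw [k1 r (by omega), r2 r hr]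
      have r3' : s₃.reg 12 = c := by rw [k1 12 (by omega), r12]
      have a3 : ∀ a, a ≠ 5 → s₃.arr a = s₁.arr a := fun a ha => by rw [k2 a ha, a2]
      refine Tri.time (Tri.ite (T₁ := 100 * (k + 1)) (T₂ := 100 * (L + N + 2) + 20) (by decide)
        (fun hb => ?_) (fun hb => ?_)) (by simp [Expr.cost]; omega)
      · have hw : w c = false := by
          cases hw : w c
          · rfl
          · refine absurd (k3.2 (hiff.2 ?_)) hb
            have := hy.1 hw
            omega
        have ecnt : cnt w (c + 1) = cnt w c := by simp [cnt, hw]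
        have esiz : siz w (c + 1) = siz w c + cnt w c := by simp [siz, hw]
        have epath : pathIdx w (c + 1) = pathIdx w c := by simp [pathIdx, hw]
        refine Tri.post (columnProg_spec (a := cnt w c) (r := siz w c) hp hs₃ hk0 hcn
          (by rw [r3 7 (by omega), i2, ecnt]) (by rw [r3 8 (by omega), i3, esiz]) r3') ?_
        rintro s₄ - ⟨l1, l2, l3, l4, l5, l6⟩
        rw [hcj']
        refine ⟨?_, fun r hr => ?_, ?_, ?_, ?_, ?_, ?_, ?_⟩
        · rw [l4, r3 10 (by omega), h10]
        · rw [State.setReg_reg, if_neg (by omega), l1 r (by omega), r3 r (by omega), i1 r hr]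
        · rw [State.setReg_reg, if_neg (by omega), l1 7 (by omega), r3 7 (by omega), i2, ecnt]
        · rw [State.setReg_reg, if_neg (by omega), l2]
        · rw [State.setReg_reg, if_neg (by omega), l3, r3 9 (by omega), i4]
        · rw [State.setReg_arr, l5 2 (by omega), a3 2 (by omega), i5]
        · rw [State.setReg_arr, l5 0 (by omega), a3 0 (by omega), i6, epath]
        · intro t x hx
          rw [State.setReg_arr, l6 t x hx, a3 0 (by omega), a3 1 (by omega), i6, i7 t x hx]
          by_cases hxc : x = c
          · subst hxc
            by_cases ht : t < cnt w x
            · have hpos := siz_add_cnt_le hcn hw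
              rw [if_pos ⟨rfl, ht⟩, if_pos le_rfl, digitArray_add_mul_pow hTlt _ (by omega), hT,
                digit_tabList hc.entry_lt hcn hw ht]
            · rw [if_neg (by omega), if_neg (by omega), if_pos le_rfl,
                hc.zero x hcn hw t (by omega)]
          · rw [if_neg (by omega)]
            by_cases hlt : c ≤ x
            · rw [if_pos (by omega), if_pos hlt]
            · rw [if_neg (by omega), if_neg hlt]
      · have hw : w c = true := by
          cases hw : w c
          · have h4 := hy.2 hw
            have h5 := hiff.1 (k3.1 hb)
            omega
          · rfl
        have hYle : Y * q ^ siz w n ≤ q ^ siz w n * pathIdx w (c + 1) + T := k3.1 hb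
        have ecnt : cnt w (c + 1) = cnt w c + 1 := by simp [cnt, hw]
        have esiz : siz w (c + 1) = siz w c := by simp [siz, hw]
        have ediff : q ^ siz w n * pathIdx w (c + 1) + T - Y * q ^ siz w n =
            q ^ siz w n * pathIdx w c + T := by
          rw [← hy.1 hw, mul_add, mul_comm Y]
          omega
        refine Tri.time (Tri.seq (T₂ := 20) (subProg_spec (a := 0) hp hs₃
          (by rw [k1 21 (by omega), j3])
          (j4.congr (k1 20 (by omega)) (k1 22 (by omega)) (k2 2 (by omega))) (by omega)
          (by rw [a3 0 (by omega), i6]) hzlt hYlt) ?_) le_rfl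
        rintro s₄ ⟨l1, l2, -, l4⟩
        have r4 : ∀ r < 12, s₄.reg r = s₁.reg r := fun r hr => by rw [l1 r (by omega), r3 r hr]
        have r4' : s₄.reg 12 = c := by rw [l1 12 (by omega), r3']
        have l4 := l4 rfl hYle
        rw [ediff] at l4
        have e7 : (Expr.sub (.reg 7) (.lit 1)).val s₄ = cnt w c := by
          simp only [Expr.val, r4 7 (by omega), i2, ecnt]; omega
        refine Tri.time (Tri.set_seq (by decide) (fun _ => ?_) <|
          Tri.store (by decide) (by decide) (fun _ => ?_) ?_) (by decide)
        · rw [e7]; omega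
        · simp only [Expr.val]; omega
        · rw [e7, hcj']
          have ei : (Expr.add (.mul (.reg 7) (.reg 1)) (.reg 12)).val (s₄.setReg 7 (cnt w c)) =
              cnt w c * n + c := by
            simp [Expr.val, r4 1, i1 1, hs.r1, r4']
          rw [ei]
          refine ⟨by simp [r4 10, h10], fun r hr => ?_, by simp, ?_, ?_, ?_, ?_, ?_⟩
          · simp [show r ≠ 10 by omega, show r ≠ 7 by omega, r4 r (by omega), i1 r hr]
          · simp [r4 8, i3, esiz]
          · simp [r4 9, i4]
          · rw [State.setReg_arr, State.setCell_arr_ne _ _ _ (by omega), State.setReg_arr,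
              l2 2 (by omega), a3 2 (by omega), i5]
          · rw [State.setReg_arr, State.setCell_arr_ne _ _ _ (by omega), State.setReg_arr, l4]
          · intro t x hx
            simp only [State.setReg_arr, State.setCell_arr_self, Expr.val]
            by_cases he : t * n + x = cnt w c * n + c
            · obtain ⟨rfl, rfl⟩ := mul_add_inj hx hcn he
              rw [if_pos rfl, if_pos le_rfl, hc.pivot x hcn hw, if_pos rfl]
            · rw [if_neg he, l2 1 (by omega), a3 1 (by omega), i7 t x hx]
              by_cases hxc : x = c
              · subst hxc
                rw [if_neg (by omega), if_pos le_rfl, hc.pivot x hcn hw, if_neg]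
                rintro rfl
                exact he rfl
              · by_cases hlt : c ≤ x
                · rw [if_pos (by omega), if_pos hlt]
                · rw [if_neg (by omega), if_neg hlt]
    · simp [Expr.cost]; omega
  · rintro s' - ⟨-, -, -, -, -, -, -, i7⟩ t x hx
    rw [i7 t x hx, if_pos (by omega)]
  · simp only [Expr.cost]
    nlinarith

/-- The decoding program. -/
def decProg : Prog :=
  .seq setupProg <| .seq tableProg <| .seq sizeProg columnsProg

theorem decProg_spec {q n k h N L D : ℕ} {w : ℕ → Bool} {M : ℕ → ℕ → ℕ}
    (hp : Params q n k h N L D) (hc : Coded q n k h N L w M)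
    (hL : L = 5 * (Nat.sqrt N + 1)) {s : State} (h0 : s.reg 0 = q) (h1 : s.reg 1 = n)
    (h2 : s.reg 2 = k)
    (hA : s.arr 0 = digitArray q (tailCount q k h N (siz w n + 1) +
        (q ^ siz w n * pathIdx w n + numOf q (tabList w M n))))
    (hz : ∀ i, s.arr 1 i = 0) :
    Tri q D decProg (100 * (N + 1) + 1000 * ((k + 1) * (h + 1) * (N + 1) * (L + 1)) +
        500 * ((N + 1) * (L + N + 2)) + 500 * ((n + 1) * (L + N + k + 3)))
      (fun s' => ∀ t, ∀ x < n, s'.arr 1 (t * n + x) = M t x) s := by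
  have hR : q ^ siz w n * pathIdx w n + numOf q (tabList w M n) <
      boxPart k h (siz w n) * q ^ siz w n := by
    have h3 := pathIdx_lt w n
    have hkn := hp.n_eq
    rw [hc.cnt_eq, show n - k = h by omega] at h3
    have h4 := Nat.mul_le_mul_right (q ^ siz w n) (Nat.succ_le_of_lt h3)
    rw [Nat.succ_eq_add_one, add_mul, mul_comm (pathIdx w n)] at h4
    have := hc.tab_lt
    omega
  refine Tri.time (Tri.seq (setupProg_spec hp hL h0 h1 h2) fun s₁ ⟨i1, i2⟩ =>
    Tri.seq (tableProg_spec hp i1) fun s₂ ⟨j1, j2, j3⟩ =>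
    have hs₂ := i1.congr fun r hr => j1 r (by omega)
    Tri.seq (sizeProg_spec hp hs₂ j3 (hc.siz_le_N hp le_rfl) hR
      (by rw [j2 0 (by omega), i2, hA]) hc.idx_lt) fun s₃ ⟨k1, k2, k3, k4, k5⟩ =>
    columnsProg_spec hp hc (hs₂.congr k1) (by rw [k4]; exact j3) rfl k2 k5
      (fun i => by rw [k3, j2 1 (by omega), i2, hz i])) ?_
  omega

end Decoder

/-! ### Bounds on the registers and the running time -/

section Main

/-- With b = n + q the factors of the table size are at most b, b, b² and b³, so the table ends
below b^7; the exponent 8 leaves room for the remaining terms. L comes from `boxPart_lt` at s = √N +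
1, together with 2 ≤ q. -/
theorem params_of_lt {q n k : ℕ} (hq : 2 ≤ q) (hk : 0 < k) (hkn : k < n) :
    Params q n k (n - k) (k * (n - k)) (5 * (Nat.sqrt (k * (n - k)) + 1)) ((n + q) ^ 8) := by
  obtain ⟨h, rfl⟩ := Nat.exists_eq_add_of_lt hkn
  rw [show k + h + 1 - k = h + 1 by omega]
  refine ⟨hq, by omega, hk, by omega, rfl, fun a b i hi => ?_, ?_⟩
  · have h1 : k * (h + 1) ≤ (Nat.sqrt (k * (h + 1)) + 1) ^ 2 := (Nat.lt_succ_sqrt' _).le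
    exact (boxPart_lt (Nat.succ_pos _) h1 hi a b).trans_le (Nat.pow_le_pow_left hq _)
  · have hN : k * (h + 1) + 1 ≤ (k + h + 1) ^ 2 := by nlinarith
    have hs : Nat.sqrt (k * (h + 1)) < k + h + 1 := Nat.sqrt_lt'.2 (by omega)
    generalize Nat.sqrt (k * (h + 1)) = s at *
    generalize k * (h + 1) = N at *
    generalize hb : k + h + 1 + q = b at *
    have hb4 : 4 ≤ b := by omega
    have h1 : k + 1 ≤ b := by omega
    have h2 : h + 1 + 1 ≤ b := by omega
    have h3 : N + 1 ≤ b ^ 2 := hN.trans (Nat.pow_le_pow_left (by omega) 2)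
    have hb2 : 16 ≤ b ^ 2 := by nlinarith
    have h4 : 5 * (s + 1) ≤ b ^ 3 := by
      rw [pow_succ]
      nlinarith
    have h5 : (k + 1) * (h + 1 + 1) * (N + 1) * (5 * (s + 1)) ≤ b * b * b ^ 2 * b ^ 3 :=
      Nat.mul_le_mul (Nat.mul_le_mul (Nat.mul_le_mul h1 h2) h3) h4
    have h6 : b * b * b ^ 2 * b ^ 3 = b ^ 7 := by ring
    have h7 : b ^ 8 = b ^ 7 * b := by ring
    have h8 : b ^ 7 = b ^ 3 * (b ^ 2 * b ^ 2) := by ring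
    have h9 : b ^ 3 = b ^ 2 * b := by ring
    have h10 : b ^ 2 ≤ b ^ 3 := by nlinarith
    have h11 : b ≤ b ^ 2 := by nlinarith
    have h12 : b ^ 3 * 4 ≤ b ^ 7 := by
      rw [h8]
      exact Nat.mul_le_mul_left _ (by nlinarith)
    have h13 : b ^ 7 * 4 ≤ b ^ 7 * b := Nat.mul_le_mul_left _ hb4
    omega

variable {F : Type*} {n k q : ℕ}

theorem matrixArray_apply (e : F ≃ Fin q) (M : Matrix (Fin k) (Fin n) F) (t : ℕ) {c : ℕ}
    (hc : c < n) : matrixArray e M (t * n + c) = entryFn e M t c := by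
  unfold matrixArray entryFn
  by_cases ht : t < k
  · have h1 : t * n + c < k * n := by nlinarith
    rw [dif_pos h1, dif_pos ⟨ht, hc⟩]
    have e1 : Fin.divNat (⟨t * n + c, h1⟩ : Fin (k * n)) = ⟨t, ht⟩ := by
      ext
      simp [Fin.divNat, mul_comm t, Nat.mul_add_div (show n > 0 by omega), Nat.div_eq_of_lt hc]
    have e2 : Fin.modNat (⟨t * n + c, h1⟩ : Fin (k * n)) = ⟨c, hc⟩ := by
      ext
      simp [Fin.modNat, Nat.mod_eq_of_lt hc]
    rw [e1, e2]
  · have h1 : ¬ t * n + c < k * n := by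
      have := Nat.mul_le_mul_right n (not_lt.1 ht)
      omega
    rw [dif_neg h1, dif_neg (by tauto)]

theorem matrixArray_lt (hq : 0 < q) (e : F ≃ Fin q) (M : Matrix (Fin k) (Fin n) F) (j : ℕ) :
    matrixArray e M j < q := by
  unfold matrixArray
  split
  · exact Fin.is_lt _
  · exact hq

/-- The row index is unbounded in the hypothesis, so the zeros behind the matrix are covered too;
the output is compared as a whole array. -/
theorem eq_matrixArray (hn : 0 < n) (e : F ≃ Fin q) (M : Matrix (Fin k) (Fin n) F) {f : ℕ → ℕ}
    (hf : ∀ t, ∀ c < n, f (t * n + c) = entryFn e M t c) : f = matrixArray e M := by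
  funext p
  have h1 := Nat.mod_lt p hn
  have h2 : p / n * n + p % n = p := Nat.div_add_mod' p n
  rw [← h2, hf _ _ h1, matrixArray_apply e M _ h1]

theorem good_initState {q n k D : ℕ} (hD : 5 ≤ D) (hq : 2 * q ≤ D) (hn : n ≤ D) (hk : k ≤ n)
    (hq0 : 0 < q) {input : ℕ → ℕ} (hi : ∀ j, input j < q) :
    Good q D (initState q n k input) := by
  refine ⟨hD, hq, fun r => ?_, fun a i => ?_⟩
  · simp only [initState]
    split_ifs <;> omega
  · simp only [initState]
    split_ifs
    · exact hi i
    · exact hq0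

variable [Field F]

theorem coded_rref (hq : 2 ≤ q) (e : F ≃ Fin q) (he0 : (e 0 : ℕ) = 0) (he1 : (e 1 : ℕ) = 1)
    {L : ℕ} (hL : ∀ i ≤ k * (n - k), boxPart k (n - k) i < q ^ L) (X : Grassmannian F n k) :
    Coded q n k (n - k) (k * (n - k)) L (pivotFn (idVec X)) (entryFn e (rref X)) := by
  have hX := shape_rref X
  refine ⟨hX.cnt_eq, entryFn_lt (by omega) e _, fun c hc hw t => ?_, fun c hc hw t ht => ?_, ?_⟩
  · by_cases htk : t < k
    · have h1 := hX.pivot ⟨t, htk⟩ ⟨c, hc⟩ hw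
      rw [entryFn, dif_pos ⟨htk, hc⟩, h1]
      dsimp only
      split
      · exact he1
      · exact he0
    -- Below the last row `entryFn` has the default value 0, which is consistent because a pivot row
    -- has number less than `k`.
    · have h1 := cnt_lt_cnt hc hw
      rw [hX.cnt_eq] at h1
      rw [entryFn, dif_neg (by tauto), if_neg (by omega)]
  · by_cases htk : t < k
    · rw [entryFn, dif_pos ⟨htk, hc⟩, hX.zero ⟨t, htk⟩ ⟨c, hc⟩ hw ht, he0]
    · rw [entryFn, dif_neg (by tauto)]
  · exact (grassIdx_lt_tailCount (by omega) e X).trans (tailCount_lt hq hL)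

/-- The running times of the two programs, in terms of `N = k * h` and `r = √N`. -/
theorem time_le {n k h N r L : ℕ} (hn : n = k + h) (hk : 0 < k) (hh : 0 < h) (hN : N = k * h)
    (hr : r = Nat.sqrt N) (hL : L = 5 * (r + 1)) :
    100 * (N + 1) + 1000 * ((k + 1) * (h + 1) * (N + 1) * (L + 1)) +
        200 * (n * (k + 1) + 1) + 300 * ((N + 1) * (L + N + 2)) + 300 * ((n + 1) * (L + N + 2)) ≤
      200000 * (N ^ 2 * r) ∧
    100 * (N + 1) + 1000 * ((k + 1) * (h + 1) * (N + 1) * (L + 1)) +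
        500 * ((N + 1) * (L + N + 2)) + 500 * ((n + 1) * (L + N + k + 3)) ≤
      200000 * (N ^ 2 * r) := by
  have hN1 : 1 ≤ N := by rw [hN]; exact Nat.mul_pos hk hh
  have hr1 : 1 ≤ r := by rw [hr]; exact Nat.sqrt_pos.2 hN1
  have hrN : r ≤ N := hr ▸ Nat.sqrt_le_self N
  have hkN : k ≤ N := hN ▸ Nat.le_mul_of_pos_right k hh
  have hnN : n ≤ 2 * N := by
    obtain ⟨a, rfl⟩ := Nat.exists_eq_add_of_lt hk
    obtain ⟨b, rfl⟩ := Nat.exists_eq_add_of_lt hh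
    nlinarith
  have hNN : N ≤ N ^ 2 := by nlinarith
  have hP : N ^ 2 ≤ N ^ 2 * r := Nat.le_mul_of_pos_right _ hr1
  have h1 : (k + 1) * (h + 1) ≤ 4 * N := by
    rw [hN]
    calc (k + 1) * (h + 1) ≤ (2 * k) * (2 * h) := Nat.mul_le_mul (by omega) (by omega)
      _ = _ := by ring
  have h2 : (k + 1) * (h + 1) * (N + 1) * (L + 1) ≤ 88 * (N ^ 2 * r) :=
    -- The dominating term, with L + 1 = 5r + 6 ≤ 11r. All other terms are O(N²).
    calc (k + 1) * (h + 1) * (N + 1) * (L + 1) ≤ (4 * N) * (2 * N) * (11 * r) :=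
          Nat.mul_le_mul (Nat.mul_le_mul h1 (by omega)) (by omega)
      _ = _ := by ring
  have h3 : n * (k + 1) ≤ 4 * N ^ 2 :=
    calc n * (k + 1) ≤ (2 * N) * (2 * N) := Nat.mul_le_mul hnN (by omega)
      _ = _ := by ring
  have h4 : (N + 1) * (L + N + 2) ≤ 26 * N ^ 2 :=
    calc (N + 1) * (L + N + 2) ≤ (2 * N) * (13 * N) := Nat.mul_le_mul (by omega) (by omega)
      _ = _ := by ring
  have h5 : (n + 1) * (L + N + 2) ≤ 39 * N ^ 2 :=
    calc (n + 1) * (L + N + 2) ≤ (3 * N) * (13 * N) := Nat.mul_le_mul (by omega) (by omega)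
      _ = _ := by ring
  have h6 : (n + 1) * (L + N + k + 3) ≤ 45 * N ^ 2 :=
    calc (n + 1) * (L + N + k + 3) ≤ (3 * N) * (15 * N) := Nat.mul_le_mul (by omega) (by omega)
      _ = _ := by ring
  constructor <;> omega

theorem sq_mul_sqrt_le {n k : ℕ} (hkn : k ≤ n) :
    (((k * (n - k)) ^ 2 * Nat.sqrt (k * (n - k)) : ℕ) : ℝ) ≤
      (k : ℝ) ^ (5 / 2 : ℝ) * ((n : ℝ) - k) ^ (5 / 2 : ℝ) := by
  rw [← Nat.cast_sub hkn, ← Real.mul_rpow (Nat.cast_nonneg _) (Nat.cast_nonneg _),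
    ← Nat.cast_mul]
  generalize k * (n - k) = N
  have h1 : (N : ℝ) ^ (5 / 2 : ℝ) = (N : ℝ) ^ 2 * √(N : ℝ) := by
    rw [show (5 / 2 : ℝ) = 2 + 1 / 2 by norm_num, Real.rpow_add_of_nonneg (Nat.cast_nonneg _)
      (by norm_num) (by norm_num), Real.sqrt_eq_rpow, Real.rpow_two]
  rw [h1]
  push_cast
  exact mul_le_mul_of_nonneg_left Real.nat_sqrt_le_real_sqrt (by positivity)

end Main

end GrassmannEnc

open GrassmannEnc in
/-- The encoding `X ↦ Ind₁(X)` of the Grassmannian and the decoding `i ↦ Ind₁⁻¹(i)` take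
`O(k^{5/2} (n - k)^{5/2})` digit operations; the two programs and the constants do not depend on
`q`, `n` and `k`. Subspaces are given by their reduced row echelon forms, indices by their
base-`q` digits; registers and addresses have `O(log (n + q))` bits. -/
theorem mainTheorem5 :
    ∃ (enc dec : GrassmannEnc.Prog) (C : ℝ) (w : ℕ),
      ∀ (F : Type*) [Field F] [Fintype F] (e : F ≃ Fin (Fintype.card F)),
        (e 0 : ℕ) = 0 → (e 1 : ℕ) = 1 →
        ∀ n k : ℕ, 0 < k → k < n →
          (∀ X : GrassmannEnc.Grassmannian F n k,
            GrassmannEnc.ComputesWithin enc (Fintype.card F) n k ((n + Fintype.card F) ^ w)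
              (GrassmannEnc.matrixArray e (GrassmannEnc.rref X))
              (GrassmannEnc.digitArray (Fintype.card F) (GrassmannEnc.ind₁ e X))
              (C * ((k : ℝ) ^ (5 / 2 : ℝ) * ((n : ℝ) - k) ^ (5 / 2 : ℝ)))) ∧
          (∀ i < Nat.card (GrassmannEnc.Grassmannian F n k),
            ∃ X : GrassmannEnc.Grassmannian F n k, GrassmannEnc.ind₁ e X = i ∧
              GrassmannEnc.ComputesWithin dec (Fintype.card F) n k ((n + Fintype.card F) ^ w)
                (GrassmannEnc.digitArray (Fintype.card F) i)
                (GrassmannEnc.matrixArray e (GrassmannEnc.rref X))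
                (C * ((k : ℝ) ^ (5 / 2 : ℝ) * ((n : ℝ) - k) ^ (5 / 2 : ℝ)))) := by
  -- The exponent combines the register bound (n + q)^8 with the 64 leaves allowed in an expression;
  -- the constant is the one from `time_le`.
  refine ⟨encProg, decProg, 200000, 8 * 64, fun F _ _ e he0 he1 n k hk hkn => ?_⟩
  have hq : 2 ≤ Fintype.card F := Fintype.one_lt_card
  generalize Fintype.card F = q at *
  have hp := params_of_lt hq hk hkn
  obtain ⟨htE, htD⟩ := time_le hp.n_eq hk hp.h_pos rfl rfl rfl
  have hreal := sq_mul_sqrt_le hkn.le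
  have hqD : n + q ≤ (n + q) ^ 8 := Nat.le_self_pow (by norm_num) _
  have hqD2 : 2 * q ≤ (n + q) ^ 8 :=
    calc 2 * q ≤ (n + q) ^ 2 := by nlinarith
      _ ≤ _ := Nat.pow_le_pow_right (by omega) (by norm_num)
  have h5 : 5 ≤ (n + q) ^ 8 := by
    have := hp.le_D
    omega
  have hcoded := coded_rref (n := n) (k := k) hq e he0 he1 (fun i hi => hp.part_lt k (n - k) i hi)
  have hgood : ∀ input : ℕ → ℕ, (∀ j, input j < q) →
      Good q ((n + q) ^ 8) (initState q n k input) := fun input hi =>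
    good_initState h5 hqD2 (by omega) hkn.le (by omega) hi
  have htime : ∀ t T : ℕ, t ≤ T →
      T ≤ 200000 * ((k * (n - k)) ^ 2 * Nat.sqrt (k * (n - k))) →
      (t : ℝ) ≤ 200000 * ((k : ℝ) ^ (5 / 2 : ℝ) * ((n : ℝ) - k) ^ (5 / 2 : ℝ)) := by
    intro t T h1 h2
    have h3 : (t : ℝ) ≤
        ((200000 * ((k * (n - k)) ^ 2 * Nat.sqrt (k * (n - k))) : ℕ) : ℝ) := by
      exact_mod_cast h1.trans h2
    refine h3.trans ?_
    rw [Nat.cast_mul]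
    exact mul_le_mul_of_nonneg_left hreal (by norm_num)
  rw [pow_mul]
  constructor
  · intro X
    obtain ⟨t, s, h1, h2, -, h4⟩ := encProg_spec hp (hcoded X) rfl
      (s := initState q n k (matrixArray e (rref X))) rfl rfl rfl
      (fun t c hc => matrixArray_apply e (rref X) t hc) (fun _ => rfl)
      (hgood _ (matrixArray_lt (by omega) e _))
    refine ⟨t, s, h1, ?_, htime t _ h2 htE⟩
    rw [h4, ind₁_eq_grassIdx hq e hkn.le]
    rfl
  · intro i hi
    rw [card_grassmannian hq e hkn.le] at hi
    obtain ⟨X, hX⟩ := exists_grassIdx_eq hq e hkn.le hi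
    refine ⟨X, by rw [ind₁_eq_grassIdx hq e hkn.le, hX], ?_⟩
    obtain ⟨t, s, h1, h2, -, h4⟩ := decProg_spec hp (hcoded X) rfl
      (s := initState q n k (digitArray q i)) rfl rfl rfl
      (by rw [← hX]; rfl) (fun _ => rfl) (hgood _ (digitArray_lt (by omega) i))
    exact ⟨t, s, h1, eq_matrixArray (by omega) e _ h4, htime t _ h2 htD⟩
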